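/- **Setting.** Let $n\ge 1$, $\theta>0$, and let vertex $i\in\{1,\dots,n\}$ have type ${\bf W}_i=(W_i^+,W_i^-,Q_i,\zeta_i)\in\mathbb R_+^2\times\mathbb R^2$; put $\mathscr W_n=({\bf W}_1,\dots,{\bf W}_n)$. Let $q_{ij}^{(n)}=W_i^-W_j^+/(\theta n)$ for $1\le i,j\le n$, and let $\varphi_{ij}(n)>-1$ ($i\ne j$) be measurable functions of $\mathscr W_n$. Given the types, the random digraph $\mathcal G(V_n,E_n)$ on $V_n=\{1,\dots,n\}$ has independent edges, no self-loops, and edge $(i,j)$, $i\neq j$, is present with probability $p_{ij}^{(n)}=1\wedge q_{ij}^{(n)}(1+\varphi_{ij}(n))$; $\xi$ is a uniformly chosen vertex, independent of the graph. $\mathbb P_{\bf W}$ denotes conditional probability given the types. *In-exploration.* $A_0=T_0=\{\xi\}$; $A_{k+1}$ is the set of vertices outside $T_k$ that have an edge to a vertex of $A_k$, and $T_{k+1}=T_k\cup A_{k+1}$. The set of inactive vertices after step $k$, $I_{|T_k|}$, consists of the vertices outside $T_k$ that receive an edge from a vertex of $T_k$. *Poisson branching tree (PBT).* A marked multi-type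 branching process whose root has a uniformly chosen type. An individual of type ${\bf W}_i$ has independent Poisson$(q_{ji}^{(n)})$ numbers of offspring of type ${\bf W}_j$, $1\le j\le n$, the offspring being labelled in uniformly random order; independently, it has independent Poisson$(q_{it}^{(n)})$ numbers of inactive nodes of type ${\bf W}_t$, $1\le t\le n$, and its mark $\mathcal D$ is one plus the total number of its inactive nodes (so that $\mathcal D-1$ is Poisson with mean $W_i^-\sum_tW_t^+/(\theta n)$). All individuals behave independently given their types. $\hat A_k$ is the set of nodes of generation $k$, $\hat T_k=\hat A_0\cup\dots\cup\hat A_k$, and $\hat I_{|\hat T_k|}$ is the set of inactive nodes of the individuals in $\hat T_k$. *Breaking of a coupling.* The coupling holds up to step $k$ if the exploration up to distance $k$ is identical to the tree: for every $0\le l\le k$, taking types is a bijection from $\hat A_l$ onto $A_l$ and from $\hat I_{|\hat T_l|}$ onto $I_{|T_l|}$, every non-root node in $\hat T_k$ corresponds to a vertex with an edge to the vertex of its parent, and the inactive nodes of each node in $\hat T_k$ are exactly the outbound neighbours of its vertex other than the vertex of its parent. Let $\tau$ be the first step at which the coupling breaks ($\tau=\infty$ if there is none). For $\eta\in(0,1]$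 define $$B_i=\Big\{\max_{j\ne i}|\varphi_{ji}(n)|\le n^{-\eta},\ \max_{1\le j\le n}q_{ji}^{(n)}\le \tfrac14\Big\},\qquad \tilde B_i=\Big\{\max_{j\ne i}|\varphi_{ij}(n)|\le n^{-\eta},\ \max_{1\le j\le n}q_{ij}^{(n)}\le \tfrac14\Big\},$$ and let $\mu_n=(\theta n)^{-1}\sum_{i=1}^nW_i^+W_i^-$. **Theorem.** There exist random variables $\mathcal H_{n,\delta}$, $n\geq 1$, $\delta\in(0,1]$, each a measurable function of $\mathscr W_n$ (and of $n,\delta,\theta$) only, such that the following holds. (i) For every $n\ge1$ there is a coupling, given the types, of $(\xi,\mathcal G(V_n,E_n))$ with a PBT such that for all $\delta,\eta\in(0,1]$, all $x_n\ge1$ and all $k\in\mathbb N=\{0,1,2,\dots\}$, with $\gamma=\min\{\delta/2,\eta\}$ and empty sums equal to $0$, $$\begin{aligned}\mathbb P_{\bf W}(\tau\le k)\le \mathcal H_{n,\delta}\Big(&x_n^{-1}+n^{-\delta}+n^{-\eta}+n^{-\delta}x_n\sum_{m=1}^k\sum_{r=0}^{m-1}\mu_n^{m+r}+n^{-\gamma}\sum_{m=1}^k\mu_n^m\\&+n^{-1}\sum_{i=1}^n1(\tilde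 B_i^c)+1(k\ge1)\,n^{-1}\sum_{i=1}^n1(B_i^c)+n^{-1}\sum_{i=1}^n1(B_i^c\cup\tilde B_i^c)W_i^-\sum_{m=1}^k\mu_n^m\Big).\end{aligned}$$ (ii) Suppose the types ${\bf W}_1,{\bf W}_2,\dots$ are i.i.d. copies of $(W^+,W^-,Q,\zeta)$ with $\theta=E[W^++W^-]>0$, $E[(W^+)^{1+\delta}+(W^-)^2+|Q|]<\infty$ for some $\delta\in(0,1]$, $|\zeta|\le c$ a.s. for some $c\in(0,1)$, and $(W^+,Q)$ independent of $(W^-,\zeta)$. Then $\lim_{n\to\infty}\mathcal H_{n,\delta}=\mathcal H_\delta$ a.s. for some finite constant $\mathcal H_\delta$. -/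

import Mathlib

open MeasureTheory ProbabilityTheory Filter Topology
open scoped NNReal ENNReal

noncomputable section

namespace InhomDigraph

/-! ### Types, edge probabilities and the random digraph -/

/-- A vertex type `(W⁺, W⁻, Q, ζ) ∈ ℝ₊² × ℝ²`. -/
abbrev VType : Type := ℝ≥0 × ℝ≥0 × ℝ × ℝ

/-- `W⁺`, the in-degree parameter. -/
def VType.wIn (v : VType) : ℝ := (v.1 : ℝ)

/-- `W⁻`, the out-degree parameter. -/
def VType.wOut (v : VType) : ℝ := (v.2.1 : ℝ)

/-- `Q`, the personalization value. -/
def VType.pers (v : VType) : ℝ := v.2.2.1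

/-- `ζ`, the weight. -/
def VType.damp (v : VType) : ℝ := v.2.2.2

/-- The types of the `n` vertices. -/
abbrev Types (n : ℕ) : Type := Fin n → VType

variable {n : ℕ}

/-- `q i j = Wᵢ⁻ Wⱼ⁺ / (θ n)`: in the branching tree, the mean number of offspring of type `i`
of an individual of type `j`. -/
def q (θ : ℝ) (w : Types n) (i j : Fin n) : ℝ :=
  (w i).wOut * (w j).wIn / (θ * n)

/-- `p i j = 1 ∧ (Wᵢ⁻ Wⱼ⁺ / (θ n)) (1 + φᵢⱼ)` for `i ≠ j`; there are no self-loops. -/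
def p (θ : ℝ) (w : Types n) (φ : Fin n → Fin n → ℝ) (i j : Fin n) : ℝ :=
  if i = j then 0 else min 1 (q θ w i j * (1 + φ i j))

/-- A directed graph on the vertex set `Fin n`: `X i j = true` iff there is an edge from `i`
to `j`. -/
abbrev Adj (n : ℕ) : Type := Fin n → Fin n → Bool

/-- The law of an indicator with success probability `r ∈ [0, 1]`. -/
def edgeLaw (r : ℝ) : Measure Bool :=
  ENNReal.ofReal r • Measure.dirac true + ENNReal.ofReal (1 - r) • Measure.dirac false

/-- The law of the random digraph: independent edges, edge `(i, j)` with probability `p i j`. -/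
def graphLaw (θ : ℝ) (w : Types n) (φ : Fin n → Fin n → ℝ) : Measure (Adj n) :=
  Measure.pi fun i => Measure.pi fun j => edgeLaw (p θ w φ i j)

/-- The uniform distribution on the vertices. -/
def unifVertex (n : ℕ) : Measure (Fin n) := uniformOn Set.univ

/-! ### The breadth-first in-exploration of a digraph from a vertex `ξ` -/

mutual

/-- `A k`: the active vertices at the end of step `k`.  Step `k + 1` explores the inbound
neighbours of the vertices of `A k` and activates those not explored or activated before. -/
def active (X : Adj n) (ξ : Fin n) : ℕ → Set (Fin n)
  | 0 => {ξ}
  | k + 1 => {j | (∃ i ∈ active X ξ k, X j i = true) ∧ j ∉ component X ξ k}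

/-- `T k = A 0 ∪ ⋯ ∪ A k`: the vertices with a directed path of length at most `k` to `ξ`. -/
def component (X : Adj n) (ξ : Fin n) : ℕ → Set (Fin n)
  | 0 => {ξ}
  | k + 1 => component X ξ k ∪
      {j | (∃ i ∈ active X ξ k, X j i = true) ∧ j ∉ component X ξ k}

end

/-- The inactive vertices at the end of step `k`: the outbound neighbours of the vertices
of `T k` that do not belong to `T k` themselves. -/
def inactive (X : Adj n) (ξ : Fin n) (k : ℕ) : Set (Fin n) :=
  {t | (∃ j ∈ component X ξ k, X j t = true) ∧ t ∉ component X ξ k}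

/-! ### Marked multi-type trees and the Poisson branching tree -/

instance instMeasurableSpaceListFin : MeasurableSpace (List (Fin n)) := ⊤

/-- The data of a position of the Ulam–Harris tree: `none` if no individual sits there, and
otherwise the type `s` of the individual there, together with its inactive nodes, `d t` of them
having type `t`.  The mark of the individual is `1 + ∑ t, d t`. -/
abbrev Label (n : ℕ) : Type := Option (Fin n × (Fin n → ℕ))

instance instMeasurableSpaceLabel : MeasurableSpace (Label n) := ⊤

/-- A marked multi-type tree.  The root is `[]` and the children of `u` are `0 :: u`, `1 :: u`,
…, so that the node `(i₁, …, iₖ)` is written `[iₖ, …, i₁]` with indices starting from `0`. -/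
abbrev MarkedTree (n : ℕ) : Type := List ℕ → Label n

/-- What an individual produces: its inactive nodes (counted by type), and the list of the types
of its offspring in the order in which they are labelled. -/
abbrev Litter (n : ℕ) : Type := (Fin n → ℕ) × List (Fin n)

/-- The inactive nodes of an individual of type `s`: independent Poisson numbers, with mean
`q s t` for type `t`.  Hence the mark minus one is Poisson with mean `Wₛ⁻ Lₙ⁺ / (θ n)`. -/
def inactiveLaw (θ : ℝ) (w : Types n) (s : Fin n) : Measure (Fin n → ℕ) :=
  Measure.pi fun t => poissonMeasure (q θ w s t).toNNReal

/-- The numbers of offspring of each type of an individual of type `s`: independent Poisson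
numbers, with mean `q j s` for type `j`. -/
def countLaw (θ : ℝ) (w : Types n) (s : Fin n) : Measure (Fin n → ℕ) :=
  Measure.pi fun j => poissonMeasure (q θ w j s).toNNReal

/-- The lists that contain exactly `z j` entries equal to `j`, for every `j`. -/
def arrangements (z : Fin n → ℕ) : Set (List (Fin n)) := {l | ∀ j, l.count j = z j}

/-- The types of the offspring of an individual of type `s`, uniformly permuted: given the
numbers of offspring of each type, all arrangements are equally likely. -/
def offspringLaw (θ : ℝ) (w : Types n) (s : Fin n) : Measure (List (Fin n)) :=
  (countLaw θ w s).bind fun z => uniformOn (arrangements z)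

/-- The inactive nodes and the offspring of an individual of type `s` are independent. -/
def litterLaw (θ : ℝ) (w : Types n) (s : Fin n) : Measure (Litter n) :=
  (inactiveLaw θ w s).prod (offspringLaw θ w s)

/-- The type of the individual at position `u` (if there is one) in the tree with root type `r`
in which an individual of type `s` at position `u` produces `L (u, s)`. -/
def typeAt (r : Fin n) (L : List ℕ × Fin n → Litter n) : List ℕ → Option (Fin n)
  | [] => some r
  | j :: u => (typeAt r L u).bind fun s => (L (u, s)).2[j]?

/-- The tree with root type `r` in which an individual of type `s` at position `u` produces
`L (u, s)`. -/
def grow (r : Fin n) (L : List ℕ × Fin n → Litter n) : MarkedTree n :=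
  fun u => (typeAt r L u).map fun s => (s, (L (u, s)).1)

theorem finite_arrangements (z : Fin n → ℕ) : (arrangements z).Finite := by
  refine (List.finite_length_eq (Fin n) (∑ j, z j)).subset fun l hl => ?_
  have h := Multiset.sum_count_eq_card (s := (Finset.univ : Finset (Fin n)))
    (m := (l : Multiset (Fin n))) (fun a _ => Finset.mem_univ a)
  simp only [Multiset.coe_count, Multiset.coe_card] at h
  exact h.symm.trans (Finset.sum_congr rfl fun j _ => hl j)

theorem nonempty_arrangements (z : Fin n → ℕ) : (arrangements z).Nonempty := by
  refine ⟨(∑ j, z j • ({j} : Multiset (Fin n))).toList, fun j => ?_⟩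
  rw [← Multiset.coe_count, Multiset.coe_toList, Multiset.count_sum']
  simp [Multiset.count_singleton]

instance instProbInactiveLaw (θ : ℝ) (w : Types n) (s : Fin n) :
    IsProbabilityMeasure (inactiveLaw θ w s) := by
  unfold inactiveLaw; infer_instance

instance instProbCountLaw (θ : ℝ) (w : Types n) (s : Fin n) :
    IsProbabilityMeasure (countLaw θ w s) := by
  unfold countLaw; infer_instance

instance instProbOffspringLaw (θ : ℝ) (w : Types n) (s : Fin n) :
    IsProbabilityMeasure (offspringLaw θ w s) := by
  unfold offspringLaw
  refine isProbabilityMeasure_bind (Measurable.of_discrete).aemeasurable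
    (Eventually.of_forall fun z => ?_)
  exact isProbabilityMeasure_uniformOn (finite_arrangements z) (nonempty_arrangements z)

instance instProbLitterLaw (θ : ℝ) (w : Types n) (s : Fin n) :
    IsProbabilityMeasure (litterLaw θ w s) := by
  unfold litterLaw; infer_instance

/-- The law of the marked multi-type Poisson branching tree: the type of the root is uniform,
and individuals produce inactive nodes and offspring independently of each other, according to
their types. -/
def pbtLaw (θ : ℝ) (w : Types n) : Measure (MarkedTree n) :=
  ((unifVertex n).prod
    (Measure.infinitePi fun a : List ℕ × Fin n => litterLaw θ w a.2)).map
      fun x => grow x.1 x.2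

/-- The map defining the law of the tree is measurable. -/
theorem measurable_grow :
    Measurable fun x : Fin n × (List ℕ × Fin n → Litter n) => grow x.1 x.2 := by
  let _ : MeasurableSpace (Option (Fin n)) := ⊤
  have hL : ∀ (u : List ℕ) (s : Fin n),
      Measurable fun x : Fin n × (List ℕ × Fin n → Litter n) => x.2 (u, s) :=
    fun u s => (measurable_pi_apply (u, s)).comp measurable_snd
  have hT : ∀ u : List ℕ,
      Measurable fun x : Fin n × (List ℕ × Fin n → Litter n) => typeAt x.1 x.2 u := by
    intro u
    induction u with
    | nil => exact (Measurable.of_discrete (f := fun r : Fin n => some r)).comp measurable_fst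
    | cons j u ih =>
      have h2 : Measurable fun x : Fin n × (List ℕ × Fin n → Litter n) =>
          (typeAt x.1 x.2 u, fun s => x.2 (u, s)) :=
        ih.prodMk (measurable_pi_lambda _ fun s => hL u s)
      exact (Measurable.of_discrete (f := fun y : Option (Fin n) × (Fin n → Litter n) =>
        y.1.bind fun s => (y.2 s).2[j]?)).comp h2
  refine measurable_pi_lambda _ fun u => ?_
  have h2 : Measurable fun x : Fin n × (List ℕ × Fin n → Litter n) =>
      (typeAt x.1 x.2 u, fun s => x.2 (u, s)) :=
    (hT u).prodMk (measurable_pi_lambda _ fun s => hL u s)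
  exact (Measurable.of_discrete (f := fun y : Option (Fin n) × (Fin n → Litter n) =>
    (y.1.map fun s => (s, (y.2 s).1) : Label n))).comp h2

/-! ### Comparing the exploration with the tree -/

/-- The nodes of generation `k` of the tree. -/
def generation (t : MarkedTree n) (k : ℕ) : Set (List ℕ) :=
  {u | u.length = k ∧ t u ≠ none}

/-- The type of the node at position `u`. -/
def nodeType (t : MarkedTree n) (u : List ℕ) : Option (Fin n) := (t u).map Prod.fst

/-- The inactive nodes of the tree after generation `k` has been added.  The triple `(u, r, m)`
is the `m`-th inactive node of type `r` produced by the node `u`. -/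
def inactiveNodes (t : MarkedTree n) (k : ℕ) : Set (List ℕ × Fin n × ℕ) :=
  {x | x.1.length ≤ k ∧ ∃ s d, t x.1 = some (s, d) ∧ x.2.2 < d x.2.1}

/-- The coupling holds up to step `k`: the in-exploration of `X` from `ξ` up to distance `k` is
identical to the tree.  At each step the active vertices are exactly the types of the nodes of
that generation, and the inactive vertices are exactly the types of the inactive nodes, each
type occurring once; and the parent of each node and its inactive nodes are given by the edges
of the graph. -/
structure HoldsUpTo (X : Adj n) (ξ : Fin n) (t : MarkedTree n) (k : ℕ) : Prop where
  active_eq : ∀ l ≤ k, Set.BijOn (nodeType t) (generation t l) (some '' active X ξ l)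
  inactive_eq : ∀ l ≤ k, Set.BijOn (fun x => x.2.1) (inactiveNodes t l) (inactive X ξ l)
  parent_edge : ∀ u j s d s' d', u.length < k → t u = some (s, d) → t (j :: u) = some (s', d') →
    X s' s = true
  root_inactive : ∀ s d, t [] = some (s, d) → ∀ r, d r = if X s r = true then 1 else 0
  node_inactive : ∀ u j s d s' d', u.length < k → t u = some (s, d) →
    t (j :: u) = some (s', d') → ∀ r, d' r = if X s' r = true ∧ r ≠ s then 1 else 0

/-- An outcome of the coupling: a root vertex and a graph, and a marked tree. -/
abbrev Outcome (n : ℕ) : Type := (Fin n × Adj n) × MarkedTree n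

/-- `τ`: the first step at which the coupling breaks (`⊤` if it never does). -/
def breakStep (ω : Outcome n) : ℕ∞ :=
  ⨅ k ∈ {k : ℕ | ¬ HoldsUpTo ω.1.2 ω.1.1 ω.2 k}, (k : ℕ∞)

/-- `κ` is a coupling, given the types, of the random digraph with an independent uniformly
chosen vertex and of the Poisson branching tree: `κ w` is the conditional law given that the
types are `w`. -/
def IsCoupling (θ : ℝ) (φ : Types n → Fin n → Fin n → ℝ)
    (κ : Kernel (Types n) (Outcome n)) : Prop :=
  ∀ w, (κ w).map Prod.fst = (unifVertex n).prod (graphLaw θ w (φ w)) ∧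
    (κ w).map Prod.snd = pbtLaw θ w

/-! ### The quantities in the bound -/

open Classical in
/-- The indicator of a proposition. -/
def ind (P : Prop) : ℝ := if P then 1 else 0

/-- `μₙ = (θ n)⁻¹ ∑ᵢ Wᵢ⁺ Wᵢ⁻`. -/
def mu (θ : ℝ) (w : Types n) : ℝ := (θ * n)⁻¹ * ∑ i, (w i).wIn * (w i).wOut

/-- The event `Bᵢ`. -/
def B (θ η : ℝ) (w : Types n) (φ : Fin n → Fin n → ℝ) (i : Fin n) : Prop :=
  (∀ j, j ≠ i → |φ j i| ≤ (n : ℝ) ^ (-η)) ∧ ∀ j, q θ w j i ≤ 1 / 4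

/-- The event `B̃ᵢ`. -/
def B' (θ η : ℝ) (w : Types n) (φ : Fin n → Fin n → ℝ) (i : Fin n) : Prop :=
  (∀ j, j ≠ i → |φ i j| ≤ (n : ℝ) ^ (-η)) ∧ ∀ j, q θ w i j ≤ 1 / 4

/-- The assumption on the generic type vector `V = (W⁺, W⁻, Q, ζ)`. -/
structure TypeAssumption {Ω : Type*} [MeasurableSpace Ω] (P : Measure Ω) (V : Ω → VType)
    (δ : ℝ) : Prop where
  delta_pos : 0 < δ
  delta_le : δ ≤ 1
  moment_in : Integrable (fun ω => (V ω).wIn ^ (1 + δ)) P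
  moment_out : Integrable (fun ω => (V ω).wOut ^ 2) P
  moment_pers : Integrable (fun ω => |(V ω).pers|) P
  damp_bound : ∃ c : ℝ, 0 < c ∧ c < 1 ∧ ∀ᵐ ω ∂P, |(V ω).damp| ≤ c
  indep : IndepFun (fun ω => ((V ω).wIn, (V ω).pers)) (fun ω => ((V ω).wOut, (V ω).damp)) P

end InhomDigraph

end

-- Every possible node (a position and a type `s`) carries an independent sample: a whole random
-- digraph together with a litter, coupled so that the edges at `s` and the Poisson numbers of an
-- individual of type `s` agree as far as possible. The tree is grown from the litters alone, so its
-- law is exact. The digraph is assembled breadth first: when a node of type `s` is explored, the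
-- edges at `s` that are still undetermined are taken from its sample. Each sample is fresh when it
-- is read, so this only replaces unrevealed independent edges by an independent copy, and the
-- assembled digraph has exactly the right law (`Exploration.lintegral_assemble`).
--
-- A sample is good if its litter matches the edges at `s`, contains no known type, and gives no
-- type as both offspring and inactive node. Good samples keep all types distinct and all revealed
-- edges accounted for (`Exploration.Inv.advance`), so exploration and tree agree up to generation
-- `k` unless a bad sample is met there (`Exploration.Inv.holdsUpTo`).
--
-- The probability of a bad sample is bounded by an expected cost. An edge of probability `r` and a
-- Poisson number of mean `q` disagree with probability at most `|r - q| + q ^ 2`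
-- (`edgeCoupling_mismatch_le`). A collision with known types is controlled by giving type `j` the
-- weight `n ^ (-δ / 2) * g_j ^ δ`, where `g = 1 + W⁺ + W⁻`: while the known types weigh at most
-- one, both a bad sample at a regular vertex and the expected gain of weight cost `O(n ^ (-γ) * g)`
-- (`badBound_add_le`), and total weight above one is paid for by the weight itself. An induction
-- along the queue (`Exploration.measure_breaks_le`) then bounds the breaking probability by the
-- initial weight plus the expected total cost of the tree. No truncation level is needed: the terms
-- with `x_n` only enlarge the bound.
--
-- The mean matrix `q` has rank one, so the expected total cost is a geometric sum in `μ_n`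
-- (`potential_step`), of the form `∑_{i<k} μ_n ^ i`, whereas the theorem has `∑_{m=1}^k μ_n ^ m`.
-- The factor `μ_n⁻¹` goes into the random variable. If `μ_n = 0`, either no edge can occur and
-- nothing breaks, or an extra summand `n` makes the bound exceed one. Step `0` is treated apart,
-- since it may involve only the outbound edges of the root (`couplingLaw_zero_le`). The random
-- variable is otherwise a continuous function of empirical means, and the law of large numbers
-- gives its limit; independence of `W⁺` and `W⁻` excludes the degenerate case there
-- (`tendsto_boundConst`).

noncomputable section

namespace InhomDigraph

variable {n : ℕ}

/-! ### Exploring a digraph along a tree -/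

/-- The digraph that agrees with `x` on the edges incident to `S` and with `y` elsewhere. -/
def overlay (S : Finset (Fin n)) (x y : Adj n) : Adj n :=
  fun i j => if i ∈ S ∨ j ∈ S then x i j else y i j

/-- A digraph together with the litter of one individual. -/
abbrev Sample (n : ℕ) : Type := Adj n × Litter n

/-- A state of the joint exploration of a digraph and a tree: the explored nodes (with their
types), the edges revealed so far, the set of known types, and the queue of active nodes. -/
structure Exploration (n : ℕ) where
  explored : List (List ℕ × Fin n)
  edges : Adj n
  known : Finset (Fin n)
  queue : List (List ℕ × Fin n)

namespace Exploration

/-- The types of the explored nodes. -/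
def types (σ : Exploration n) : Finset (Fin n) := (σ.explored.map Prod.snd).toFinset

/-- The explored and the active nodes. -/
def nodes (σ : Exploration n) : List (List ℕ × Fin n) := σ.explored ++ σ.queue

/-- The sample `y` at a node of type `s` is good given the set `K` of known types: the litter
agrees with the edges incident to `s`, and contains no known type and no type twice. -/
def IsGood (K : Finset (Fin n)) (s : Fin n) (y : Sample n) : Prop :=
  -- In an exploration `s` itself is known, so this also excludes loops at `s`. The last clause is
  -- needed because a vertex joined to `s` in both directions would be active and inactive at once.
  (∀ j ∈ K, y.2.2.count j = 0 ∧ y.2.1 j = 0) ∧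
  (∀ j, y.2.2.count j = (if y.1 j s = true then 1 else 0) ∧
    y.2.1 j = if y.1 s j = true then 1 else 0) ∧
  ∀ j, y.2.2.count j = 0 ∨ y.2.1 j = 0

/-- The offspring of the node `u` when the list of their types is `l`. -/
def children (u : List ℕ) (l : List (Fin n)) : List (List ℕ × Fin n) :=
  l.zipIdx.map fun p => (p.2 :: u, p.1)

/-- The types that occur in a litter. -/
def litterTypes (y : Litter n) : Finset (Fin n) :=
  Finset.univ.filter fun j => 0 < y.2.count j ∨ 0 < y.1 j

open Classical in
/-- Explore the node `a`, using the sample `y`; the rest of the queue is discarded if the sample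
is not good. -/
def advance (σ : Exploration n) (a : List ℕ × Fin n) (rest : List (List ℕ × Fin n))
    (y : Sample n) : Exploration n where
  explored := a :: σ.explored
  edges := overlay σ.types σ.edges y.1
  known := σ.known ∪ litterTypes y.2
  queue := if IsGood σ.known a.2 y then rest ++ children a.1 y.2.2 else []

/-- One step of the exploration. -/
def step (R : List ℕ × Fin n → Sample n) (σ : Exploration n) : Exploration n :=
  match σ.queue with
  | [] => σ
  -- A type is explored at most once, so no sample at a node of an explored type is ever read again.
  -- Resampling rests on this.
  | a :: rest => if a.2 ∈ σ.types then { σ with queue := [] } else advance σ a rest (R a)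

/-- The digraph obtained after `N` steps, the edges not revealed being those of `X`. -/
def assemble (N : ℕ) (σ : Exploration n) (X : Adj n) (R : List ℕ × Fin n → Sample n) : Adj n :=
  overlay ((step R)^[N] σ).types ((step R)^[N] σ).edges X

/-- In one of the next `N` steps, a node of generation at most `k` has a sample that is not
good. -/
def Breaks (k : ℕ) (R : List ℕ × Fin n → Sample n) : ℕ → Exploration n → Prop
  | 0, _ => False
  | N + 1, σ =>
    match σ.queue with
    | [] => False
    -- A repeated type need not count as a break: it cannot appear before some sample is bad. Once
    -- the head of the queue is beyond generation `k`, so is the rest.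
    | a :: rest => a.1.length ≤ k ∧ a.2 ∉ σ.types ∧
        (¬ IsGood σ.known a.2 (R a) ∨ Breaks k R N (advance σ a rest (R a)))

/-- The initial state, where only the root is active. -/
def start (r : Fin n) : Exploration n where
  explored := []
  edges := fun _ _ => false
  known := {r}
  queue := [([], r)]

/-- What is known of the state of an exploration without bad samples. -/
structure Inv (R : List ℕ × Fin n → Sample n) (r : Fin n) (σ : Exploration n) : Prop where
  typ : ∀ a ∈ σ.nodes, typeAt r (fun b => (R b).2) a.1 = some a.2
  root : ([], r) ∈ σ.nodes
  child : ∀ a ∈ σ.explored, ∀ i j, (R a).2.2[i]? = some j → (i :: a.1, j) ∈ σ.nodes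
  nodup : (σ.nodes.map Prod.snd).Nodup
  known : ∀ a ∈ σ.nodes, a.2 ∈ σ.known
  inact_known : ∀ a ∈ σ.explored, ∀ t, 0 < (R a).2.1 t → t ∈ σ.known
  inact_le : ∀ a ∈ σ.explored, ∀ t, (R a).2.1 t ≤ 1
  inact_inj : ∀ a ∈ σ.explored, ∀ b ∈ σ.explored, ∀ t, 0 < (R a).2.1 t → 0 < (R b).2.1 t → a = b
  inact_ne : ∀ a ∈ σ.explored, ∀ t, 0 < (R a).2.1 t → ∀ b ∈ σ.nodes, b.2 ≠ t
  edge_child : ∀ a ∈ σ.explored, ∀ j ∈ (R a).2.2, σ.edges j a.2 = true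
  edge_inact : ∀ a ∈ σ.explored, ∀ t, 0 < (R a).2.1 t → σ.edges a.2 t = true
  edge_cases : ∀ i j, i ∈ σ.types ∨ j ∈ σ.types → σ.edges i j = true →
    (∃ a ∈ σ.explored, a.2 = j ∧ i ∈ (R a).2.2) ∨ ∃ a ∈ σ.explored, a.2 = i ∧ 0 < (R a).2.1 j
  -- Breadth-first order: generations in the queue do not decrease and spread over at most two
  -- values, so appending the children of the head keeps the order.
  sorted : σ.queue.Pairwise fun a b => a.1.length ≤ b.1.length
  width : ∀ a ∈ σ.queue, ∀ b ∈ σ.queue, b.1.length ≤ a.1.length + 1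

theorem mem_types {σ : Exploration n} {i : Fin n} : i ∈ σ.types ↔ ∃ a ∈ σ.explored, a.2 = i := by
  simp [types]

theorem mem_nodes {σ : Exploration n} {a : List ℕ × Fin n} :
    a ∈ σ.nodes ↔ a ∈ σ.explored ∨ a ∈ σ.queue := by
  simp [nodes]

theorem mem_children {u : List ℕ} {l : List (Fin n)} {a : List ℕ × Fin n} :
    a ∈ children u l ↔ ∃ i, l[i]? = some a.2 ∧ a.1 = i :: u := by
  obtain ⟨v, s⟩ := a
  simp only [children, List.mem_map, Prod.exists, List.mem_zipIdx_iff_getElem?, Prod.mk.injEq]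
  constructor
  · rintro ⟨b, i, h, rfl, rfl⟩; exact ⟨i, h, rfl⟩
  · rintro ⟨i, h, rfl⟩; exact ⟨s, i, h, rfl, rfl⟩

theorem map_snd_children (u : List ℕ) (l : List (Fin n)) : (children u l).map Prod.snd = l := by
  simp [children, Function.comp_def, List.zipIdx_map_fst]

theorem mem_litterTypes {y : Litter n} {j : Fin n} :
    j ∈ litterTypes y ↔ 0 < y.2.count j ∨ 0 < y.1 j := by
  simp [litterTypes]

theorem types_advance (σ : Exploration n) (a : List ℕ × Fin n) (rest : List (List ℕ × Fin n))
    (y : Sample n) : (advance σ a rest y).types = insert a.2 σ.types := by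
  simp [types, advance]

theorem Inv.start (R : List ℕ × Fin n → Sample n) (r : Fin n) : Inv R r (start r) where
  typ := by simp [Exploration.start, nodes, typeAt]
  root := by simp [Exploration.start, nodes]
  child := by simp [Exploration.start]
  nodup := by simp [Exploration.start, nodes]
  known := by simp [Exploration.start, nodes]
  inact_known := by simp [Exploration.start]
  inact_le := by simp [Exploration.start]
  inact_inj := by simp [Exploration.start]
  inact_ne := by simp [Exploration.start]
  edge_child := by simp [Exploration.start]
  edge_inact := by simp [Exploration.start]
  edge_cases := by simp [Exploration.start]
  sorted := by simp [Exploration.start]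
  width := by simp [Exploration.start]

theorem Inv.injOn {R : List ℕ × Fin n → Sample n} {r : Fin n} {σ : Exploration n}
    (h : Inv R r σ) {a b : List ℕ × Fin n} (ha : a ∈ σ.nodes) (hb : b ∈ σ.nodes)
    (hab : a.2 = b.2) : a = b :=
  List.inj_on_of_nodup_map h.nodup ha hb hab

theorem Inv.notMem_types {R : List ℕ × Fin n → Sample n} {r : Fin n} {σ : Exploration n}
    (h : Inv R r σ) {a : List ℕ × Fin n} {rest : List (List ℕ × Fin n)}
    (hq : σ.queue = a :: rest) : a.2 ∉ σ.types := by
  intro hs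
  have hnd := h.nodup
  rw [nodes, hq, List.map_append, List.nodup_append] at hnd
  obtain ⟨b, hb, hba⟩ := mem_types.1 hs
  exact hnd.2.2 _ (List.mem_map_of_mem hb) _ (List.mem_map_of_mem (List.mem_cons_self)) hba

/-- Offspring of a good sample are new because no known type occurs, distinct because the counts are
indicators, and disjoint from the inactive nodes by the last clause of `IsGood`. Edges at types
explored earlier stay frozen; the other edges at the head are those of its sample, where goodness
explains each of them by the litter. -/
theorem Inv.advance {R : List ℕ × Fin n → Sample n} {r : Fin n} {σ : Exploration n}
    (h : Inv R r σ) {a : List ℕ × Fin n} {rest : List (List ℕ × Fin n)}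
    (hq : σ.queue = a :: rest) (hg : IsGood σ.known a.2 (R a)) :
    Inv R r (advance σ a rest (R a)) := by
  have hat := h.notMem_types hq
  have ha : a ∈ σ.nodes := by simp [nodes, hq]
  have haK := h.known a ha
  obtain ⟨hK, hE, hD⟩ := id hg
  have hq' : (Exploration.advance σ a rest (R a)).queue = rest ++ children a.1 (R a).2.2 := by
    simp only [Exploration.advance]
    exact if_pos hg
  have he' : (Exploration.advance σ a rest (R a)).explored = a :: σ.explored := rfl
  have hx' : (Exploration.advance σ a rest (R a)).edges = overlay σ.types σ.edges (R a).1 := rfl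
  have hk' : (Exploration.advance σ a rest (R a)).known = σ.known ∪ litterTypes (R a).2 := rfl
  have hn' : ∀ b, b ∈ (Exploration.advance σ a rest (R a)).nodes ↔
      b ∈ σ.nodes ∨ b ∈ children a.1 (R a).2.2 := by
    intro b
    simp only [nodes, he', hq', hq, List.mem_append, List.mem_cons]
    tauto
  have hold : ∀ b ∈ σ.nodes, b ∈ (Exploration.advance σ a rest (R a)).nodes :=
    fun b hb => (hn' b).2 (Or.inl hb)
  have hexp : ∀ b ∈ σ.explored, b ∈ σ.nodes := fun b hb => mem_nodes.2 (Or.inl hb)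
  have hcm : ∀ b ∈ children a.1 (R a).2.2, b.2 ∈ (R a).2.2 := by
    intro b hb
    obtain ⟨i, hi, -⟩ := mem_children.1 hb
    exact List.mem_of_getElem? hi
  have hpos : ∀ j ∈ (R a).2.2, 0 < (R a).2.2.count j := fun j hj => List.count_pos_iff.2 hj
  have hnK : ∀ j ∈ (R a).2.2, j ∉ σ.known := fun j hj hjK => by
    have := (hK j hjK).1
    have := hpos j hj
    omega
  have hdK : ∀ t, 0 < (R a).2.1 t → t ∉ σ.known := fun j hj hjK => by
    have := (hK j hjK).2
    omega
  have htK : ∀ i ∈ σ.types, i ∈ σ.known := by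
    intro i hi
    obtain ⟨b, hb, rfl⟩ := mem_types.1 hi
    exact h.known b (hexp b hb)
  have hcount : ∀ j ∈ (R a).2.2, (R a).1 j a.2 = true := by
    intro j hj
    have h1 := hpos j hj
    rw [(hE j).1] at h1
    by_contra hne
    simp [hne] at h1
  have hdd : ∀ t, 0 < (R a).2.1 t → (R a).1 a.2 t = true := by
    intro j h1
    rw [(hE j).2] at h1
    by_contra hne
    simp [hne] at h1
  refine ⟨?_, hold _ h.root, ?_, ?_, ?_, ?_, ?_, ?_, ?_, ?_, ?_, ?_, ?_, ?_⟩
  · intro b hb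
    rcases (hn' b).1 hb with hb | hb
    · exact h.typ b hb
    · obtain ⟨i, hi, hbi⟩ := mem_children.1 hb
      rw [hbi, typeAt, h.typ a ha]
      exact hi
  · intro b hb i j hij
    rw [he', List.mem_cons] at hb
    rcases hb with rfl | hb
    · exact (hn' _).2 (Or.inr (mem_children.2 ⟨i, hij, rfl⟩))
    · exact hold _ (h.child b hb i j hij)
  -- Moving the head from the queue to the explored list only permutes the nodes, so the new ones
  -- are just the children.
  · have hperm : (Exploration.advance σ a rest (R a)).nodes.Perm
        (σ.nodes ++ children a.1 (R a).2.2) := by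
      simp only [nodes, he', hq', hq]
      simp only [List.cons_append, List.append_assoc]
      exact (List.perm_middle (l₁ := σ.explored)
        (l₂ := rest ++ children a.1 (R a).2.2) (a := a)).symm
    rw [(hperm.map _).nodup_iff, List.map_append, map_snd_children, List.nodup_append]
    refine ⟨h.nodup, ?_, ?_⟩
    · rw [List.nodup_iff_count_le_one]
      intro j
      rw [(hE j).1]
      split_ifs <;> simp
    · rintro i hi j hj rfl
      obtain ⟨b, hb, rfl⟩ := List.mem_map.1 hi
      exact hnK _ hj (h.known b hb)
  · intro b hb
    rw [hk', Finset.mem_union]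
    rcases (hn' b).1 hb with hb | hb
    · exact Or.inl (h.known b hb)
    · exact Or.inr (mem_litterTypes.2 (Or.inl (hpos _ (hcm b hb))))
  · intro b hb t ht
    rw [hk', Finset.mem_union]
    rw [he', List.mem_cons] at hb
    rcases hb with rfl | hb
    · exact Or.inr (mem_litterTypes.2 (Or.inr ht))
    · exact Or.inl (h.inact_known b hb t ht)
  · intro b hb t
    rw [he', List.mem_cons] at hb
    rcases hb with rfl | hb
    · rw [(hE t).2]
      split_ifs <;> simp
    · exact h.inact_le b hb t
  · intro b hb c hc t htb htc
    rw [he', List.mem_cons] at hb hc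
    rcases hb with rfl | hb <;> rcases hc with rfl | hc
    · rfl
    · exact absurd (h.inact_known c hc t htc) (hdK t htb)
    · exact absurd (h.inact_known b hb t htb) (hdK t htc)
    · exact h.inact_inj b hb c hc t htb htc
  · rintro b hb t ht c hc rfl
    rw [he', List.mem_cons] at hb
    rcases (hn' c).1 hc with hc' | hc'
    · rcases hb with rfl | hb
      · exact hdK _ ht (h.known c hc')
      · exact h.inact_ne b hb _ ht c hc' rfl
    · rcases hb with rfl | hb
      · have h1 := hpos _ (hcm c hc')
        have h2 := hD c.2
        omega
      · exact hnK _ (hcm c hc') (h.inact_known b hb _ ht)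
  · intro b hb j hj
    rw [he', List.mem_cons] at hb
    rw [hx']
    rcases hb with rfl | hb
    · have : ¬ (j ∈ σ.types ∨ b.2 ∈ σ.types) := by
        rintro (h1 | h1)
        · exact hnK j hj (htK j h1)
        · exact hat h1
      simp only [overlay, if_neg this]
      exact hcount j hj
    · have : j ∈ σ.types ∨ b.2 ∈ σ.types := Or.inr (mem_types.2 ⟨b, hb, rfl⟩)
      simp only [overlay, if_pos this]
      exact h.edge_child b hb j hj
  · intro b hb t ht
    rw [he', List.mem_cons] at hb
    rw [hx']
    rcases hb with rfl | hb
    · have : ¬ (b.2 ∈ σ.types ∨ t ∈ σ.types) := by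
        rintro (h1 | h1)
        · exact hat h1
        · exact hdK t ht (htK t h1)
      simp only [overlay, if_neg this]
      exact hdd t ht
    · have : b.2 ∈ σ.types ∨ t ∈ σ.types := Or.inl (mem_types.2 ⟨b, hb, rfl⟩)
      simp only [overlay, if_pos this]
      exact h.edge_inact b hb t ht
  · intro i j hij hx
    rw [hx'] at hx
    by_cases hm : i ∈ σ.types ∨ j ∈ σ.types
    · simp only [overlay, if_pos hm] at hx
      rcases h.edge_cases i j hm hx with ⟨b, hb, h1⟩ | ⟨b, hb, h1⟩
      · exact Or.inl ⟨b, by simp [he', hb], h1⟩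
      · exact Or.inr ⟨b, by simp [he', hb], h1⟩
    · simp only [overlay, if_neg hm] at hx
      rw [types_advance] at hij
      simp only [Finset.mem_insert] at hij
      -- An edge that is explained now but was not before must touch the head.
      have : i = a.2 ∨ j = a.2 := by tauto
      rcases this with rfl | rfl
      · refine Or.inr ⟨a, by simp [he'], rfl, ?_⟩
        rw [(hE j).2, if_pos hx]; exact one_pos
      · refine Or.inl ⟨a, by simp [he'], rfl, ?_⟩
        rw [← List.count_pos_iff, (hE i).1, if_pos hx]; exact one_pos
  · have hs := h.sorted
    have hw := h.width
    rw [hq] at hs hw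
    rw [hq', List.pairwise_append]
    refine ⟨(List.pairwise_cons.1 hs).2, ?_, ?_⟩
    · refine List.pairwise_of_forall_mem_list ?_
      intro b hb c hc
      obtain ⟨i, -, hb⟩ := mem_children.1 hb
      obtain ⟨j, -, hc⟩ := mem_children.1 hc
      simp [hb, hc]
    · intro b hb c hc
      obtain ⟨j, -, hc⟩ := mem_children.1 hc
      have := (List.pairwise_cons.1 hs).1 b hb
      have := hw a List.mem_cons_self b (List.mem_cons_of_mem _ hb)
      simp only [hc, List.length_cons]
      omega
  · have hs := h.sorted
    have hw := h.width
    rw [hq] at hs hw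
    have hlen : ∀ b ∈ rest ++ children a.1 (R a).2.2,
        a.1.length ≤ b.1.length ∧ b.1.length ≤ a.1.length + 1 := by
      intro b hb
      rcases List.mem_append.1 hb with hb | hb
      · exact ⟨(List.pairwise_cons.1 hs).1 b hb,
          hw a List.mem_cons_self b (List.mem_cons_of_mem _ hb)⟩
      · obtain ⟨j, -, hc⟩ := mem_children.1 hb
        simp [hc]
    rw [hq']
    intro b hb c hc
    have := hlen b hb
    have := hlen c hc
    omega

/-- Distinct types leave room for at most `n` nodes; hence `n` steps always exhaust a good
exploration. -/
theorem Inv.length_le {R : List ℕ × Fin n → Sample n} {r : Fin n} {σ : Exploration n}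
    (h : Inv R r σ) : σ.nodes.length ≤ n := by
  simpa using h.nodup.length_le_card

/-- Without bad samples in generations `0, …, k`, the exploration reaches a state where all
nodes of these generations are explored. -/
theorem exists_inv_of_not_breaks {k : ℕ} {R : List ℕ × Fin n → Sample n} {r : Fin n} (N : ℕ)
    (σ : Exploration n) (h : Inv R r σ) (hN : n ≤ N + σ.explored.length)
    (hb : ¬ Breaks k R N σ) :
    ∃ i ≤ N, Inv R r ((step R)^[i] σ) ∧ ∀ a ∈ ((step R)^[i] σ).queue, k < a.1.length := by
  induction N generalizing σ with
  | zero =>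
    refine ⟨0, le_rfl, h, ?_⟩
    have hl := h.length_le
    rw [nodes, List.length_append] at hl
    have : σ.queue = [] := List.eq_nil_of_length_eq_zero (by omega)
    simp [this]
  | succ N ih =>
    rcases hq : σ.queue with _ | ⟨a, rest⟩
    · exact ⟨0, Nat.zero_le _, h, by simp [hq]⟩
    · by_cases hk : a.1.length ≤ k
      · have hat := h.notMem_types hq
        rw [Breaks, hq] at hb
        simp only [hk, hat, not_false_eq_true, true_and, not_or, not_not] at hb
        have hst : step R σ = Exploration.advance σ a rest (R a) := by
          simp [step, hq, hat]
        obtain ⟨i, hi, h1, h2⟩ := ih _ (h.advance hq hb.1)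
          (by simp only [Exploration.advance, List.length_cons]; omega) hb.2
        refine ⟨i + 1, by omega, ?_⟩
        rw [Function.iterate_succ_apply, hst]
        exact ⟨h1, h2⟩
      -- The head is beyond generation `k`, and the queue is sorted by generation.
      · refine ⟨0, Nat.zero_le _, h, ?_⟩
        intro b hb
        have hs := h.sorted
        simp only [Function.iterate_zero, id_eq] at hb
        rw [hq] at hs hb
        rcases List.mem_cons.1 hb with rfl | hb
        · omega
        · have := (List.pairwise_cons.1 hs).1 b hb
          omega

/-- Revealed edges are never overwritten. The state at an intermediate step therefore already fixes
the assembled digraph at all types explored by then, whatever bad samples come later. -/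
theorem overlay_iterate_step (R : List ℕ × Fin n → Sample n) (N : ℕ) (σ : Exploration n) :
    σ.types ⊆ ((step R)^[N] σ).types ∧
      ∀ i j, i ∈ σ.types ∨ j ∈ σ.types → ((step R)^[N] σ).edges i j = σ.edges i j := by
  induction N generalizing σ with
  | zero => simp
  | succ N ih =>
    rw [Function.iterate_succ_apply]
    have key : σ.types ⊆ (step R σ).types ∧
        ∀ i j, i ∈ σ.types ∨ j ∈ σ.types → (step R σ).edges i j = σ.edges i j := by
      unfold step
      split
      · simp
      · split_ifs
        · exact ⟨fun _ h => h, fun _ _ _ => rfl⟩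
        · refine ⟨by rw [types_advance]; exact Finset.subset_insert _ _, fun i j hij => ?_⟩
          simp [Exploration.advance, overlay, hij]
    obtain ⟨h1, h2⟩ := ih (step R σ)
    refine ⟨key.1.trans h1, fun i j hij => ?_⟩
    rw [h2 i j (hij.imp (fun h => key.1 h) fun h => key.1 h), key.2 i j hij]

theorem assemble_eq_edges (R : List ℕ × Fin n → Sample n) (X : Adj n) {i N : ℕ} (hi : i ≤ N)
    (σ : Exploration n) (s t : Fin n)
    (hst : s ∈ ((step R)^[i] σ).types ∨ t ∈ ((step R)^[i] σ).types) :
    assemble N σ X R s t = ((step R)^[i] σ).edges s t := by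
  obtain ⟨m, rfl⟩ := Nat.exists_eq_add_of_le' hi
  obtain ⟨h1, h2⟩ := overlay_iterate_step R m ((step R)^[i] σ)
  rw [← Function.iterate_add_apply] at h1 h2
  rw [assemble, overlay, if_pos (hst.imp (fun h => h1 h) fun h => h1 h), h2 s t hst]

end Exploration

-- Agreement of the in-exploration with the tree

theorem component_succ (X : Adj n) (ξ : Fin n) (k : ℕ) :
    component X ξ (k + 1) = component X ξ k ∪ active X ξ (k + 1) := by
  rw [component, active]

theorem grow_eq_some {r : Fin n} {L : List ℕ × Fin n → Litter n} {u : List ℕ} {s : Fin n}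
    {d : Fin n → ℕ} :
    grow r L u = some (s, d) ↔ typeAt r L u = some s ∧ (L (u, s)).1 = d := by
  simp only [grow, Option.map_eq_some_iff, Prod.mk.injEq]
  constructor
  · rintro ⟨a, h, rfl, rfl⟩; exact ⟨h, rfl⟩
  · rintro ⟨h, rfl⟩; exact ⟨s, h, rfl, rfl⟩

theorem nodeType_grow (r : Fin n) (L : List ℕ × Fin n → Litter n) (u : List ℕ) :
    nodeType (grow r L) u = typeAt r L u := by
  simp [nodeType, grow, Function.comp_def]

theorem grow_ne_none {r : Fin n} {L : List ℕ × Fin n → Litter n} {u : List ℕ} :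
    grow r L u ≠ none ↔ ∃ s, typeAt r L u = some s := by
  simp [grow, Option.ne_none_iff_exists']

namespace Exploration

/-- If the exploration has explored all nodes of generations `0, …, k` without bad samples, it
agrees with the tree up to generation `k`. -/
theorem Inv.holdsUpTo {k : ℕ} {R : List ℕ × Fin n → Sample n} {r : Fin n} {σ : Exploration n}
    (h : Inv R r σ) (hq : ∀ a ∈ σ.queue, k < a.1.length) {X : Adj n}
    (hX : ∀ i j, i ∈ σ.types ∨ j ∈ σ.types → X i j = σ.edges i j) :
    HoldsUpTo X r (grow r fun a => (R a).2) k := by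
  set L : List ℕ × Fin n → Litter n := fun a => (R a).2 with hL
  have hexp : ∀ b ∈ σ.explored, b ∈ σ.nodes := fun b hb => mem_nodes.2 (Or.inl hb)
  have hnode : ∀ a ∈ σ.nodes, a.1.length ≤ k → a ∈ σ.explored := by
    intro a ha hk
    rcases mem_nodes.1 ha with ha | ha
    · exact ha
    · have := hq a ha
      omega
  -- The explored list exhausts the tree up to generation `k`: offspring of explored nodes are
  -- listed nodes, and the queue contains only later generations.
  have hdone : ∀ u s, u.length ≤ k → typeAt r L u = some s → (u, s) ∈ σ.explored := by
    intro u
    induction u with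
    | nil =>
      intro s _ hs
      simp only [typeAt, Option.some.injEq] at hs
      subst hs
      exact hnode _ h.root (Nat.zero_le _)
    | cons i u ih =>
      intro s hk hs
      simp only [List.length_cons] at hk
      simp only [typeAt, Option.bind_eq_some_iff] at hs
      obtain ⟨s', hs', hi⟩ := hs
      exact hnode _ (h.child _ (ih s' (by omega) hs') i s hi) (by simpa using hk)
  have hXt : ∀ a ∈ σ.explored, ∀ i, X i a.2 = σ.edges i a.2 :=
    fun a ha i => hX _ _ (Or.inr (mem_types.2 ⟨a, ha, rfl⟩))
  have hXs : ∀ a ∈ σ.explored, ∀ i, X a.2 i = σ.edges a.2 i :=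
    fun a ha i => hX _ _ (Or.inl (mem_types.2 ⟨a, ha, rfl⟩))
  have hin : ∀ a ∈ σ.explored, ∀ i, X i a.2 = true ↔ i ∈ (R a).2.2 := by
    intro a ha i
    rw [hXt a ha]
    refine ⟨fun hx => ?_, h.edge_child a ha i⟩
    rcases h.edge_cases i a.2 (Or.inr (mem_types.2 ⟨a, ha, rfl⟩)) hx with
      ⟨b, hb, hba, hi⟩ | ⟨b, hb, hbi, hd⟩
    · rwa [h.injOn (hexp b hb) (hexp a ha) hba] at hi
    -- An edge into a node cannot come from an inactive node record, since inactive types are never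
    -- types of nodes.
    · exact absurd rfl (h.inact_ne b hb _ hd a (hexp a ha))
  have hout : ∀ a ∈ σ.explored, ∀ t, X a.2 t = true ↔
      0 < (R a).2.1 t ∨ ∃ b ∈ σ.explored, b.2 = t ∧ a.2 ∈ (R b).2.2 := by
    intro a ha t
    constructor
    · intro hx
      rw [hXs a ha] at hx
      rcases h.edge_cases a.2 t (Or.inl (mem_types.2 ⟨a, ha, rfl⟩)) hx with
        ⟨b, hb, hba, hi⟩ | ⟨b, hb, hbi, hd⟩
      · exact Or.inr ⟨b, hb, hba, hi⟩
      · rw [h.injOn (hexp b hb) (hexp a ha) hbi] at hd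
        exact Or.inl hd
    · rintro (hd | ⟨b, hb, rfl, hi⟩)
      · rw [hXs a ha]; exact h.edge_inact a ha t hd
      · exact (hin b hb _).2 hi
  -- By `hin`, inbound neighbours are offspring; a type already in the component would sit at two
  -- positions of different generations, contrary to distinctness.
  have hgen : ∀ l ≤ k, active X r l = {s | ∃ u, u.length = l ∧ typeAt r L u = some s} ∧
      component X r l = {s | ∃ u, u.length ≤ l ∧ typeAt r L u = some s} := by
    intro l
    induction l with
    | zero =>
      intro _
      refine ⟨?_, ?_⟩
      · ext s
        simp only [active, Set.mem_singleton_iff, List.length_eq_zero_iff, Set.mem_ofPred_eq,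
          exists_eq_left, typeAt, Option.some.injEq, eq_comm]
      · ext s
        simp only [component, Set.mem_singleton_iff, Nat.le_zero, List.length_eq_zero_iff,
          Set.mem_ofPred_eq, exists_eq_left, typeAt, Option.some.injEq, eq_comm]
    | succ l ih =>
      intro hl
      obtain ⟨hA, hC⟩ := ih (by omega)
      have hA' : active X r (l + 1) =
          {s | ∃ u, u.length = l + 1 ∧ typeAt r L u = some s} := by
        ext j
        rw [active, hA, hC]
        simp only [Set.mem_ofPred_eq, not_exists, not_and]
        constructor
        · rintro ⟨⟨s, ⟨u, hu, hs⟩, hx⟩, -⟩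
          have ha := hdone u s (by omega) hs
          have hj := (hin _ ha j).1 hx
          obtain ⟨i, hi⟩ := List.mem_iff_getElem?.1 hj
          refine ⟨i :: u, by simp [hu], ?_⟩
          rw [typeAt, hs]
          exact hi
        · rintro ⟨u, hu, hj⟩
          rcases u with _ | ⟨i, u⟩
          · simp at hu
          · have hmem := hdone _ _ (by omega) hj
            simp only [typeAt, Option.bind_eq_some_iff] at hj
            simp only [List.length_cons, Nat.add_right_cancel_iff] at hu
            obtain ⟨s, hs, hi⟩ := hj
            have ha := hdone u s (by omega) hs
            refine ⟨⟨s, ⟨u, hu, hs⟩, (hin _ ha j).2 (List.mem_of_getElem? hi)⟩, ?_⟩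
            intro v hv hvj
            have hmem' := hdone v j (by omega) hvj
            have := h.injOn (hexp _ hmem) (hexp _ hmem') rfl
            simp only [Prod.mk.injEq, and_true] at this
            subst this
            simp at hv
            omega
      refine ⟨hA', ?_⟩
      rw [component_succ, hA', hC]
      ext s
      simp only [Set.mem_union, Set.mem_ofPred_eq]
      constructor
      · rintro (⟨u, hu, hs⟩ | ⟨u, hu, hs⟩)
        · exact ⟨u, by omega, hs⟩
        · exact ⟨u, by omega, hs⟩
      · rintro ⟨u, hu, hs⟩
        rcases Nat.lt_or_ge l u.length with h1 | h1
        · exact Or.inr ⟨u, by omega, hs⟩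
        · exact Or.inl ⟨u, h1, hs⟩
  -- An edge leaving a node leads to one of its inactive nodes or to its parent; the last premise
  -- says that `t` is not the type of the parent.
  have hinact : ∀ u s t, u.length ≤ k → typeAt r L u = some s →
      (∀ v s', v.length ≤ k → typeAt r L v = some s' → s ∈ (R (v, s')).2.2 → t ≠ s') →
      (L (u, s)).1 t = if X s t = true then 1 else 0 := by
    intro u s t hu hs ht
    have ha := hdone u s hu hs
    have h1 := h.inact_le _ ha t
    split_ifs with hx
    · rcases (hout _ ha t).1 hx with hd | ⟨b, hb, rfl, hi⟩
      · simp only [hL]; omega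
      · obtain ⟨i, hi'⟩ := List.mem_iff_getElem?.1 hi
        have hc := h.child b hb i _ hi'
        have hbu := h.injOn hc (hexp _ ha) rfl
        have hlen : b.1.length ≤ k := by
          have := congrArg (fun z => z.1.length) hbu
          simp at this
          omega
        exact absurd rfl (ht b.1 b.2 hlen (h.typ b (hexp b hb)) hi)
    · by_contra hne
      exact hx ((hout _ ha t).2 (Or.inl (Nat.pos_of_ne_zero hne)))
  refine ⟨?_, ?_, ?_, ?_, ?_⟩
  · intro l hl
    rw [(hgen l hl).1]
    refine ⟨?_, ?_, ?_⟩
    · rintro u ⟨hu, hne⟩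
      obtain ⟨s, hs⟩ := grow_ne_none.1 hne
      rw [nodeType_grow, hs]
      exact ⟨s, ⟨u, hu, hs⟩, rfl⟩
    · rintro u ⟨hu, hne⟩ v ⟨hv, hne'⟩ huv
      obtain ⟨s, hs⟩ := grow_ne_none.1 hne
      rw [nodeType_grow, nodeType_grow, hs] at huv
      have := h.injOn (hexp _ (hdone u s (by omega) hs)) (hexp _ (hdone v s (by omega) huv.symm))
        rfl
      exact congrArg Prod.fst this
    · rintro _ ⟨s, ⟨u, hu, hs⟩, rfl⟩
      exact ⟨u, ⟨hu, grow_ne_none.2 ⟨s, hs⟩⟩, by rw [nodeType_grow, hs]⟩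
  · intro l hl
    have hI : inactive X r l =
        {t | ∃ u s, u.length ≤ l ∧ typeAt r L u = some s ∧ 0 < (R (u, s)).2.1 t} := by
      ext t
      rw [inactive, (hgen l hl).2]
      simp only [Set.mem_ofPred_eq, not_exists, not_and]
      constructor
      · rintro ⟨⟨s, ⟨u, hu, hs⟩, hx⟩, ht⟩
        have ha := hdone u s (by omega) hs
        rcases (hout _ ha t).1 hx with hd | ⟨b, hb, rfl, hi⟩
        · exact ⟨u, s, hu, hs, hd⟩
        · obtain ⟨i, hi'⟩ := List.mem_iff_getElem?.1 hi
          have hc := h.child b hb i _ hi'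
          have hbu := h.injOn hc (hexp _ ha) rfl
          have hlen : b.1.length ≤ l := by
            have := congrArg (fun z => z.1.length) hbu
            simp at this
            omega
          exact absurd (h.typ b (hexp b hb)) (ht b.1 hlen)
      · rintro ⟨u, s, hu, hs, hd⟩
        have ha := hdone u s (by omega) hs
        refine ⟨⟨s, ⟨u, hu, hs⟩, (hout _ ha t).2 (Or.inl hd)⟩, ?_⟩
        intro v hv ht
        exact h.inact_ne _ ha t hd _ (hexp _ (hdone v t (by omega) ht)) rfl
    rw [hI]
    refine ⟨?_, ?_, ?_⟩
    · rintro ⟨u, t, m⟩ ⟨hu, s, d, hs, hm⟩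
      obtain ⟨hs1, rfl⟩ := grow_eq_some.1 hs
      exact ⟨u, s, hu, hs1, Nat.zero_lt_of_lt hm⟩
    · rintro ⟨u, t, m⟩ ⟨hu, s, d, hs, hm⟩ ⟨u', t', m'⟩ ⟨hu', s', d', hs', hm'⟩ htt
      simp only at htt hu hu' hs hs' hm hm'
      subst htt
      obtain ⟨hs1, rfl⟩ := grow_eq_some.1 hs
      obtain ⟨hs1', rfl⟩ := grow_eq_some.1 hs'
      have ha := hdone u s (by omega) hs1
      have ha' := hdone u' s' (by omega) hs1'
      have h1 := h.inact_inj _ ha _ ha' t (Nat.zero_lt_of_lt hm) (Nat.zero_lt_of_lt hm')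
      have h2 := h.inact_le _ ha t
      have h3 := h.inact_le _ ha' t
      simp only [hL] at hm hm'
      simp only [Prod.mk.injEq] at h1 ⊢
      refine ⟨h1.1, trivial, ?_⟩
      omega
    · rintro t ⟨u, s, hu, hs, hd⟩
      exact ⟨(u, t, 0), ⟨hu, s, (L (u, s)).1, grow_eq_some.2 ⟨hs, rfl⟩, hd⟩, rfl⟩
  · intro u j s d s' d' hu hs hs'
    obtain ⟨hs, -⟩ := grow_eq_some.1 hs
    obtain ⟨hs', -⟩ := grow_eq_some.1 hs'
    simp only [typeAt, hs, Option.bind_some] at hs'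
    exact (hin _ (hdone u s hu.le hs) s').2 (List.mem_of_getElem? hs')
  · intro s d hs t
    obtain ⟨hs1, rfl⟩ := grow_eq_some.1 hs
    refine hinact [] s t (Nat.zero_le _) hs1 ?_
    rintro v s' hv hs' hmem -
    obtain ⟨i, hi⟩ := List.mem_iff_getElem?.1 hmem
    have hc := h.child _ (hdone v s' hv hs') i _ hi
    have := h.injOn hc (hexp _ (hdone [] s (Nat.zero_le _) hs1)) rfl
    simp at this
  · intro u j s d s' d' hu hs hs' t
    obtain ⟨hs, -⟩ := grow_eq_some.1 hs
    obtain ⟨hs1', rfl⟩ := grow_eq_some.1 hs'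
    have hu' : (j :: u).length ≤ k := by simpa using hu
    have ha' := hdone _ _ hu' hs1'
    have hau := hdone u s hu.le hs
    by_cases ht : t = s
    · subst ht
      simp only [ne_eq, not_true_eq_false, and_false, if_false]
      by_contra hne
      exact h.inact_ne _ ha' t (Nat.pos_of_ne_zero hne) _ (hexp _ hau) rfl
    · simp only [ne_eq, ht, not_false_eq_true, and_true]
      refine hinact _ s' t hu' hs1' ?_
      rintro v s'' hv hs'' hmem rfl
      obtain ⟨i, hi⟩ := List.mem_iff_getElem?.1 hmem
      have hc := h.child _ (hdone v t hv hs'') i _ hi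
      have h1 := h.injOn hc (hexp _ ha') rfl
      simp only [Prod.mk.injEq, List.cons.injEq, and_true] at h1
      obtain ⟨-, rfl⟩ := h1
      rw [hs''] at hs
      exact ht (Option.some.inj hs)

/-- Without bad samples up to generation `k`, the assembled digraph agrees with the tree up to
generation `k`. -/
theorem holdsUpTo_assemble {k : ℕ} {R : List ℕ × Fin n → Sample n} {r : Fin n} (X : Adj n)
    (hb : ¬ Breaks k R n (start r)) :
    HoldsUpTo (assemble n (start r) X R) r (grow r fun a => (R a).2) k := by
  obtain ⟨i, hi, h1, h2⟩ := exists_inv_of_not_breaks n (start r) (Inv.start R r) (by simp) hb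
  exact h1.holdsUpTo h2 fun s t hst => assemble_eq_edges R X hi _ s t hst

end Exploration

/-- The coupling holds up to step `0` as soon as the outbound edges of the root agree with its
inactive nodes. -/
theorem holdsUpTo_zero {X : Adj n} {r : Fin n} {L : List ℕ × Fin n → Litter n}
    (hd : ∀ t, (L ([], r)).1 t = if X r t = true then 1 else 0) (hr : (L ([], r)).1 r = 0) :
    HoldsUpTo X r (grow r L) 0 := by
  have hroot : ∀ s d, grow r L [] = some (s, d) ↔ r = s ∧ (L ([], s)).1 = d := by
    intro s d
    rw [grow_eq_some]
    simp [typeAt]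
  refine ⟨?_, ?_, ?_, ?_, ?_⟩
  · intro l hl
    obtain rfl : l = 0 := by omega
    refine ⟨?_, ?_, ?_⟩
    · rintro u ⟨hu, -⟩
      obtain rfl := List.length_eq_zero_iff.1 hu
      exact ⟨r, rfl, by simp [nodeType_grow, typeAt]⟩
    · rintro u ⟨hu, -⟩ v ⟨hv, -⟩ -
      rw [List.length_eq_zero_iff.1 hu, List.length_eq_zero_iff.1 hv]
    · rintro _ ⟨s, hs, rfl⟩
      obtain rfl : s = r := hs
      exact ⟨[], ⟨rfl, grow_ne_none.2 ⟨s, rfl⟩⟩, by simp [nodeType_grow, typeAt]⟩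
  · intro l hl
    obtain rfl : l = 0 := by omega
    refine ⟨?_, ?_, ?_⟩
    · rintro ⟨u, t, m⟩ ⟨hu, s, d, hs, hm⟩
      obtain rfl := List.length_eq_zero_iff.1 (Nat.le_zero.1 hu)
      obtain ⟨rfl, rfl⟩ := (hroot s d).1 hs
      simp only at hm
      have h1 := hd t
      have hx : X r t = true := by
        by_contra hne
        simp [hne] at h1
        omega
      refine ⟨⟨r, rfl, hx⟩, ?_⟩
      intro ht
      obtain rfl : t = r := ht
      omega
    · rintro ⟨u, t, m⟩ ⟨hu, s, d, hs, hm⟩ ⟨u', t', m'⟩ ⟨hu', s', d', hs', hm'⟩ htt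
      simp only at htt hu hu' hs hs' hm hm'
      obtain rfl := List.length_eq_zero_iff.1 (Nat.le_zero.1 hu)
      obtain rfl := List.length_eq_zero_iff.1 (Nat.le_zero.1 hu')
      obtain ⟨rfl, rfl⟩ := (hroot s d).1 hs
      obtain ⟨rfl, rfl⟩ := (hroot s' d').1 hs'
      subst htt
      have h1 := hd t
      have h2 : (if X r t = true then 1 else 0) ≤ 1 := by split_ifs <;> simp
      simp only [Prod.mk.injEq, true_and]
      omega
    · rintro t ⟨⟨s, hs, hx⟩, -⟩
      obtain rfl : s = r := hs
      refine ⟨([], t, 0), ⟨le_rfl, s, _, (hroot _ _).2 ⟨rfl, rfl⟩, ?_⟩, rfl⟩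
      simp only
      rw [hd, if_pos hx]
      exact one_pos
  · intro u j s d s' d' hu
    exact absurd hu (Nat.not_lt_zero _)
  · intro s d hs t
    obtain ⟨rfl, rfl⟩ := (hroot s d).1 hs
    exact hd t
  · intro u j s d s' d' hu
    exact absurd hu (Nat.not_lt_zero _)

theorem HoldsUpTo.mono {X : Adj n} {r : Fin n} {t : MarkedTree n} {k l : ℕ}
    (h : HoldsUpTo X r t k) (hl : l ≤ k) : HoldsUpTo X r t l where
  active_eq m hm := h.active_eq m (hm.trans hl)
  inactive_eq m hm := h.inactive_eq m (hm.trans hl)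
  parent_edge u j s d s' d' hu := h.parent_edge u j s d s' d' (hu.trans_le hl)
  root_inactive := h.root_inactive
  node_inactive u j s d s' d' hu := h.node_inactive u j s d s' d' (hu.trans_le hl)

/-- Agreement up to a step implies agreement up to every earlier one, so the failing steps form an
upper set. -/
theorem breakStep_le_iff {ω : Outcome n} {k : ℕ} :
    breakStep ω ≤ (k : ℕ∞) ↔ ¬ HoldsUpTo ω.1.2 ω.1.1 ω.2 k := by
  rw [breakStep]
  constructor
  · intro h hk
    have h1 : ((k + 1 : ℕ) : ℕ∞) ≤ ⨅ l ∈ {l : ℕ | ¬ HoldsUpTo ω.1.2 ω.1.1 ω.2 l}, (l : ℕ∞) := by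
      refine le_iInf₂ fun l hl => ?_
      have : k < l := by
        by_contra hlk
        exact hl (hk.mono (by omega))
      exact_mod_cast this
    have h2 := h1.trans h
    have : k + 1 ≤ k := by exact_mod_cast h2
    omega
  · intro h
    exact iInf₂_le k h

/-! ### Resampling -/

/-- Replacing one coordinate by an independent copy preserves a product measure, as one sees on
finite cylinders. This allows the sample at the head of the queue to be integrated separately while
the others keep their joint law. -/
theorem map_update_infinitePi {ι : Type*} {X : ι → Type*} [DecidableEq ι]
    [∀ i, MeasurableSpace (X i)] (μ : (i : ι) → Measure (X i)) [∀ i, IsProbabilityMeasure (μ i)]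
    (a : ι) :
    ((μ a).prod (Measure.infinitePi μ)).map (fun p => Function.update p.2 a p.1) =
      Measure.infinitePi μ := by
  have hm : Measurable fun p : X a × ((i : ι) → X i) => Function.update p.2 a p.1 :=
    measurable_update'.comp measurable_swap
  refine Measure.eq_infinitePi μ fun s t ht => ?_
  rw [Measure.map_apply hm (.pi s.countable_toSet fun _ _ => ht _)]
  by_cases ha : a ∈ s
  · have : (fun p : X a × ((i : ι) → X i) => Function.update p.2 a p.1) ⁻¹' (Set.pi s t) =
        t a ×ˢ Set.pi (s.erase a : Finset ι) t := by
      ext p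
      simp only [Set.mem_preimage, Set.mem_pi, Finset.mem_coe, Set.mem_prod, Finset.mem_erase]
      constructor
      · intro h
        refine ⟨by simpa using h a ha, fun i hi => ?_⟩
        simpa [Function.update_of_ne hi.1] using h i hi.2
      · rintro ⟨h1, h2⟩ i hi
        by_cases h : i = a
        · subst h; simpa using h1
        · simpa [Function.update_of_ne h] using h2 i ⟨h, hi⟩
    rw [this, Measure.prod_prod, Measure.infinitePi_pi _ fun i _ => ht i,
      Finset.mul_prod_erase s (fun i => μ i (t i)) ha]
  · have : (fun p : X a × ((i : ι) → X i) => Function.update p.2 a p.1) ⁻¹' (Set.pi s t) =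
        Set.univ ×ˢ Set.pi s t := by
      ext p
      simp only [Set.mem_preimage, Set.mem_pi, Finset.mem_coe, Set.mem_prod, Set.mem_univ,
        true_and]
      refine forall₂_congr fun i hi => ?_
      rw [Function.update_of_ne (by rintro rfl; exact ha hi)]
    rw [this, Measure.prod_prod, Measure.infinitePi_pi _ fun i _ => ht i, measure_univ, one_mul]

theorem lintegral_infinitePi_update {ι : Type*} {X : ι → Type*} [DecidableEq ι]
    [∀ i, MeasurableSpace (X i)] (μ : (i : ι) → Measure (X i)) [∀ i, IsProbabilityMeasure (μ i)]
    (a : ι) {f : ((i : ι) → X i) → ℝ≥0∞} (hf : Measurable f) :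
    ∫⁻ R, f R ∂(Measure.infinitePi μ) =
      ∫⁻ y, ∫⁻ R, f (Function.update R a y) ∂(Measure.infinitePi μ) ∂(μ a) := by
  have hm : Measurable fun p : X a × ((i : ι) → X i) => Function.update p.2 a p.1 :=
    measurable_update'.comp measurable_swap
  conv_lhs => rw [← map_update_infinitePi μ a]
  rw [lintegral_map hf hm]
  exact lintegral_prod _ (hf.comp hm).aemeasurable

/-- Independent edges may be resampled. -/
theorem map_overlay_pi (μ : Fin n → Fin n → Measure Bool) [∀ i j, IsProbabilityMeasure (μ i j)]
    (S : Finset (Fin n)) :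
    ((Measure.pi fun i => Measure.pi fun j => μ i j).prod
      (Measure.pi fun i => Measure.pi fun j => μ i j)).map (fun p => overlay S p.1 p.2) =
      Measure.pi fun i => Measure.pi fun j => μ i j := by
  refine Measure.ext_of_singleton fun x => ?_
  rw [Measure.map_apply Measurable.of_discrete (measurableSet_singleton x)]
  -- Each edge of the overlay is prescribed by exactly one of the two digraphs, so the product over
  -- edges factors with a trivial factor for the other one.
  have hpre : (fun p : Adj n × Adj n => overlay S p.1 p.2) ⁻¹' {x} =
      (Set.pi Set.univ fun i => Set.pi Set.univ fun j =>
        if i ∈ S ∨ j ∈ S then {x i j} else Set.univ) ×ˢ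
      (Set.pi Set.univ fun i => Set.pi Set.univ fun j =>
        if i ∈ S ∨ j ∈ S then Set.univ else {x i j}) := by
    ext p
    simp only [Set.mem_preimage, Set.mem_singleton_iff, Set.mem_prod, Set.mem_pi, Set.mem_univ,
      true_imp_iff, funext_iff, overlay]
    constructor
    · intro h
      refine ⟨fun i j => ?_, fun i j => ?_⟩ <;> have := h i j <;> split_ifs with hS <;>
        simp_all
    · rintro ⟨h1, h2⟩ i j
      have h1 := h1 i j
      have h2 := h2 i j
      split_ifs at h1 h2 ⊢ with hS <;> simp_all
  rw [hpre, Measure.prod_prod]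
  simp_rw [Measure.pi_pi]
  rw [← Finset.prod_mul_distrib, ← Set.univ_pi_singleton x, Measure.pi_pi]
  refine Finset.prod_congr rfl fun i _ => ?_
  rw [← Finset.prod_mul_distrib, ← Set.univ_pi_singleton (x i), Measure.pi_pi]
  refine Finset.prod_congr rfl fun j _ => ?_
  split_ifs <;> rw [measure_univ] <;> simp

/-- Exploring `s` from the sample `y` and completing by `z` amounts to completing the old state by a
digraph whose edges at `s` come from `y` and the others from `z`. If `y` and `z` are independent
with the same law, this completion has that law too. -/
theorem overlay_overlay (T : Finset (Fin n)) (s : Fin n) (x y z : Adj n) :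
    overlay (insert s T) (overlay T x y) z = overlay T x (overlay {s} y z) := by
  funext i j
  by_cases hT : i ∈ T ∨ j ∈ T
  · have : i ∈ insert s T ∨ j ∈ insert s T :=
      hT.imp Finset.mem_insert_of_mem Finset.mem_insert_of_mem
    simp [overlay, hT]
    tauto
  · by_cases hs : i = s ∨ j = s
    · simp [overlay, hT, hs]; tauto
    · simp [overlay, hT, hs]; tauto

-- Measurability and resampling of the joint exploration

namespace Exploration

instance instMeasurableSpace : MeasurableSpace (Exploration n) := ⊤

theorem step_of_cons {R : List ℕ × Fin n → Sample n} {σ : Exploration n}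
    {a : List ℕ × Fin n} {rest : List (List ℕ × Fin n)} (hq : σ.queue = a :: rest)
    (ha : a.2 ∉ σ.types) : step R σ = advance σ a rest (R a) := by
  simp [step, hq, ha]

/-- One coordinate takes countably many values, so it may be frozen; recursions that read the sample
at the head of the queue become measurable by induction. -/
theorem measurable_apply_eval {ι α β : Type*} [MeasurableSpace α] [MeasurableSpace β]
    [Countable α] [MeasurableSingletonClass α]
    {h : α → (ι → α) → β} (hh : ∀ y, Measurable (h y)) (a : ι) :
    Measurable fun R : ι → α => h (R a) R := by
  have : Measurable fun p : α × (ι → α) => h p.1 p.2 := measurable_from_prod_countable_right hh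
  exact this.comp (Measurable.prodMk (measurable_pi_apply (X := fun _ : ι => α) a) measurable_id)

theorem measurable_iterate_step (N : ℕ) (σ : Exploration n) :
    Measurable fun R : List ℕ × Fin n → Sample n => (step R)^[N] σ := by
  induction N generalizing σ with
  | zero => exact measurable_const
  | succ N ih =>
    simp only [Function.iterate_succ_apply]
    rcases hq : σ.queue with _ | ⟨a, rest⟩
    · simpa [step, hq] using ih σ
    · by_cases ha : a.2 ∈ σ.types
      · simpa [step, hq, ha] using ih _
      · simp only [step_of_cons hq ha]
        exact measurable_apply_eval (h := fun y R => (step R)^[N] (advance σ a rest y))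
          (fun y => ih _) a

theorem types_subset_step (R : List ℕ × Fin n → Sample n) (σ : Exploration n) :
    σ.types ⊆ (step R σ).types :=
  (overlay_iterate_step R 1 σ).1

/-- The sample at a node of an explored type is not read any more, so after one step the future is a
function of the other samples. -/
theorem iterate_step_update (R : List ℕ × Fin n → Sample n) (N : ℕ) (σ : Exploration n)
    (a : List ℕ × Fin n) (y : Sample n) (ha : a.2 ∈ σ.types) :
    (step (Function.update R a y))^[N] σ = (step R)^[N] σ := by
  induction N generalizing σ with
  | zero => rfl
  | succ N ih =>
    rw [Function.iterate_succ_apply, Function.iterate_succ_apply]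
    have : step (Function.update R a y) σ = step R σ := by
      unfold step
      split
      · rfl
      · rename_i b rest hq
        split_ifs with hb
        · rfl
        · rw [Function.update_of_ne (by rintro rfl; exact hb ha)]
    rw [this, ih _ (types_subset_step R σ ha)]

theorem breaks_update (k : ℕ) (R : List ℕ × Fin n → Sample n) (N : ℕ) (σ : Exploration n)
    (a : List ℕ × Fin n) (y : Sample n) (ha : a.2 ∈ σ.types) :
    Breaks k (Function.update R a y) N σ ↔ Breaks k R N σ := by
  induction N generalizing σ with
  | zero => rfl
  | succ N ih =>
    unfold Breaks
    split
    · rfl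
    · rename_i b rest hq
      refine and_congr_right fun _ => and_congr_right fun hb => ?_
      rw [Function.update_of_ne (by rintro rfl; exact hb ha), ih]
      rw [types_advance]
      exact Finset.mem_insert_of_mem ha

theorem measurableSet_breaks (k N : ℕ) (σ : Exploration n) :
    MeasurableSet {R : List ℕ × Fin n → Sample n | Breaks k R N σ} := by
  induction N generalizing σ with
  | zero => simp [Breaks]
  | succ N ih =>
    rcases hq : σ.queue with _ | ⟨a, rest⟩
    · simp [Breaks, hq]
    · simp only [Breaks, hq]
      refine measurableSet_setOfPred.2 ?_
      refine Measurable.and measurable_const (Measurable.and measurable_const (Measurable.or ?_ ?_))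
      · exact (Measurable.of_discrete (f := fun y : Sample n => ¬ IsGood σ.known a.2 y)).comp
          (measurable_pi_apply a)
      · exact measurable_apply_eval (h := fun y R => Breaks k R N (advance σ a rest y))
          (fun y => measurableSet_setOfPred.1 (ih _)) a

/-- The assembled digraph has independent edges, whatever has been explored. -/
theorem lintegral_assemble (μ : Fin n → Fin n → Measure Bool)
    [∀ i j, IsProbabilityMeasure (μ i j)] (ρ : List ℕ × Fin n → Measure (Sample n))
    [∀ a, IsProbabilityMeasure (ρ a)]
    (hρ : ∀ a, (ρ a).map Prod.fst = Measure.pi fun i => Measure.pi fun j => μ i j)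
    (f : Adj n → ℝ≥0∞) (N : ℕ) (σ : Exploration n) :
    ∫⁻ R, ∫⁻ X, f (assemble N σ X R) ∂(Measure.pi fun i => Measure.pi fun j => μ i j)
        ∂(Measure.infinitePi ρ) =
      ∫⁻ X, f (overlay σ.types σ.edges X) ∂(Measure.pi fun i => Measure.pi fun j => μ i j) := by
  set ν : Measure (Adj n) := Measure.pi fun i => Measure.pi fun j => μ i j with hν
  induction N generalizing σ with
  | zero => simp [assemble]
  | succ N ih =>
    rcases hq : σ.queue with _ | ⟨a, rest⟩
    · have : ∀ R, step R σ = σ := fun R => by simp [step, hq]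
      simp only [assemble, Function.iterate_succ_apply, this]
      exact ih σ
    · by_cases ha : a.2 ∈ σ.types
      · have : ∀ R, step R σ = { σ with queue := [] } := fun R => by simp [step, hq, ha]
        simp only [assemble, Function.iterate_succ_apply, this]
        exact ih { σ with queue := [] }
      · have hm : Measurable fun R : List ℕ × Fin n → Sample n =>
            ∫⁻ X, f (assemble (N + 1) σ X R) ∂ν :=
          (Measurable.of_discrete (f := fun τ : Exploration n =>
            ∫⁻ X, f (overlay τ.types τ.edges X) ∂ν)).comp (measurable_iterate_step (N + 1) σ)
        rw [lintegral_infinitePi_update ρ a hm]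
        -- With the sample at the head fixed to `y`, the induction hypothesis applies to the
        -- advanced state, and the two overlays merge.
        have key : ∀ y : Sample n,
            ∫⁻ R, ∫⁻ X, f (assemble (N + 1) σ X (Function.update R a y)) ∂ν
              ∂(Measure.infinitePi ρ) =
            ∫⁻ X, f (overlay σ.types σ.edges (overlay {a.2} y.1 X)) ∂ν := by
          intro y
          have h1 : ∀ R X, assemble (N + 1) σ X (Function.update R a y) =
              assemble N (advance σ a rest y) X R := by
            intro R X
            simp only [assemble, Function.iterate_succ_apply, step_of_cons hq ha,
              Function.update_self]
            rw [iterate_step_update]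
            rw [types_advance]
            exact Finset.mem_insert_self _ _
          simp only [h1, ih, types_advance]
          simp only [advance, overlay_overlay]
        simp only [key]
        -- Only the digraph of the sample enters, and its law is the same for every node;
        -- `map_overlay_pi` then removes the inner overlay.
        have h2 : ∫⁻ y, ∫⁻ X, f (overlay σ.types σ.edges (overlay {a.2} y.1 X)) ∂ν ∂(ρ a) =
            ∫⁻ Y, ∫⁻ X, f (overlay σ.types σ.edges (overlay {a.2} Y X)) ∂ν ∂ν := by
          have := lintegral_map (μ := ρ a) (g := Prod.fst) (f := fun Y : Adj n =>
            ∫⁻ X, f (overlay σ.types σ.edges (overlay {a.2} Y X)) ∂ν)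
            Measurable.of_discrete measurable_fst
          rw [hρ a] at this
          exact this.symm
        rw [h2, ← lintegral_prod
          (fun p : Adj n × Adj n => f (overlay σ.types σ.edges (overlay {a.2} p.1 p.2)))
          Measurable.of_discrete.aemeasurable]
        have h3 := lintegral_map (μ := ν.prod ν) (g := fun p => overlay {a.2} p.1 p.2)
          (f := fun Y : Adj n => f (overlay σ.types σ.edges Y))
          Measurable.of_discrete Measurable.of_discrete
        rw [hν, map_overlay_pi μ {a.2}] at h3
        exact h3.symm

-- The breaking probability as an expected cost

theorem sum_map_children (u : List ℕ) (l : List (Fin n)) (f : Fin n → ℝ≥0∞) :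
    ((children u l).map fun b => f b.2).sum = ∑ j, (l.count j : ℝ≥0∞) * f j := by
  have : (children u l).map (fun b => f b.2) = l.map f := by
    conv_rhs => rw [← map_snd_children u l, List.map_map]
    rfl
  rw [this, Finset.sum_list_map_count]
  simp only [nsmul_eq_mul]
  refine Finset.sum_subset (Finset.subset_univ _) fun j _ hj => ?_
  rw [List.mem_toFinset] at hj
  simp [List.count_eq_zero.2 hj]

theorem sum_litterTypes_le (y : Litter n) (f : Fin n → ℝ≥0∞) :
    ∑ j ∈ litterTypes y, f j ≤ ∑ j, ((y.2.count j : ℝ≥0∞) + y.1 j) * f j := by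
  refine (Finset.sum_le_sum fun j hj => ?_).trans
    (Finset.sum_le_sum_of_subset (Finset.subset_univ _))
  rw [mem_litterTypes] at hj
  have : (1 : ℝ≥0∞) ≤ (y.2.count j : ℝ≥0∞) + y.1 j := by
    have : 1 ≤ y.2.count j + y.1 j := by omega
    exact_mod_cast this
  calc f j = 1 * f j := (one_mul _).symm
    _ ≤ _ := by gcongr

/-- The probability of a bad sample up to generation `k`, in terms of a potential `g` of the
active nodes and the weight `a` of the known types.  The cost `c` dominates the probability that
a sample is bad plus the expected increase of the weight, provided that the weight is at
most one. -/
theorem measure_breaks_le (ρ : Fin n → Measure (Sample n)) [∀ s, IsProbabilityMeasure (ρ s)]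
    (w c : Fin n → ℝ≥0∞) (g : ℕ → Fin n → ℝ≥0∞)
    (hc : ∀ (K : Finset (Fin n)) (s : Fin n), s ∈ K → ∑ j ∈ K, w j ≤ 1 →
      ρ s {y | ¬ IsGood K s y} +
        ∫⁻ y, ∑ j, ((y.2.2.count j : ℝ≥0∞) + y.2.1 j) * w j ∂(ρ s) ≤ c s)
    (hg : ∀ l s, c s + ∫⁻ y, ∑ j, (y.2.2.count j : ℝ≥0∞) * g l j ∂(ρ s) ≤ g (l + 1) s)
    (k N : ℕ) (σ : Exploration n) (hσ : ∀ a ∈ σ.queue, a.2 ∈ σ.known) :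
    Measure.infinitePi (fun a : List ℕ × Fin n => ρ a.2) {R | Breaks k R N σ} ≤
      ∑ j ∈ σ.known, w j + (σ.queue.map fun a => g (k + 1 - a.1.length) a.2).sum := by
  set P := Measure.infinitePi (fun a : List ℕ × Fin n => ρ a.2) with hP
  induction N generalizing σ with
  | zero => simp [Breaks]
  | succ N ih =>
    -- Weight above one makes the claim trivial, which is why `hc` is only required for lighter sets
    -- of known types.
    by_cases hw : ∑ j ∈ σ.known, w j ≤ 1
    swap
    · exact prob_le_one.trans ((not_le.1 hw).le.trans le_self_add)
    rcases hq : σ.queue with _ | ⟨a, rest⟩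
    · simp [Breaks, hq]
    rw [hq] at hσ
    have haK := hσ a List.mem_cons_self
    by_cases hb : a.1.length ≤ k ∧ a.2 ∉ σ.types
    swap
    · have : {R : List ℕ × Fin n → Sample n | Breaks k R (N + 1) σ} = ∅ := by
        ext R
        simp only [Breaks, hq, Set.mem_ofPred_eq, Set.mem_empty_iff_false, iff_false]
        tauto
      simp [this]
    obtain ⟨hk, ha⟩ := hb
    have hm := measurableSet_breaks k (N + 1) σ
    rw [← lintegral_indicator_one hm,
      lintegral_infinitePi_update (fun a : List ℕ × Fin n => ρ a.2) a
        (measurable_one.indicator hm)]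
    -- A bad sample is charged one. After a good one the induction hypothesis applies to the
    -- advanced state, whose weight grows by at most that of the litter and whose queue exchanges
    -- the head for its children.
    have key : ∀ y : Sample n,
        ∫⁻ R, Set.indicator {R | Breaks k R (N + 1) σ} 1 (Function.update R a y) ∂P ≤
          Set.indicator {y | ¬ IsGood σ.known a.2 y} 1 y +
          ((∑ j ∈ σ.known, w j + (rest.map fun b => g (k + 1 - b.1.length) b.2).sum) +
            (∑ j, ((y.2.2.count j : ℝ≥0∞) + y.2.1 j) * w j +
            ∑ j, (y.2.2.count j : ℝ≥0∞) * g (k - a.1.length) j)) := by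
      intro y
      by_cases hy : IsGood σ.known a.2 y
      swap
      · refine le_trans ?_ le_self_add
        rw [Set.indicator_of_mem (by exact hy)]
        refine (lintegral_mono (g := fun _ => 1) fun R => ?_).trans (by simp)
        exact Set.indicator_le_self' (f := (1 : (List ℕ × Fin n → Sample n) → ℝ≥0∞)) (fun _ _ => zero_le) _
      · have h1 : ∀ R, Set.indicator {R | Breaks k R (N + 1) σ} (1 : (List ℕ × Fin n → Sample n) → ℝ≥0∞)
            (Function.update R a y) =
            Set.indicator {R | Breaks k R N (advance σ a rest y)} 1 R := by
          intro R
          have : Breaks k (Function.update R a y) (N + 1) σ ↔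
              Breaks k R N (advance σ a rest y) := by
            rw [Breaks, hq]
            simp only [hk, ha, not_false_eq_true, true_and, Function.update_self, hy, not_true,
              false_or]
            exact breaks_update k R N _ a y (by rw [types_advance]; simp)
          by_cases hB : Breaks k R N (advance σ a rest y)
          · rw [Set.indicator_of_mem (by exact this.2 hB), Set.indicator_of_mem (by exact hB)]
            rfl
          · rw [Set.indicator_of_notMem (by exact fun h => hB (this.1 h)),
              Set.indicator_of_notMem (by exact hB)]
        simp only [h1]
        rw [lintegral_indicator_one (measurableSet_breaks _ _ _)]
        refine (ih _ ?_).trans ?_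
        · simp only [advance, if_pos hy]
          intro b hb
          rw [Finset.mem_union]
          rcases List.mem_append.1 hb with hb | hb
          · exact Or.inl (hσ b (List.mem_cons_of_mem _ hb))
          · obtain ⟨i, hi, -⟩ := mem_children.1 hb
            exact Or.inr (mem_litterTypes.2 (Or.inl (List.count_pos_iff.2
              (List.mem_of_getElem? hi))))
        · refine le_trans ?_ le_add_self
          simp only [advance, if_pos hy, List.map_append, List.sum_append]
          have h2 : ((children a.1 y.2.2).map fun b => g (k + 1 - b.1.length) b.2) =
              (children a.1 y.2.2).map fun b => g (k - a.1.length) b.2 := by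
            refine List.map_congr_left fun b hb => ?_
            obtain ⟨i, -, hb⟩ := mem_children.1 hb
            rw [hb, List.length_cons, Nat.add_sub_add_right]
          rw [h2, sum_map_children]
          have h3 : ∑ j ∈ σ.known ∪ litterTypes y.2, w j ≤
              ∑ j ∈ σ.known, w j + ∑ j, ((y.2.2.count j : ℝ≥0∞) + y.2.1 j) * w j := by
            refine le_trans ?_ (add_le_add_right (sum_litterTypes_le y.2 w) _)
            rw [← Finset.sum_union_inter]
            exact le_self_add
          calc _ ≤ (∑ j ∈ σ.known, w j + ∑ j, ((y.2.2.count j : ℝ≥0∞) + y.2.1 j) * w j) +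
                ((rest.map fun b => g (k + 1 - b.1.length) b.2).sum +
                  ∑ j, (y.2.2.count j : ℝ≥0∞) * g (k - a.1.length) j) :=
                add_le_add_left h3 _
            _ = _ := by ring
    refine (lintegral_mono key).trans ?_
    have hga := hg (k - a.1.length) a.2
    have hca := hc σ.known a.2 haK hw
    have hint : ∀ (C : ℝ≥0∞) (A B D : Sample n → ℝ≥0∞),
        ∫⁻ y, A y + (C + (B y + D y)) ∂(ρ a.2) =
          ∫⁻ y, A y ∂(ρ a.2) + (C + (∫⁻ y, B y ∂(ρ a.2) + ∫⁻ y, D y ∂(ρ a.2))) := by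
      intro C A B D
      rw [lintegral_add_left Measurable.of_discrete, lintegral_add_left measurable_const,
        lintegral_add_left Measurable.of_discrete, lintegral_const, measure_univ, mul_one]
    rw [hint, lintegral_indicator_one (MeasurableSet.of_discrete)]
    -- The head has generation at most `k`, so the truncated subtraction is exact and `hg` turns
    -- cost plus potential of the children into the potential of the head.
    have hk1 : k + 1 - a.1.length = k - a.1.length + 1 := by omega
    rw [List.map_cons, List.sum_cons, hk1]
    refine le_trans (le_of_eq ?_) (add_le_add_right (add_le_add_left
      ((add_le_add_left hca _).trans hga) _) _)
    ring

end Exploration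

/-! ### Coupling an edge with a Poisson number -/

theorem lintegral_poissonMeasure_cast (r : ℝ≥0) :
    ∫⁻ N, (N : ℝ≥0∞) ∂(poissonMeasure r) = r := by
  rw [lintegral_countable']
  -- The size-biased Poisson law is the Poisson law shifted by one.
  have h : ∀ N : ℕ, (N : ℝ≥0∞) * poissonMeasure r {N} =
      if N = 0 then 0 else r * poissonMeasure r {N - 1} := by
    intro N
    rcases N with _ | N
    · simp
    · rw [if_neg (Nat.succ_ne_zero N), Nat.add_sub_cancel, poissonMeasure_singleton,
        poissonMeasure_singleton, ← ENNReal.ofReal_natCast, ← ENNReal.ofReal_coe_nnreal,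
        ← ENNReal.ofReal_mul (by positivity), ← ENNReal.ofReal_mul (by positivity)]
      congr 1
      rw [Nat.factorial_succ]
      push_cast
      field_simp
      ring
  simp_rw [h]
  rw [tsum_eq_zero_add' ENNReal.summable]
  simp only [if_true, zero_add, Nat.succ_ne_zero, if_false, Nat.add_sub_cancel, ENNReal.tsum_mul_left]
  have : ∑' N : ℕ, poissonMeasure r {N} = 1 := by
    have := lintegral_countable' (μ := poissonMeasure r) (fun _ => 1)
    simpa using this.symm
  rw [this, mul_one]

theorem poissonMeasure_ne_zero_le (r : ℝ≥0) : poissonMeasure r {N | N ≠ 0} ≤ r := by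
  rw [← lintegral_poissonMeasure_cast r, ← lintegral_indicator_one MeasurableSet.of_discrete]
  refine lintegral_mono fun N => ?_
  rcases N with _ | N
  · simp
  · simp

theorem poissonMeasure_zero (r : ℝ≥0) :
    poissonMeasure r {0} = ENNReal.ofReal (Real.exp (-r)) := by
  simp [poissonMeasure_singleton]

theorem poissonMeasure_one (r : ℝ≥0) :
    poissonMeasure r {1} = ENNReal.ofReal (Real.exp (-r) * r) := by
  simp [poissonMeasure_singleton]

theorem poissonMeasure_pos_eq (r : ℝ≥0) :
    poissonMeasure r {N | N ≠ 0} = ENNReal.ofReal (1 - Real.exp (-r)) := by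
  have : {N : ℕ | N ≠ 0} = {0}ᶜ := rfl
  rw [this, prob_compl_eq_one_sub (measurableSet_singleton 0), poissonMeasure_zero,
    ENNReal.ofReal_sub _ (Real.exp_nonneg _), ENNReal.ofReal_one]

theorem poissonMeasure_two_le (r : ℝ≥0) :
    poissonMeasure r {N | 2 ≤ N} = ENNReal.ofReal (1 - Real.exp (-r) - Real.exp (-r) * r) := by
  have : {N : ℕ | 2 ≤ N} = ({0} ∪ {1})ᶜ := by
    ext N; simp; omega
  rw [this, prob_compl_eq_one_sub (by measurability), measure_union (by simp) (by simp),
    poissonMeasure_zero, poissonMeasure_one, ← ENNReal.ofReal_add (by positivity) (by positivity),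
    ← ENNReal.ofReal_one, ← ENNReal.ofReal_sub _ (by positivity)]
  congr 1
  ring

instance instFiniteEdgeLaw (r : ℝ) : IsFiniteMeasure (edgeLaw r) := by
  constructor
  simp [edgeLaw]

theorem edgeLaw_true (r : ℝ) : edgeLaw r {true} = ENNReal.ofReal r := by
  simp [edgeLaw]

theorem edgeLaw_false (r : ℝ) : edgeLaw r {false} = ENNReal.ofReal (1 - r) := by
  simp [edgeLaw]

theorem isProbabilityMeasure_edgeLaw {r : ℝ} (h0 : 0 ≤ r) (h1 : r ≤ 1) :
    IsProbabilityMeasure (edgeLaw r) := by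
  constructor
  rw [edgeLaw]
  simp only [Measure.coe_add, Measure.coe_smul, Pi.add_apply, Pi.smul_apply, measure_univ,
    smul_eq_mul, mul_one]
  rw [← ENNReal.ofReal_add h0 (by linarith)]
  simp

theorem eq_edgeLaw {μ : Measure Bool} [IsProbabilityMeasure μ] {r : ℝ} (h0 : 0 ≤ r)
    (h : μ {true} = ENNReal.ofReal r) : μ = edgeLaw r := by
  refine Measure.ext_of_singleton fun b => ?_
  cases b
  · have : ({false} : Set Bool) = {true}ᶜ := by ext b; cases b <;> simp
    rw [edgeLaw_false, this, prob_compl_eq_one_sub (measurableSet_singleton _), h,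
      ENNReal.ofReal_sub _ h0, ENNReal.ofReal_one]
  · rw [h, edgeLaw_true]

/-- The conditional probability of an edge of probability `r`, given that the Poisson number of
mean `s` coupled with it equals `N`. -/
def edgeProb (r : ℝ) (s : ℝ≥0) (N : ℕ) : ℝ :=
  -- These values couple the edge maximally with the event `N ≠ 0`, of probability `c = 1 - exp
  -- (-s)`: one of the two events contains the other almost surely.
  if N = 0 then max 0 (r - (1 - Real.exp (-s))) / Real.exp (-s)
  else min 1 (r / (1 - Real.exp (-s)))

theorem one_sub_exp_nonneg (s : ℝ≥0) : 0 ≤ 1 - Real.exp (-(s : ℝ)) := by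
  have : Real.exp (-(s : ℝ)) ≤ 1 := Real.exp_le_one_iff.2 (by simp)
  linarith

theorem edgeProb_nonneg {r : ℝ} (h0 : 0 ≤ r) (s : ℝ≥0) (N : ℕ) : 0 ≤ edgeProb r s N := by
  have := one_sub_exp_nonneg s
  unfold edgeProb
  split_ifs <;> positivity

theorem edgeProb_le_one {r : ℝ} (h1 : r ≤ 1) (s : ℝ≥0) (N : ℕ) : edgeProb r s N ≤ 1 := by
  unfold edgeProb
  split_ifs
  · rw [div_le_one (Real.exp_pos _)]
    exact max_le (Real.exp_nonneg _) (by linarith)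
  · exact min_le_left _ _

/-- A coupling of an edge of probability `r` with a Poisson number of mean `s`. -/
def edgeCoupling (r : ℝ) (s : ℝ≥0) : Measure (Bool × ℕ) :=
  (poissonMeasure s).bind fun N => (edgeLaw (edgeProb r s N)).map fun b => (b, N)

theorem edgeCoupling_apply (r : ℝ) (s : ℝ≥0) (A : Set (Bool × ℕ)) :
    edgeCoupling r s A = ∫⁻ N, edgeLaw (edgeProb r s N) {b | (b, N) ∈ A} ∂(poissonMeasure s) := by
  rw [edgeCoupling, Measure.bind_apply MeasurableSet.of_discrete Measurable.of_discrete.aemeasurable]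
  refine lintegral_congr fun N => ?_
  rw [Measure.map_apply Measurable.of_discrete MeasurableSet.of_discrete]
  rfl

theorem isProbabilityMeasure_edgeCoupling {r : ℝ} (h0 : 0 ≤ r) (h1 : r ≤ 1) (s : ℝ≥0) :
    IsProbabilityMeasure (edgeCoupling r s) := by
  constructor
  rw [edgeCoupling_apply]
  have : ∀ N, edgeLaw (edgeProb r s N) {b | (b, N) ∈ (Set.univ : Set (Bool × ℕ))} = 1 := by
    intro N
    have := isProbabilityMeasure_edgeLaw (edgeProb_nonneg h0 s N) (edgeProb_le_one h1 s N)
    exact measure_univ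
  simp only [this, lintegral_one, measure_univ]

theorem map_snd_edgeCoupling {r : ℝ} (h0 : 0 ≤ r) (h1 : r ≤ 1) (s : ℝ≥0) :
    (edgeCoupling r s).map Prod.snd = poissonMeasure s := by
  refine Measure.ext fun A hA => ?_
  rw [Measure.map_apply measurable_snd hA, edgeCoupling_apply, ← lintegral_indicator_one hA]
  refine lintegral_congr fun N => ?_
  have := isProbabilityMeasure_edgeLaw (edgeProb_nonneg h0 s N) (edgeProb_le_one h1 s N)
  by_cases hN : N ∈ A
  · simp only [Set.mem_preimage, hN, Set.indicator_of_mem, Pi.one_apply]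
    exact measure_univ
  · simp [Set.mem_preimage, hN]

theorem lintegral_eq_zero_add {μ : Measure ℕ} (f : ℕ → ℝ≥0∞) :
    ∫⁻ N, f N ∂μ = f 0 * μ {0} + ∫⁻ N in {N | N ≠ 0}, f N ∂μ := by
  rw [← lintegral_add_compl f (measurableSet_singleton 0)]
  congr 1
  simp [mul_comm]

/-- With `c = 1 - exp (-s)`, the two cases contribute `max 0 (r - c) + min c r = r`. -/
theorem map_fst_edgeCoupling {r : ℝ} (h0 : 0 ≤ r) (h1 : r ≤ 1) (s : ℝ≥0) :
    (edgeCoupling r s).map Prod.fst = edgeLaw r := by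
  have := isProbabilityMeasure_edgeCoupling h0 h1 s
  have : IsProbabilityMeasure ((edgeCoupling r s).map Prod.fst) :=
    Measure.isProbabilityMeasure_map measurable_fst.aemeasurable
  refine eq_edgeLaw h0 ?_
  rw [Measure.map_apply measurable_fst (measurableSet_singleton _), edgeCoupling_apply]
  have h : ∀ N, edgeLaw (edgeProb r s N) {b | (b, N) ∈ Prod.fst ⁻¹' ({true} : Set Bool)} =
      ENNReal.ofReal (edgeProb r s N) := fun N => edgeLaw_true _
  simp only [h]
  rw [lintegral_eq_zero_add]
  have h2 : ∫⁻ N in {N | N ≠ 0}, ENNReal.ofReal (edgeProb r s N) ∂(poissonMeasure s) =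
      ENNReal.ofReal (min 1 (r / (1 - Real.exp (-s)))) *
        ENNReal.ofReal (1 - Real.exp (-s)) := by
    rw [← poissonMeasure_pos_eq, ← setLIntegral_const]
    refine setLIntegral_congr_fun MeasurableSet.of_discrete fun N hN => ?_
    simp only [edgeProb, if_neg (show N ≠ 0 from hN)]
  have he := Real.exp_pos (-(s : ℝ))
  have hs := one_sub_exp_nonneg s
  rw [h2, poissonMeasure_zero, ← ENNReal.ofReal_mul (edgeProb_nonneg h0 _ _),
    ← ENNReal.ofReal_mul (by positivity), ← ENNReal.ofReal_add
      (mul_nonneg (edgeProb_nonneg h0 _ _) he.le) (by positivity)]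
  congr 1
  rw [edgeProb, if_pos rfl, div_mul_cancel₀ _ he.ne']
  -- If `c = 0`, the quotient by zero is harmless because it is multiplied by the probability zero
  -- of `N ≠ 0`.
  rcases hs.eq_or_lt with h3 | h3
  · rw [← h3]; simp [h0]
  · rcases le_total r (1 - Real.exp (-s)) with h4 | h4
    · rw [max_eq_left (by linarith), min_eq_right ((div_le_one h3).2 h4), div_mul_cancel₀ _ h3.ne']
      ring
    · rw [max_eq_right (by linarith), min_eq_left ((one_le_div h3).2 h4)]
      ring

/-- The event that an edge disagrees with a number. -/
def Mismatch : Set (Bool × ℕ) := {y | y.2 ≠ if y.1 = true then 1 else 0}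

/-- A disagreement is `(true, 0)`, `(false, 1)` or a number at least two. Maximality bounds the
first two together by `|r - c|` with `c = 1 - exp (-s)`, so the total is at most `|r - s| + (s - c)
+ (c - s * exp (-s)) = |r - s| + s * c`, and `c ≤ s`. -/
theorem edgeCoupling_mismatch_le {r : ℝ} (h0 : 0 ≤ r) (h1 : r ≤ 1) (s : ℝ≥0) :
    edgeCoupling r s Mismatch ≤ ENNReal.ofReal (|r - s| + s ^ 2) := by
  have hsub : (Mismatch : Set (Bool × ℕ)) ⊆
      ({(true, 0)} ∪ {(false, 1)}) ∪ Prod.snd ⁻¹' {N | 2 ≤ N} := by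
    rintro ⟨b, N⟩ h
    simp only [Mismatch, Set.mem_ofPred_eq] at h
    simp only [Set.mem_union, Set.mem_singleton_iff, Prod.mk.injEq, Set.mem_preimage,
      Set.mem_ofPred_eq]
    cases b <;> simp at h ⊢ <;> omega
  have e1 : edgeCoupling r s {(true, 0)} =
      ENNReal.ofReal (max 0 (r - (1 - Real.exp (-s)))) := by
    rw [edgeCoupling_apply, lintegral_eq_zero_add]
    have : ∫⁻ N in {N | N ≠ 0}, edgeLaw (edgeProb r s N)
        {b | (b, N) ∈ ({(true, 0)} : Set (Bool × ℕ))} ∂(poissonMeasure s) = 0 := by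
      rw [setLIntegral_congr_fun (g := fun _ => 0) MeasurableSet.of_discrete]
      · simp
      · intro N hN
        have : N ≠ 0 := hN
        simp [this]
    rw [this, add_zero]
    have : {b | (b, 0) ∈ ({(true, 0)} : Set (Bool × ℕ))} = {true} := by ext b; simp
    rw [this, edgeLaw_true, poissonMeasure_zero, ← ENNReal.ofReal_mul (edgeProb_nonneg h0 _ _)]
    rw [edgeProb, if_pos rfl, div_mul_cancel₀ _ (Real.exp_pos _).ne']
  have e2 : edgeCoupling r s {(false, 1)} ≤
      ENNReal.ofReal (max 0 ((1 - Real.exp (-s)) - r)) := by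
    rw [edgeCoupling_apply]
    have hle : ∀ N, edgeLaw (edgeProb r s N) {b | (b, N) ∈ ({(false, 1)} : Set (Bool × ℕ))} ≤
        Set.indicator {N | N ≠ 0}
          (fun _ => ENNReal.ofReal (1 - min 1 (r / (1 - Real.exp (-s))))) N := by
      intro N
      by_cases hN : N = 1
      · subst hN
        have : {b | (b, 1) ∈ ({(false, 1)} : Set (Bool × ℕ))} = {false} := by ext b; simp
        rw [this, edgeLaw_false, Set.indicator_of_mem (by simp)]
        simp [edgeProb]
      · simp [hN]
    refine (lintegral_mono hle).trans ?_
    rw [lintegral_indicator_const MeasurableSet.of_discrete, poissonMeasure_pos_eq,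
      ← ENNReal.ofReal_mul (by linarith [min_le_left 1 (r / (1 - Real.exp (-s)))])]
    refine ENNReal.ofReal_le_ofReal ?_
    have hs := one_sub_exp_nonneg s
    rcases hs.eq_or_lt with h3 | h3
    · rw [← h3]; simp
    · rcases le_total r (1 - Real.exp (-s)) with h4 | h4
      · rw [min_eq_right ((div_le_one h3).2 h4), sub_mul, div_mul_cancel₀ _ h3.ne', one_mul]
        exact le_max_right _ _
      · rw [min_eq_left ((one_le_div h3).2 h4)]
        simp
  have e3 : edgeCoupling r s (Prod.snd ⁻¹' {N | 2 ≤ N}) =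
      ENNReal.ofReal (1 - Real.exp (-s) - Real.exp (-s) * s) := by
    rw [← Measure.map_apply measurable_snd MeasurableSet.of_discrete,
      map_snd_edgeCoupling h0 h1, poissonMeasure_two_le]
  have hs0 : (0 : ℝ) ≤ s := s.2
  have hexp : 1 - (s : ℝ) ≤ Real.exp (-s) := by
    have := Real.add_one_le_exp (-(s : ℝ)); linarith
  have h2 : 0 ≤ 1 - Real.exp (-s) - Real.exp (-s) * s := by
    have h3 := Real.add_one_le_exp (s : ℝ)
    have h4 : Real.exp (-s) * Real.exp s = 1 := by rw [← Real.exp_add]; simp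
    nlinarith [Real.exp_pos (-(s : ℝ))]
  calc edgeCoupling r s Mismatch
      ≤ edgeCoupling r s {(true, 0)} + edgeCoupling r s {(false, 1)} +
        edgeCoupling r s (Prod.snd ⁻¹' {N | 2 ≤ N}) :=
        (measure_mono hsub).trans ((measure_union_le _ _).trans
          (add_le_add_left (measure_union_le _ _) _))
    _ ≤ ENNReal.ofReal (max 0 (r - (1 - Real.exp (-s)))) +
        ENNReal.ofReal (max 0 ((1 - Real.exp (-s)) - r)) +
        ENNReal.ofReal (1 - Real.exp (-s) - Real.exp (-s) * s) := by
        rw [e1, e3]; gcongr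
    _ = ENNReal.ofReal (max 0 (r - (1 - Real.exp (-s))) + max 0 ((1 - Real.exp (-s)) - r) +
        (1 - Real.exp (-s) - Real.exp (-s) * s)) := by
        rw [ENNReal.ofReal_add (by positivity) h2,
          ENNReal.ofReal_add (le_max_left _ _) (le_max_left _ _)]
    _ ≤ _ := by
        refine ENNReal.ofReal_le_ofReal ?_
        have h5 : max 0 (r - (1 - Real.exp (-s))) + max 0 ((1 - Real.exp (-s)) - r) ≤
            |r - s| + (s - (1 - Real.exp (-s))) := by
          rcases le_total r (1 - Real.exp (-s)) with h4 | h4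
          · rw [max_eq_left (by linarith), max_eq_right (by linarith)]
            have := neg_abs_le (r - s)
            linarith
          · rw [max_eq_right (by linarith), max_eq_left (by linarith)]
            have := le_abs_self (r - s)
            linarith
        nlinarith [Real.exp_pos (-(s : ℝ))]

/-! ### Coupling a digraph with the litter of an individual -/

/-- The numbers attached to the edges, and an additional number. -/
abbrev EdgeNumbers (n : ℕ) : Type := (Fin n → Fin n → Bool × ℕ) × ℕ

namespace EdgeNumbers

/-- The digraph. -/
def edges (y : EdgeNumbers n) : Adj n := fun i j => (y.1 i j).1

/-- The numbers of the inbound edges of `s`. -/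
def counts (s : Fin n) (y : EdgeNumbers n) : Fin n → ℕ := fun j => (y.1 j s).2

/-- The numbers of the outbound edges of `s`, and the additional number instead of the number of
the loop at `s`. -/
def inactive (s : Fin n) (y : EdgeNumbers n) : Fin n → ℕ :=
  fun t => if t = s then y.2 else (y.1 s t).2

end EdgeNumbers

/-- Every edge is coupled with a Poisson number, independently. -/
def edgeNumbersLaw (P : Fin n → Fin n → ℝ) (Q : Fin n → Fin n → ℝ≥0) (s : Fin n) :
    Measure (EdgeNumbers n) :=
  (Measure.pi fun i => Measure.pi fun j => edgeCoupling (P i j) (Q i j)).prod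
    (poissonMeasure (Q s s))

/-- A coupling of the digraph with the litter of an individual of type `s`. -/
def sampleLaw (P : Fin n → Fin n → ℝ) (Q : Fin n → Fin n → ℝ≥0) (s : Fin n) :
    Measure (Sample n) :=
  (edgeNumbersLaw P Q s).bind fun y =>
    (uniformOn (arrangements (y.counts s))).map fun l => (y.edges, (y.inactive s, l))

instance instProbUniformOnArrangements (z : Fin n → ℕ) :
    IsProbabilityMeasure (uniformOn (arrangements z)) :=
  isProbabilityMeasure_uniformOn (finite_arrangements z) (nonempty_arrangements z)

section

variable {P : Fin n → Fin n → ℝ} {Q : Fin n → Fin n → ℝ≥0}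

theorem isProbabilityMeasure_edgeNumbersLaw (h0 : ∀ i j, 0 ≤ P i j) (h1 : ∀ i j, P i j ≤ 1)
    (s : Fin n) : IsProbabilityMeasure (edgeNumbersLaw P Q s) := by
  have := fun i j => isProbabilityMeasure_edgeCoupling (h0 i j) (h1 i j) (Q i j)
  unfold edgeNumbersLaw
  infer_instance

theorem lintegral_sampleLaw (f : Sample n → ℝ≥0∞) (s : Fin n) :
    ∫⁻ x, f x ∂(sampleLaw P Q s) = ∫⁻ y, ∫⁻ l, f (y.edges, (y.inactive s, l))
      ∂(uniformOn (arrangements (y.counts s))) ∂(edgeNumbersLaw P Q s) := by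
  rw [sampleLaw, Measure.lintegral_bind Measurable.of_discrete.aemeasurable
    Measurable.of_discrete.aemeasurable]
  refine lintegral_congr fun y => ?_
  rw [lintegral_map Measurable.of_discrete Measurable.of_discrete]

/-- Almost every arrangement has the prescribed counts, so functions of the counts do not see the
random order. -/
theorem lintegral_sampleLaw_count (f : Adj n → (Fin n → ℕ) → (Fin n → ℕ) → ℝ≥0∞) (s : Fin n) :
    ∫⁻ x, f x.1 x.2.1 (fun j => x.2.2.count j) ∂(sampleLaw P Q s) =
      ∫⁻ y, f y.edges (y.inactive s) (y.counts s) ∂(edgeNumbersLaw P Q s) := by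
  rw [lintegral_sampleLaw]
  refine lintegral_congr fun y => ?_
  have : ∀ᵐ l ∂(uniformOn (arrangements (y.counts s))),
      f y.edges (y.inactive s) (fun j => l.count j) = f y.edges (y.inactive s) (y.counts s) := by
    have h : ∀ᵐ l ∂(uniformOn (arrangements (y.counts s))), l ∈ arrangements (y.counts s) := by
      rw [ae_iff]
      have h1 := uniformOn_self (finite_arrangements (y.counts s)) (nonempty_arrangements _)
      exact (prob_compl_eq_zero_iff MeasurableSet.of_discrete).2 h1
    filter_upwards [h] with l hl
    rw [show (fun j => l.count j) = y.counts s from funext hl]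
  rw [lintegral_congr_ae this]
  simp

theorem sampleLaw_apply_count (A : Set (Adj n × (Fin n → ℕ) × (Fin n → ℕ))) (s : Fin n) :
    sampleLaw P Q s {x | (x.1, x.2.1, fun j => x.2.2.count j) ∈ A} =
      edgeNumbersLaw P Q s {y | (y.edges, y.inactive s, y.counts s) ∈ A} := by
  rw [← lintegral_indicator_one MeasurableSet.of_discrete,
    ← lintegral_indicator_one MeasurableSet.of_discrete]
  exact lintegral_sampleLaw_count (fun x d z => A.indicator 1 (x, d, z)) s

theorem isProbabilityMeasure_sampleLaw (h0 : ∀ i j, 0 ≤ P i j) (h1 : ∀ i j, P i j ≤ 1)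
    (s : Fin n) : IsProbabilityMeasure (sampleLaw P Q s) := by
  have := isProbabilityMeasure_edgeNumbersLaw (Q := Q) h0 h1 s
  constructor
  have := sampleLaw_apply_count (P := P) (Q := Q) Set.univ s
  simpa using this

theorem map_edges_edgeNumbersLaw (h0 : ∀ i j, 0 ≤ P i j) (h1 : ∀ i j, P i j ≤ 1) (s : Fin n) :
    (edgeNumbersLaw P Q s).map EdgeNumbers.edges =
      Measure.pi fun i => Measure.pi fun j => edgeLaw (P i j) := by
  have := fun i j => isProbabilityMeasure_edgeCoupling (h0 i j) (h1 i j) (Q i j)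
  have h2 := fun i j => map_fst_edgeCoupling (h0 i j) (h1 i j) (Q i j)
  have h3 := fun i j => isProbabilityMeasure_edgeLaw (h0 i j) (h1 i j)
  have he : (EdgeNumbers.edges : EdgeNumbers n → Adj n) =
      (fun (M : Fin n → Fin n → Bool × ℕ) i j => (M i j).1) ∘ Prod.fst := rfl
  rw [he, ← Measure.map_map Measurable.of_discrete measurable_fst, edgeNumbersLaw,
    Measure.map_fst_prod, measure_univ, one_smul]
  have hi : ∀ i, (Measure.pi fun j => edgeCoupling (P i j) (Q i j)).map
      (fun (M : Fin n → Bool × ℕ) j => (M j).1) = Measure.pi fun j => edgeLaw (P i j) := by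
    intro i
    have h4 : ∀ j, SigmaFinite ((edgeCoupling (P i j) (Q i j)).map Prod.fst) := by
      intro j; rw [h2]; infer_instance
    have h7 := Measure.pi_map_pi (μ := fun j => edgeCoupling (P i j) (Q i j))
      (f := fun _ => Prod.fst) fun j => measurable_fst.aemeasurable
    rw [h7]
    simp only [h2]
  have h5 : ∀ i, SigmaFinite ((Measure.pi fun j => edgeCoupling (P i j) (Q i j)).map
      (fun (M : Fin n → Bool × ℕ) j => (M j).1)) := by
    intro i; rw [hi]; infer_instance
  have h6 := Measure.pi_map_pi (μ := fun i => Measure.pi fun j => edgeCoupling (P i j) (Q i j))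
    (f := fun _ (M : Fin n → Bool × ℕ) j => (M j).1)
    fun j => Measurable.of_discrete.aemeasurable
  rw [h6]
  simp only [hi]

theorem map_fst_sampleLaw (h0 : ∀ i j, 0 ≤ P i j) (h1 : ∀ i j, P i j ≤ 1) (s : Fin n) :
    (sampleLaw P Q s).map Prod.fst = Measure.pi fun i => Measure.pi fun j => edgeLaw (P i j) := by
  rw [← map_edges_edgeNumbersLaw (Q := Q) h0 h1 s]
  refine Measure.ext_of_lintegral _ fun f hf => ?_
  rw [lintegral_map hf measurable_fst, lintegral_map hf Measurable.of_discrete]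
  exact lintegral_sampleLaw_count (fun x _ _ => f x) s

/-- Column `s` (offspring) and row `s` (inactive nodes) share only the diagonal entry. The
additional number replaces it in the row, so the two families are independent. -/
theorem map_numbers_edgeNumbersLaw (h0 : ∀ i j, 0 ≤ P i j) (h1 : ∀ i j, P i j ≤ 1) (s : Fin n) :
    (edgeNumbersLaw P Q s).map (fun y => (y.inactive s, y.counts s)) =
      (Measure.pi fun t => poissonMeasure (Q s t)).prod
        (Measure.pi fun j => poissonMeasure (Q j s)) := by
  have := fun i j => isProbabilityMeasure_edgeCoupling (h0 i j) (h1 i j) (Q i j)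
  refine Measure.ext_of_singleton fun ⟨d, z⟩ => ?_
  rw [Measure.map_apply Measurable.of_discrete (measurableSet_singleton _)]
  have hpre : (fun y : EdgeNumbers n => (y.inactive s, y.counts s)) ⁻¹' {(d, z)} =
      (Set.pi Set.univ fun i => Set.pi Set.univ fun j =>
        if j = s then Prod.snd ⁻¹' {z i} else if i = s then Prod.snd ⁻¹' {d j} else Set.univ) ×ˢ
      {d s} := by
    ext y
    simp only [Set.mem_preimage, Set.mem_singleton_iff, Prod.mk.injEq, Set.mem_prod, Set.mem_pi,
      Set.mem_univ, true_imp_iff, funext_iff, EdgeNumbers.inactive, EdgeNumbers.counts]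
    constructor
    · rintro ⟨hd, hz⟩
      refine ⟨fun i j => ?_, by simpa using hd s⟩
      split_ifs with hj hi
      · subst hj; exact hz i
      · subst hi; simpa [hj] using hd j
      · trivial
    · rintro ⟨h, hs⟩
      refine ⟨fun t => ?_, fun j => by simpa using h j s⟩
      split_ifs with ht
      · rw [ht]; exact hs
      · simpa [ht] using h s t
  have hsnd : ∀ i j m, edgeCoupling (P i j) (Q i j) (Prod.snd ⁻¹' {m}) =
      poissonMeasure (Q i j) {m} := by
    intro i j m
    rw [← Measure.map_apply measurable_snd (measurableSet_singleton _),
      map_snd_edgeCoupling (h0 i j) (h1 i j)]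
  rw [hpre, edgeNumbersLaw, Measure.prod_prod, ← Set.singleton_prod_singleton, Measure.prod_prod]
  simp_rw [Measure.pi_pi]
  rw [← Set.univ_pi_singleton d, ← Set.univ_pi_singleton z, Measure.pi_pi, Measure.pi_pi]
  have hrow : ∀ i, ∏ j, edgeCoupling (P i j) (Q i j)
      (if j = s then Prod.snd ⁻¹' {z i} else if i = s then Prod.snd ⁻¹' {d j} else Set.univ) =
      poissonMeasure (Q i s) {z i} *
        if i = s then ∏ j ∈ Finset.univ.erase s, poissonMeasure (Q s j) {d j} else 1 := by
    intro i
    rw [← Finset.mul_prod_erase Finset.univ _ (Finset.mem_univ s), if_pos rfl, hsnd]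
    congr 1
    split_ifs with hi
    · subst hi
      refine Finset.prod_congr rfl fun j hj => ?_
      rw [if_neg (Finset.ne_of_mem_erase hj), hsnd]
    · refine Finset.prod_eq_one fun j hj => ?_
      rw [if_neg (Finset.ne_of_mem_erase hj)]
      exact measure_univ
  simp_rw [hrow]
  rw [Finset.prod_mul_distrib, Finset.prod_ite_eq' Finset.univ s, if_pos (Finset.mem_univ s),
    ← Finset.mul_prod_erase Finset.univ (fun j => poissonMeasure (Q s j) {d j})
      (Finset.mem_univ s)]
  ring

theorem map_snd_sampleLaw (h0 : ∀ i j, 0 ≤ P i j) (h1 : ∀ i j, P i j ≤ 1) (s : Fin n) :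
    (sampleLaw P Q s).map Prod.snd =
      (Measure.pi fun t => poissonMeasure (Q s t)).prod
        ((Measure.pi fun j => poissonMeasure (Q j s)).bind fun z => uniformOn (arrangements z)) := by
  have hb : IsProbabilityMeasure ((Measure.pi fun j => poissonMeasure (Q j s)).bind
      fun z => uniformOn (arrangements z)) :=
    isProbabilityMeasure_bind Measurable.of_discrete.aemeasurable
      (Eventually.of_forall fun z => inferInstance)
  refine Measure.ext_of_lintegral _ fun f hf => ?_
  rw [lintegral_map hf measurable_snd, lintegral_sampleLaw (fun x => f x.2),
    lintegral_prod _ hf.aemeasurable]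
  have h2 : ∀ d, ∫⁻ l, f (d, l) ∂((Measure.pi fun j => poissonMeasure (Q j s)).bind
      fun z => uniformOn (arrangements z)) = ∫⁻ z, ∫⁻ l, f (d, l) ∂(uniformOn (arrangements z))
        ∂(Measure.pi fun j => poissonMeasure (Q j s)) := fun d =>
    Measure.lintegral_bind Measurable.of_discrete.aemeasurable Measurable.of_discrete.aemeasurable
  simp only [h2]
  rw [← lintegral_prod (fun x : (Fin n → ℕ) × (Fin n → ℕ) =>
      ∫⁻ l, f (x.1, l) ∂(uniformOn (arrangements x.2))) Measurable.of_discrete.aemeasurable,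
    ← map_numbers_edgeNumbersLaw h0 h1, lintegral_map Measurable.of_discrete Measurable.of_discrete]

theorem edgeNumbersLaw_edge (h0 : ∀ i j, 0 ≤ P i j) (h1 : ∀ i j, P i j ≤ 1) (s i j : Fin n)
    (A : Set (Bool × ℕ)) :
    edgeNumbersLaw P Q s {y | y.1 i j ∈ A} = edgeCoupling (P i j) (Q i j) A := by
  have := fun i j => isProbabilityMeasure_edgeCoupling (h0 i j) (h1 i j) (Q i j)
  have e1 : {y : EdgeNumbers n | y.1 i j ∈ A} =
      Prod.fst ⁻¹' (Function.eval i ⁻¹' (Function.eval j ⁻¹' A)) := rfl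
  rw [e1, edgeNumbersLaw, ← Measure.map_apply measurable_fst MeasurableSet.of_discrete,
    Measure.map_fst_prod, measure_univ, one_smul,
    (measurePreserving_eval (fun i => Measure.pi fun j => edgeCoupling (P i j) (Q i j)) i
      ).measure_preimage MeasurableSet.of_discrete.nullMeasurableSet,
    (measurePreserving_eval (fun j => edgeCoupling (P i j) (Q i j)) j
      ).measure_preimage MeasurableSet.of_discrete.nullMeasurableSet]

theorem edgeNumbersLaw_snd (h0 : ∀ i j, 0 ≤ P i j) (h1 : ∀ i j, P i j ≤ 1) (s : Fin n)
    (A : Set ℕ) : edgeNumbersLaw P Q s {y | y.2 ∈ A} = poissonMeasure (Q s s) A := by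
  have := fun i j => isProbabilityMeasure_edgeCoupling (h0 i j) (h1 i j) (Q i j)
  have e1 : {y : EdgeNumbers n | y.2 ∈ A} = Prod.snd ⁻¹' A := rfl
  rw [e1, edgeNumbersLaw, ← Measure.map_apply measurable_snd MeasurableSet.of_discrete,
    Measure.map_snd_prod, measure_univ, one_smul]

theorem sampleLaw_count_mismatch_le (h0 : ∀ i j, 0 ≤ P i j) (h1 : ∀ i j, P i j ≤ 1)
    (s j : Fin n) :
    sampleLaw P Q s {x | x.2.2.count j ≠ if x.1 j s = true then 1 else 0} ≤
      ENNReal.ofReal (|P j s - Q j s| + Q j s ^ 2) := by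
  have h := sampleLaw_apply_count (P := P) (Q := Q)
    {a | a.2.2 j ≠ if a.1 j s = true then 1 else 0} s
  refine h.le.trans (le_trans (le_of_eq ?_) (edgeCoupling_mismatch_le (h0 j s) (h1 j s) (Q j s)))
  exact edgeNumbersLaw_edge h0 h1 s j s Mismatch

/-- Off the diagonal this is the coupling of one edge. On it there is no loop, so the additional
number must vanish; it fails to with probability at most `Q s s = |P s s - Q s s|`, and the same
bound results. -/
theorem sampleLaw_inactive_mismatch_le (h0 : ∀ i j, 0 ≤ P i j) (h1 : ∀ i j, P i j ≤ 1)
    (hd : ∀ i, P i i = 0) (s t : Fin n) :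
    sampleLaw P Q s {x | x.2.1 t ≠ if x.1 s t = true then 1 else 0} ≤
      ENNReal.ofReal (|P s t - Q s t| + Q s t ^ 2) := by
  have h := sampleLaw_apply_count (P := P) (Q := Q)
    {a | a.2.1 t ≠ if a.1 s t = true then 1 else 0} s
  refine h.le.trans ?_
  by_cases ht : t = s
  · subst ht
    have hsub : {y : EdgeNumbers n | (y.edges, y.inactive t, y.counts t) ∈
        {a : Adj n × (Fin n → ℕ) × (Fin n → ℕ) | a.2.1 t ≠ if a.1 t t = true then 1 else 0}} ⊆
        {y | y.1 t t ∈ (Prod.fst ⁻¹' {true} : Set (Bool × ℕ))} ∪ {y | y.2 ∈ {N | N ≠ 0}} := by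
      intro y hy
      have hy' : y.inactive t t ≠ if y.edges t t = true then 1 else 0 := hy
      rw [show y.inactive t t = y.2 from if_pos rfl] at hy'
      by_cases hb : y.edges t t = true
      · exact Or.inl hb
      · rw [if_neg hb] at hy'
        exact Or.inr hy'
    refine (measure_mono hsub).trans ((measure_union_le _ _).trans ?_)
    rw [edgeNumbersLaw_edge h0 h1, edgeNumbersLaw_snd h0 h1,
      ← Measure.map_apply measurable_fst (measurableSet_singleton _),
      map_fst_edgeCoupling (h0 t t) (h1 t t), edgeLaw_true, hd t, ENNReal.ofReal_zero, zero_add]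
    refine (poissonMeasure_ne_zero_le _).trans ?_
    rw [← ENNReal.ofReal_coe_nnreal]
    refine ENNReal.ofReal_le_ofReal ?_
    rw [zero_sub, abs_neg]
    linarith [sq_nonneg (Q t t : ℝ), le_abs_self (Q t t : ℝ)]
  · refine le_trans (le_of_eq ?_) (edgeCoupling_mismatch_le (h0 s t) (h1 s t) (Q s t))
    rw [← edgeNumbersLaw_edge h0 h1 s s t Mismatch]
    congr 1
    ext y
    have hy : y.inactive s t = (y.1 s t).2 := if_neg ht
    change y.inactive s t ≠ _ ↔ (y.1 s t).2 ≠ _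
    rw [hy]
    rfl

theorem sampleLaw_numbers (h0 : ∀ i j, 0 ≤ P i j) (h1 : ∀ i j, P i j ≤ 1)
    (f : (Fin n → ℕ) → (Fin n → ℕ) → ℝ≥0∞) (s : Fin n) :
    ∫⁻ x, f x.2.1 (fun j => x.2.2.count j) ∂(sampleLaw P Q s) =
      ∫⁻ d, ∫⁻ z, f d z ∂(Measure.pi fun j => poissonMeasure (Q j s))
        ∂(Measure.pi fun t => poissonMeasure (Q s t)) := by
  rw [lintegral_sampleLaw_count (fun _ d z => f d z),
    ← lintegral_prod (fun x : (Fin n → ℕ) × (Fin n → ℕ) => f x.1 x.2)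
      Measurable.of_discrete.aemeasurable, ← map_numbers_edgeNumbersLaw h0 h1,
    lintegral_map Measurable.of_discrete Measurable.of_discrete]

theorem lintegral_pi_eval {ι : Type*} [Fintype ι] (r : ι → ℝ≥0) (i : ι) (f : ℕ → ℝ≥0∞) :
    ∫⁻ z, f (z i) ∂(Measure.pi fun j => poissonMeasure (r j)) =
      ∫⁻ N, f N ∂(poissonMeasure (r i)) := by
  rw [← (measurePreserving_eval (fun j => poissonMeasure (r j)) i).map_eq,
    lintegral_map Measurable.of_discrete (measurable_pi_apply i)]

theorem lintegral_sampleLaw_count_cast (h0 : ∀ i j, 0 ≤ P i j) (h1 : ∀ i j, P i j ≤ 1)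
    (s j : Fin n) :
    ∫⁻ x, (x.2.2.count j : ℝ≥0∞) ∂(sampleLaw P Q s) = Q j s := by
  rw [sampleLaw_numbers h0 h1 (fun _ z => (z j : ℝ≥0∞))]
  simp only [lintegral_const, measure_univ, mul_one]
  rw [lintegral_pi_eval (fun i => Q i s) j (fun N => (N : ℝ≥0∞)), lintegral_poissonMeasure_cast]

theorem lintegral_sampleLaw_inactive_cast (h0 : ∀ i j, 0 ≤ P i j) (h1 : ∀ i j, P i j ≤ 1)
    (s t : Fin n) :
    ∫⁻ x, (x.2.1 t : ℝ≥0∞) ∂(sampleLaw P Q s) = Q s t := by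
  rw [sampleLaw_numbers h0 h1 (fun d _ => (d t : ℝ≥0∞))]
  simp only [lintegral_const, measure_univ, mul_one]
  rw [lintegral_pi_eval (fun i => Q s i) t (fun N => (N : ℝ≥0∞)), lintegral_poissonMeasure_cast]

theorem sampleLaw_inactive_ne_zero_le (h0 : ∀ i j, 0 ≤ P i j) (h1 : ∀ i j, P i j ≤ 1)
    (s t : Fin n) : sampleLaw P Q s {x | x.2.1 t ≠ 0} ≤ Q s t := by
  rw [← lintegral_sampleLaw_inactive_cast h0 h1 s t,
    ← lintegral_indicator_one MeasurableSet.of_discrete]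
  refine lintegral_mono fun x => ?_
  by_cases h : x.2.1 t = 0
  · simp [h]
  · have : 1 ≤ x.2.1 t := Nat.one_le_iff_ne_zero.2 h
    simpa [h] using this

theorem sampleLaw_count_ne_zero_le (h0 : ∀ i j, 0 ≤ P i j) (h1 : ∀ i j, P i j ≤ 1)
    (s j : Fin n) : sampleLaw P Q s {x | x.2.2.count j ≠ 0} ≤ Q j s := by
  rw [← lintegral_sampleLaw_count_cast h0 h1 s j,
    ← lintegral_indicator_one MeasurableSet.of_discrete]
  refine lintegral_mono fun x => ?_
  by_cases h : x.2.2.count j = 0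
  · simp [h]
  · have : 1 ≤ x.2.2.count j := Nat.one_le_iff_ne_zero.2 h
    rw [Set.indicator_of_mem (by exact h), Pi.one_apply]
    change (1 : ℝ≥0∞) ≤ _
    exact_mod_cast this

/-- Markov's inequality for the product of the two numbers, which are independent, even for `j = s`.
-/
theorem sampleLaw_both_ne_zero_le (h0 : ∀ i j, 0 ≤ P i j) (h1 : ∀ i j, P i j ≤ 1)
    (s j : Fin n) :
    sampleLaw P Q s {x | x.2.2.count j ≠ 0 ∧ x.2.1 j ≠ 0} ≤ (Q j s * Q s j : ℝ≥0) := by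
  have h : ∫⁻ x, (x.2.1 j : ℝ≥0∞) * x.2.2.count j ∂(sampleLaw P Q s) =
      (Q j s * Q s j : ℝ≥0) := by
    rw [sampleLaw_numbers h0 h1 (fun d z => (d j : ℝ≥0∞) * z j)]
    have : ∀ d : Fin n → ℕ,
        ∫⁻ z, (d j : ℝ≥0∞) * z j ∂(Measure.pi fun j => poissonMeasure (Q j s)) =
          d j * Q j s := by
      intro d
      rw [lintegral_const_mul _ Measurable.of_discrete,
        lintegral_pi_eval (fun i => Q i s) j (fun N => (N : ℝ≥0∞)),
        lintegral_poissonMeasure_cast]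
    simp only [this]
    rw [lintegral_mul_const _ Measurable.of_discrete,
      lintegral_pi_eval (fun i => Q s i) j (fun N => (N : ℝ≥0∞)), lintegral_poissonMeasure_cast,
      mul_comm, ENNReal.coe_mul]
  rw [← h, ← lintegral_indicator_one MeasurableSet.of_discrete]
  refine lintegral_mono fun x => ?_
  by_cases hx : x.2.2.count j ≠ 0 ∧ x.2.1 j ≠ 0
  · have : 1 ≤ x.2.1 j * x.2.2.count j :=
      Nat.one_le_iff_ne_zero.2 (mul_ne_zero hx.2 hx.1)
    rw [Set.indicator_of_mem (by exact hx), Pi.one_apply]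
    change (1 : ℝ≥0∞) ≤ _
    exact_mod_cast this
  · rw [Set.indicator_of_notMem (by exact hx)]
    exact zero_le

/-- The probability of a bad sample. -/
theorem sampleLaw_not_isGood_le (h0 : ∀ i j, 0 ≤ P i j) (h1 : ∀ i j, P i j ≤ 1)
    (hd : ∀ i, P i i = 0) (K : Finset (Fin n)) (s : Fin n) :
    sampleLaw P Q s {x | ¬ Exploration.IsGood K s x} ≤ ENNReal.ofReal
      (∑ j, (|P j s - Q j s| + Q j s ^ 2) + ∑ j, (|P s j - Q s j| + Q s j ^ 2) +
        ∑ j ∈ K, ((Q j s : ℝ) + Q s j) + ∑ j, (Q j s : ℝ) * Q s j) := by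
  have hsub : {x : Sample n | ¬ Exploration.IsGood K s x} ⊆
      (⋃ j ∈ Finset.univ, {x : Sample n | x.2.2.count j ≠ if x.1 j s = true then 1 else 0}) ∪
      (⋃ j ∈ Finset.univ, {x : Sample n | x.2.1 j ≠ if x.1 s j = true then 1 else 0}) ∪
      (⋃ j ∈ K, ({x : Sample n | x.2.2.count j ≠ 0} ∪ {x : Sample n | x.2.1 j ≠ 0})) ∪
      (⋃ j ∈ Finset.univ, {x : Sample n | x.2.2.count j ≠ 0 ∧ x.2.1 j ≠ 0}) := by
    intro x hx
    by_contra hcon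
    simp only [Set.mem_union, Set.mem_iUnion, Set.mem_ofPred_eq, Finset.mem_univ, not_or,
      not_exists, not_and, not_not, exists_prop, true_and] at hcon
    obtain ⟨⟨⟨c1, c2⟩, c3⟩, c4⟩ := hcon
    refine hx ⟨c3, fun j => ⟨c1 j, c2 j⟩, fun j => ?_⟩
    by_cases hj : x.2.2.count j = 0
    · exact Or.inl hj
    · exact Or.inr (c4 j hj)
  have hnn : ∀ i j, 0 ≤ |P i j - Q i j| + (Q i j : ℝ) ^ 2 := fun i j => by positivity
  rw [ENNReal.ofReal_add (by positivity) (by positivity),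
    ENNReal.ofReal_add (by positivity) (by positivity),
    ENNReal.ofReal_add (by positivity) (by positivity),
    ENNReal.ofReal_sum_of_nonneg fun j _ => hnn j s,
    ENNReal.ofReal_sum_of_nonneg fun j _ => hnn s j,
    ENNReal.ofReal_sum_of_nonneg fun j _ => by positivity,
    ENNReal.ofReal_sum_of_nonneg fun j _ => by positivity]
  refine (measure_mono hsub).trans ((measure_union_le _ _).trans (add_le_add
    ((measure_union_le _ _).trans (add_le_add ((measure_union_le _ _).trans (add_le_add
    ?_ ?_)) ?_)) ?_))
  · exact (measure_biUnion_finset_le _ _).trans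
      (Finset.sum_le_sum fun j _ => sampleLaw_count_mismatch_le h0 h1 s j)
  · exact (measure_biUnion_finset_le _ _).trans
      (Finset.sum_le_sum fun j _ => sampleLaw_inactive_mismatch_le h0 h1 hd s j)
  · refine (measure_biUnion_finset_le _ _).trans
      (Finset.sum_le_sum fun j _ => (measure_union_le _ _).trans ?_)
    rw [ENNReal.ofReal_add (by positivity) (by positivity), ENNReal.ofReal_coe_nnreal,
      ENNReal.ofReal_coe_nnreal]
    exact add_le_add (sampleLaw_count_ne_zero_le h0 h1 s j)
      (sampleLaw_inactive_ne_zero_le h0 h1 s j)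
  · refine (measure_biUnion_finset_le _ _).trans
      (Finset.sum_le_sum fun j _ => (sampleLaw_both_ne_zero_le h0 h1 s j).trans ?_)
    rw [← ENNReal.ofReal_coe_nnreal, NNReal.coe_mul]

end

/-! ### Measurability in the types -/

theorem measurable_of_singletons {α β : Type*} [MeasurableSpace α] [MeasurableSpace β]
    [Countable β] [MeasurableSingletonClass β] {μ : α → Measure β}
    (h : ∀ b, Measurable fun a => μ a {b}) : Measurable μ := by
  refine Measure.measurable_of_measurable_coe _ fun s hs => ?_
  simp_rw [← Measure.tsum_indicator_apply_singleton _ s hs]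
  refine Measurable.tsum fun b => ?_
  by_cases hb : b ∈ s
  · simpa [hb] using h b
  · simp [hb]

/-- Cylinders over finitely many coordinates form a generating π-system, and on them the measure is
a finite product. This makes the coupling a kernel in the types. -/
theorem measurable_infinitePi {α ι : Type*} {X : ι → Type*} [MeasurableSpace α]
    [∀ i, MeasurableSpace (X i)] {μ : α → (i : ι) → Measure (X i)}
    [∀ a i, IsProbabilityMeasure (μ a i)] (h : ∀ i, Measurable fun a => μ a i) :
    Measurable fun a => Measure.infinitePi (μ a) := by
  refine Measurable.measure_of_isPiSystem_of_isProbabilityMeasure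
    generateFrom_squareCylinders.symm
    (isPiSystem_squareCylinders (fun _ => MeasurableSpace.isPiSystem_measurableSet)
      (by simp)) ?_
  rintro _ ⟨s, t, ht, rfl⟩
  have ht' : ∀ i, MeasurableSet (t i) := fun i => ht i (Set.mem_univ i)
  simp_rw [Measure.infinitePi_pi _ fun i _ => ht' i]
  exact Finset.measurable_prod _ fun i _ => (Measure.measurable_coe (ht' i)).comp (h i)

theorem measurable_edgeLaw_apply {α : Type*} [MeasurableSpace α] {r : α → ℝ} (hr : Measurable r)
    (b : Bool) : Measurable fun a => edgeLaw (r a) {b} := by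
  cases b
  · simp_rw [edgeLaw_false]; fun_prop
  · simp_rw [edgeLaw_true]; fun_prop

theorem measurable_poissonMeasure_apply {α : Type*} [MeasurableSpace α] {r : α → ℝ≥0}
    (hr : Measurable r) (N : ℕ) : Measurable fun a => poissonMeasure (r a) {N} := by
  simp_rw [poissonMeasure_singleton]
  fun_prop

theorem edgeCoupling_singleton (r : ℝ) (s : ℝ≥0) (b : Bool) (N : ℕ) :
    edgeCoupling r s {(b, N)} = edgeLaw (edgeProb r s N) {b} * poissonMeasure s {N} := by
  rw [edgeCoupling_apply]
  have : ∀ M, edgeLaw (edgeProb r s M) {c | (c, M) ∈ ({(b, N)} : Set (Bool × ℕ))} =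
      Set.indicator {N} (fun _ => edgeLaw (edgeProb r s N) {b}) M := by
    intro M
    by_cases hM : M = N
    · subst hM
      rw [Set.indicator_of_mem (Set.mem_singleton _)]
      congr 1
      ext c
      simp
    · simp [hM]
  simp only [this]
  rw [lintegral_indicator_const (measurableSet_singleton _)]

theorem measurable_edgeProb {α : Type*} [MeasurableSpace α] {r : α → ℝ} {s : α → ℝ≥0}
    (hr : Measurable r) (hs : Measurable s) (N : ℕ) :
    Measurable fun a => edgeProb (r a) (s a) N := by
  unfold edgeProb
  split_ifs <;> fun_prop

theorem measurable_edgeCoupling_apply {α : Type*} [MeasurableSpace α] {r : α → ℝ} {s : α → ℝ≥0}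
    (hr : Measurable r) (hs : Measurable s) (y : Bool × ℕ) :
    Measurable fun a => edgeCoupling (r a) (s a) {y} := by
  obtain ⟨b, N⟩ := y
  simp_rw [edgeCoupling_singleton]
  exact (measurable_edgeLaw_apply (measurable_edgeProb hr hs N) b).mul
    (measurable_poissonMeasure_apply hs N)

section

variable {α : Type*} [MeasurableSpace α] {P : α → Fin n → Fin n → ℝ}
  {Q : α → Fin n → Fin n → ℝ≥0}

theorem measurable_sampleLaw (h0 : ∀ a i j, 0 ≤ P a i j) (h1 : ∀ a i j, P a i j ≤ 1)
    (hP : ∀ i j, Measurable fun a => P a i j) (hQ : ∀ i j, Measurable fun a => Q a i j)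
    (s : Fin n) : Measurable fun a => sampleLaw (P a) (Q a) s := by
  have h : Measurable fun a => edgeNumbersLaw (P a) (Q a) s := by
    refine measurable_of_singletons fun ⟨M, e⟩ => ?_
    have : ∀ a, edgeNumbersLaw (P a) (Q a) s {(M, e)} =
        (∏ i, ∏ j, edgeCoupling (P a i j) (Q a i j) {M i j}) *
          poissonMeasure (Q a s s) {e} := by
      intro a
      have := fun i j => isProbabilityMeasure_edgeCoupling (h0 a i j) (h1 a i j) (Q a i j)
      rw [edgeNumbersLaw, ← Set.singleton_prod_singleton, Measure.prod_prod,
        ← Set.univ_pi_singleton M, Measure.pi_pi]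
      congr 1
      refine Finset.prod_congr rfl fun i _ => ?_
      rw [← Set.univ_pi_singleton (M i), Measure.pi_pi]
    simp_rw [this]
    exact (Finset.measurable_prod _ fun i _ => Finset.measurable_prod _ fun j _ =>
      measurable_edgeCoupling_apply (hP i j) (hQ i j) _).mul
      (measurable_poissonMeasure_apply (hQ s s) e)
  exact (Measure.measurable_bind' Measurable.of_discrete).comp h

theorem measurable_pi_edgeLaw (h0 : ∀ a i j, 0 ≤ P a i j) (h1 : ∀ a i j, P a i j ≤ 1)
    (hP : ∀ i j, Measurable fun a => P a i j) :
    Measurable fun a => (Measure.pi fun i => Measure.pi fun j => edgeLaw (P a i j) :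
      Measure (Adj n)) := by
  refine measurable_of_singletons fun X => ?_
  have : ∀ a, (Measure.pi fun i => Measure.pi fun j => edgeLaw (P a i j)) {X} =
      ∏ i, ∏ j, edgeLaw (P a i j) {X i j} := by
    intro a
    have := fun i j => isProbabilityMeasure_edgeLaw (h0 a i j) (h1 a i j)
    rw [← Set.univ_pi_singleton X, Measure.pi_pi]
    refine Finset.prod_congr rfl fun i _ => ?_
    rw [← Set.univ_pi_singleton (X i), Measure.pi_pi]
  simp_rw [this]
  exact Finset.measurable_prod _ fun i _ => Finset.measurable_prod _ fun j _ =>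
    measurable_edgeLaw_apply (hP i j) _

end

/-! ### The coupling -/

/-- The root, the assembled digraph and the tree. -/
def coupledOutcome (x : Fin n × Adj n × (List ℕ × Fin n → Sample n)) : Outcome n :=
  ((x.1, Exploration.assemble n (Exploration.start x.1) x.2.1 x.2.2),
    grow x.1 fun a => (x.2.2 a).2)

theorem measurable_coupledOutcome : Measurable (coupledOutcome (n := n)) := by
  refine Measurable.prodMk (Measurable.prodMk measurable_fst ?_) ?_
  · refine measurable_from_prod_countable_right fun r => measurable_from_prod_countable_right
      fun X => ?_
    exact (Measurable.of_discrete (f := fun τ : Exploration n => overlay τ.types τ.edges X)).comp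
      (Exploration.measurable_iterate_step n (Exploration.start r))
  · have h : Measurable fun R : List ℕ × Fin n → Sample n => fun a => (R a).2 :=
      measurable_pi_lambda _ fun a => measurable_snd.comp
        (measurable_pi_apply (X := fun _ : List ℕ × Fin n => Sample n) a)
    exact measurable_grow.comp (measurable_fst.prodMk (h.comp (measurable_snd.comp measurable_snd)))

/-- The coupling, for edge probabilities `P` and Poisson means `Q`. -/
def couplingLaw (P : Fin n → Fin n → ℝ) (Q : Fin n → Fin n → ℝ≥0) : Measure (Outcome n) :=
  ((unifVertex n).prod ((Measure.pi fun i => Measure.pi fun j => edgeLaw (P i j)).prod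
    (Measure.infinitePi fun a : List ℕ × Fin n => sampleLaw P Q a.2))).map coupledOutcome

theorem lintegral_unifVertex (f : Fin n → ℝ≥0∞) :
    ∫⁻ r, f r ∂(unifVertex n) = (n : ℝ≥0∞)⁻¹ * ∑ r, f r := by
  rw [lintegral_fintype, Finset.mul_sum]
  refine Finset.sum_congr rfl fun r _ => ?_
  rw [unifVertex, uniformOn_univ, Measure.count_singleton, Fintype.card_fin, mul_comm, one_div]

section

variable {P : Fin n → Fin n → ℝ} {Q : Fin n → Fin n → ℝ≥0}

theorem map_fst_couplingLaw [NeZero n] (h0 : ∀ i j, 0 ≤ P i j) (h1 : ∀ i j, P i j ≤ 1) :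
    (couplingLaw P Q).map Prod.fst =
      (unifVertex n).prod (Measure.pi fun i => Measure.pi fun j => edgeLaw (P i j)) := by
  have := fun s => isProbabilityMeasure_sampleLaw (Q := Q) h0 h1 s
  have := fun i j => isProbabilityMeasure_edgeLaw (h0 i j) (h1 i j)
  set ν : Measure (Adj n) := Measure.pi fun i => Measure.pi fun j => edgeLaw (P i j) with hν
  refine Measure.ext_of_lintegral _ fun f hf => ?_
  have hm : Measurable fun x => f (coupledOutcome (n := n) x).1 :=
    hf.comp (measurable_fst.comp measurable_coupledOutcome)
  rw [lintegral_map hf measurable_fst, couplingLaw,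
    lintegral_map (f := fun ω : Outcome n => f ω.1) (hf.comp measurable_fst)
      measurable_coupledOutcome,
    lintegral_prod _ hm.aemeasurable, lintegral_prod _ hf.aemeasurable]
  refine lintegral_congr fun r => ?_
  have hm' : Measurable fun x => f (coupledOutcome (n := n) (r, x)).1 :=
    hm.comp measurable_prodMk_left
  -- The leftover digraph is integrated before the samples, the order in
  -- `Exploration.lintegral_assemble`; at the start nothing is revealed, so the full law appears.
  rw [lintegral_prod_symm _ hm'.aemeasurable]
  have := Exploration.lintegral_assemble (fun i j => edgeLaw (P i j))
    (fun a : List ℕ × Fin n => sampleLaw P Q a.2) (fun a => map_fst_sampleLaw h0 h1 a.2)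
    (fun X => f (r, X)) n (Exploration.start r)
  refine this.trans (lintegral_congr fun X => ?_)
  have : overlay (Exploration.start r).types (Exploration.start r).edges X = X := by
    funext i j
    simp [overlay, Exploration.start, Exploration.types]
  rw [this]

theorem map_snd_couplingLaw [NeZero n] (h0 : ∀ i j, 0 ≤ P i j) (h1 : ∀ i j, P i j ≤ 1) :
    (couplingLaw P Q).map Prod.snd = ((unifVertex n).prod
      (Measure.infinitePi fun a : List ℕ × Fin n =>
        (sampleLaw P Q a.2).map Prod.snd)).map fun x => grow x.1 x.2 := by
  have := fun s => isProbabilityMeasure_sampleLaw (Q := Q) h0 h1 s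
  have := fun i j => isProbabilityMeasure_edgeLaw (h0 i j) (h1 i j)
  set ν : Measure (Adj n) := Measure.pi fun i => Measure.pi fun j => edgeLaw (P i j) with hν
  have h : Measurable fun R : List ℕ × Fin n → Sample n => fun a => (R a).2 :=
    measurable_pi_lambda _ fun a => measurable_snd.comp
      (measurable_pi_apply (X := fun _ : List ℕ × Fin n => Sample n) a)
  have e1 : Measure.infinitePi (fun a : List ℕ × Fin n => (sampleLaw P Q a.2).map Prod.snd) =
      (ν.prod (Measure.infinitePi fun a : List ℕ × Fin n => sampleLaw P Q a.2)).map
        fun x => fun a => (x.2 a).2 := by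
    rw [← Measure.infinitePi_map_pi (fun a : List ℕ × Fin n => sampleLaw P Q a.2)
      (f := fun _ => Prod.snd) fun _ => measurable_snd]
    have e2 : (fun x : Adj n × (List ℕ × Fin n → Sample n) => fun a => (x.2 a).2) =
        (fun R a => (R a).2) ∘ Prod.snd := rfl
    rw [e2, ← Measure.map_map h measurable_snd, Measure.map_snd_prod, measure_univ, one_smul]
  rw [e1, couplingLaw, Measure.map_map measurable_snd measurable_coupledOutcome]
  conv_rhs => rw [← Measure.map_id (μ := unifVertex n)]
  have hg : Measurable fun x : Adj n × (List ℕ × Fin n → Sample n) => fun a => (x.2 a).2 :=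
    h.comp measurable_snd
  rw [Measure.map_prod_map _ _ measurable_id hg,
    Measure.map_map measurable_grow (measurable_id.prodMap hg)]
  rfl

/-- There are countably many positions, and for a fixed root and digraph each condition concerns at
most two of them. -/
theorem measurable_holdsUpTo (k : ℕ) :
    Measurable fun ω : Outcome n => HoldsUpTo ω.1.2 ω.1.1 ω.2 k := by
  refine measurable_from_prod_countable_right fun ⟨ξ, X⟩ => ?_
  have h1 : ∀ (u : List ℕ) (f : Label n → Prop), Measurable fun t : MarkedTree n => f (t u) :=
    fun u f => Measurable.of_discrete.comp (measurable_pi_apply u)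
  have h2 : ∀ (u v : List ℕ) (f : Label n → Label n → Prop),
      Measurable fun t : MarkedTree n => f (t u) (t v) := fun u v f =>
    (Measurable.of_discrete (f := fun y : Label n × Label n => f y.1 y.2)).comp
      (Measurable.prodMk (f := fun t : MarkedTree n => t u) (g := fun t : MarkedTree n => t v)
        (measurable_pi_apply u) (measurable_pi_apply v))
  have hiff : (fun t : MarkedTree n => HoldsUpTo X ξ t k) = fun t =>
      (∀ l, l ≤ k →
        (∀ u, ((u.length = l ∧ t u ≠ none) →
            ∃ s, s ∈ active X ξ l ∧ some s = (t u).map Prod.fst)) ∧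
        (∀ u v, (u.length = l ∧ t u ≠ none) → (v.length = l ∧ t v ≠ none) →
            (t u).map Prod.fst = (t v).map Prod.fst → u = v) ∧
        (∀ s, s ∈ active X ξ l →
          ∃ u, (u.length = l ∧ t u ≠ none) ∧ (t u).map Prod.fst = some s)) ∧
      (∀ l, l ≤ k →
        (∀ x : List ℕ × Fin n × ℕ,
          (x.1.length ≤ l ∧ ∃ s d, t x.1 = some (s, d) ∧ x.2.2 < d x.2.1) →
            x.2.1 ∈ inactive X ξ l) ∧
        (∀ x y : List ℕ × Fin n × ℕ,
          (x.1.length ≤ l ∧ ∃ s d, t x.1 = some (s, d) ∧ x.2.2 < d x.2.1) →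
          (y.1.length ≤ l ∧ ∃ s d, t y.1 = some (s, d) ∧ y.2.2 < d y.2.1) →
            x.2.1 = y.2.1 → x = y) ∧
        (∀ s, s ∈ inactive X ξ l → ∃ x : List ℕ × Fin n × ℕ,
          (x.1.length ≤ l ∧ ∃ s d, t x.1 = some (s, d) ∧ x.2.2 < d x.2.1) ∧ x.2.1 = s)) ∧
      (∀ u j s d s' d', u.length < k → t u = some (s, d) → t (j :: u) = some (s', d') →
        X s' s = true) ∧
      (∀ s d, t [] = some (s, d) → ∀ r, d r = if X s r = true then 1 else 0) ∧
      (∀ u j s d s' d', u.length < k → t u = some (s, d) →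
        t (j :: u) = some (s', d') → ∀ r, d' r = if X s' r = true ∧ r ≠ s then 1 else 0) := by
    funext t
    refine propext ⟨fun h => ⟨fun l hl => ?_, fun l hl => ?_, h.parent_edge, h.root_inactive,
      h.node_inactive⟩, fun h => ⟨fun l hl => ?_, fun l hl => ?_, h.2.2.1, h.2.2.2.1, h.2.2.2.2⟩⟩
    · obtain ⟨a, b, c⟩ := h.active_eq l hl
      exact ⟨fun u hu => a hu, fun u v hu hv huv => b hu hv huv, fun s hs => c ⟨s, hs, rfl⟩⟩
    · obtain ⟨a, b, c⟩ := h.inactive_eq l hl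
      exact ⟨fun u hu => a hu, fun u v hu hv huv => b hu hv huv, fun s hs => c hs⟩
    · obtain ⟨a, b, c⟩ := h.1 l hl
      exact ⟨fun u hu => a u hu, fun u hu v hv huv => b u v hu hv huv,
        by rintro _ ⟨s, hs, rfl⟩; exact c s hs⟩
    · obtain ⟨a, b, c⟩ := h.2.1 l hl
      exact ⟨fun u hu => a u hu, fun u hu v hv huv => b u v hu hv huv, fun s hs => c s hs⟩
  rw [show (fun y : MarkedTree n => HoldsUpTo (((ξ, X), y) : Outcome n).1.2
    (((ξ, X), y) : Outcome n).1.1 (((ξ, X), y) : Outcome n).2 k) =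
    fun t : MarkedTree n => HoldsUpTo X ξ t k from rfl, hiff]
  refine Measurable.and (Measurable.forall fun l => Measurable.imp measurable_const
    (Measurable.and (Measurable.forall fun u => ?_) (Measurable.and
      (Measurable.forall fun u => Measurable.forall fun v => ?_)
      (Measurable.forall fun s => Measurable.imp measurable_const
        (Measurable.exists fun u => ?_))))) (Measurable.and
    (Measurable.forall fun l => Measurable.imp measurable_const
      (Measurable.and (Measurable.forall fun u => ?_) (Measurable.and
      (Measurable.forall fun u => Measurable.forall fun v => ?_)
      (Measurable.forall fun s => Measurable.imp measurable_const
        (Measurable.exists fun u => ?_))))) (Measurable.and ?_ (Measurable.and ?_ ?_)))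
  · exact h1 u fun y => (u.length = l ∧ y ≠ none) →
      ∃ s, s ∈ active X ξ l ∧ some s = y.map Prod.fst
  · exact h2 u v fun y z => (u.length = l ∧ y ≠ none) → (v.length = l ∧ z ≠ none) →
      y.map Prod.fst = z.map Prod.fst → u = v
  · exact h1 u fun y => (u.length = l ∧ y ≠ none) ∧ y.map Prod.fst = some s
  · exact h1 u.1 fun y => (u.1.length ≤ l ∧ ∃ s d, y = some (s, d) ∧ u.2.2 < d u.2.1) →
      u.2.1 ∈ inactive X ξ l
  · exact h2 u.1 v.1 fun y z => (u.1.length ≤ l ∧ ∃ s d, y = some (s, d) ∧ u.2.2 < d u.2.1) →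
      (v.1.length ≤ l ∧ ∃ s d, z = some (s, d) ∧ v.2.2 < d v.2.1) → u.2.1 = v.2.1 → u = v
  · exact h1 u.1 fun y => (u.1.length ≤ l ∧ ∃ s d, y = some (s, d) ∧ u.2.2 < d u.2.1) ∧
      u.2.1 = s
  · refine Measurable.forall fun u => Measurable.forall fun j => ?_
    exact h2 u (j :: u) fun y z => ∀ s d s' d', u.length < k → y = some (s, d) →
      z = some (s', d') → X s' s = true
  · exact h1 [] fun y => ∀ s d, y = some (s, d) → ∀ r, d r = if X s r = true then 1 else 0
  · refine Measurable.forall fun u => Measurable.forall fun j => ?_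
    exact h2 u (j :: u) fun y z => ∀ s d s' d', u.length < k → y = some (s, d) →
      z = some (s', d') → ∀ r, d' r = if X s' r = true ∧ r ≠ s then 1 else 0

/-- Agreement is forced by the samples alone, uniformly in the leftover digraph, so the latter
integrates out. -/
theorem couplingLaw_breakStep_le [NeZero n] (h0 : ∀ i j, 0 ≤ P i j) (h1 : ∀ i j, P i j ≤ 1)
    (k : ℕ) (E : Fin n → Set (List ℕ × Fin n → Sample n))
    (hE : ∀ r X R, R ∉ E r → HoldsUpTo (Exploration.assemble n (Exploration.start r) X R) r
      (grow r fun a => (R a).2) k) :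
    couplingLaw P Q {ω | breakStep ω ≤ (k : ℕ∞)} ≤ (n : ℝ≥0∞)⁻¹ * ∑ r,
      Measure.infinitePi (fun a : List ℕ × Fin n => sampleLaw P Q a.2) (E r) := by
  have := fun s => isProbabilityMeasure_sampleLaw (Q := Q) h0 h1 s
  have := fun i j => isProbabilityMeasure_edgeLaw (h0 i j) (h1 i j)
  set ν : Measure (Adj n) := Measure.pi fun i => Measure.pi fun j => edgeLaw (P i j) with hν
  have hm : MeasurableSet {ω : Outcome n | breakStep ω ≤ (k : ℕ∞)} := by
    have : {ω : Outcome n | breakStep ω ≤ (k : ℕ∞)} =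
        {ω | ¬ HoldsUpTo ω.1.2 ω.1.1 ω.2 k} := by
      ext ω; exact breakStep_le_iff
    rw [this]
    exact measurableSet_setOfPred.2 (measurable_holdsUpTo k).not
  rw [couplingLaw, Measure.map_apply measurable_coupledOutcome hm,
    Measure.prod_apply (measurable_coupledOutcome hm), lintegral_unifVertex]
  gcongr with r
  have hsub : Prod.mk r ⁻¹' (coupledOutcome (n := n) ⁻¹' {ω | breakStep ω ≤ (k : ℕ∞)}) ⊆
      Set.univ ×ˢ E r := by
    rintro ⟨X, R⟩ hx
    refine ⟨trivial, ?_⟩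
    by_contra hR
    exact breakStep_le_iff.1 hx (hE r X R hR)
  refine (measure_mono hsub).trans ?_
  rw [Measure.prod_prod, measure_univ, one_mul]

theorem couplingLaw_breakStep_le_breaks [NeZero n] (h0 : ∀ i j, 0 ≤ P i j)
    (h1 : ∀ i j, P i j ≤ 1) (k : ℕ) :
    couplingLaw P Q {ω | breakStep ω ≤ (k : ℕ∞)} ≤ (n : ℝ≥0∞)⁻¹ * ∑ r,
      Measure.infinitePi (fun a : List ℕ × Fin n => sampleLaw P Q a.2)
        {R | Exploration.Breaks k R n (Exploration.start r)} :=
  couplingLaw_breakStep_le h0 h1 k _ fun _ X _ hR => Exploration.holdsUpTo_assemble X hR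

/-- Step `0` only compares the outbound edges of the root with its inactive nodes; a good sample
would also involve inbound edges. The minimum with one is kept so that irregular roots can be paid
for by an indicator. -/
theorem couplingLaw_breakStep_zero_le [NeZero n] (h0 : ∀ i j, 0 ≤ P i j)
    (h1 : ∀ i j, P i j ≤ 1) (hd : ∀ i, P i i = 0) :
    couplingLaw P Q {ω | breakStep ω ≤ ((0 : ℕ) : ℕ∞)} ≤ (n : ℝ≥0∞)⁻¹ * ∑ r,
      ENNReal.ofReal (min 1 (∑ t, (|P r t - Q r t| + Q r t ^ 2) + Q r r)) := by
  have := fun s => isProbabilityMeasure_sampleLaw (Q := Q) h0 h1 s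
  refine (couplingLaw_breakStep_le h0 h1 0 (fun r => Function.eval (([] : List ℕ), r) ⁻¹'
    {x : Sample n | ¬ ((∀ t, x.2.1 t = if x.1 r t = true then 1 else 0) ∧ x.2.1 r = 0)})
    ?_).trans ?_
  · intro r X R hR
    simp only [Set.mem_preimage, Function.eval, Set.mem_ofPred_eq, not_not] at hR
    have hA : ∀ t, Exploration.assemble n (Exploration.start r) X R r t = (R ([], r)).1 r t := by
      intro t
      -- The first step explores the root and reveals every edge at it.
      have hs : (Exploration.step R)^[1] (Exploration.start r) =
          Exploration.advance (Exploration.start r) ([], r) [] (R ([], r)) := by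
        simp [Exploration.step, Exploration.start, Exploration.types]
      rw [Exploration.assemble_eq_edges R X (i := 1) NeZero.one_le, hs]
      · simp [Exploration.advance, overlay, Exploration.start, Exploration.types]
      · rw [hs, Exploration.types_advance]
        simp
    exact holdsUpTo_zero (fun t => by rw [hA]; exact hR.1 t) hR.2
  · gcongr with r
    rw [(measurePreserving_eval_infinitePi (fun a : List ℕ × Fin n => sampleLaw P Q a.2)
      (([] : List ℕ), r)).measure_preimage MeasurableSet.of_discrete.nullMeasurableSet]
    have hsub : {x : Sample n | ¬ ((∀ t, x.2.1 t = if x.1 r t = true then 1 else 0) ∧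
        x.2.1 r = 0)} ⊆ (⋃ t ∈ Finset.univ,
          {x : Sample n | x.2.1 t ≠ if x.1 r t = true then 1 else 0}) ∪ {x | x.2.1 r ≠ 0} := by
      intro x hx
      by_contra hcon
      simp only [Set.mem_union, Set.mem_iUnion, Set.mem_ofPred_eq, Finset.mem_univ, not_or,
        not_exists, not_not, exists_prop, true_and] at hcon
      exact hx hcon
    rw [ENNReal.ofReal_min, ENNReal.ofReal_one]
    refine le_min prob_le_one ((measure_mono hsub).trans ((measure_union_le _ _).trans ?_))
    rw [ENNReal.ofReal_add (by positivity) (by positivity), ENNReal.ofReal_coe_nnreal,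
      ENNReal.ofReal_sum_of_nonneg fun j _ => by positivity]
    exact add_le_add ((measure_biUnion_finset_le _ _).trans
      (Finset.sum_le_sum fun j _ => sampleLaw_inactive_mismatch_le h0 h1 hd r j))
      (sampleLaw_inactive_ne_zero_le h0 h1 r r)

end

theorem p_nonneg {θ : ℝ} (hθ : 0 ≤ θ) (w : Types n) {φ : Fin n → Fin n → ℝ}
    (hφ : ∀ i j, i ≠ j → -1 < φ i j) (i j : Fin n) : 0 ≤ p θ w φ i j := by
  unfold p
  split_ifs with h
  · exact le_rfl
  · refine le_min zero_le_one (mul_nonneg ?_ (by linarith [hφ i j h]))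
    unfold q VType.wOut VType.wIn
    positivity

theorem p_le_one (θ : ℝ) (w : Types n) (φ : Fin n → Fin n → ℝ) (i j : Fin n) :
    p θ w φ i j ≤ 1 := by
  unfold p
  split_ifs
  · exact zero_le_one
  · exact min_le_left _ _

theorem measurable_wIn (i : Fin n) : Measurable fun w : Types n => (w i).wIn := by
  unfold VType.wIn
  fun_prop

theorem measurable_wOut (i : Fin n) : Measurable fun w : Types n => (w i).wOut := by
  unfold VType.wOut
  fun_prop

theorem measurable_q (θ : ℝ) (i j : Fin n) : Measurable fun w : Types n => q θ w i j :=
  ((measurable_wOut i).mul (measurable_wIn j)).div_const _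

theorem measurable_p (θ : ℝ) {φ : Types n → Fin n → Fin n → ℝ}
    (hφ : ∀ i j, Measurable fun w => φ w i j) (i j : Fin n) :
    Measurable fun w : Types n => p θ w (φ w) i j := by
  unfold p
  split_ifs
  · exact measurable_const
  · exact measurable_const.min ((measurable_q θ i j).mul (measurable_const.add (hφ i j)))

/-- The coupling of the digraph and the tree, given the types. -/
theorem exists_coupling [NeZero n] {θ : ℝ} (hθ : 0 ≤ θ) {φ : Types n → Fin n → Fin n → ℝ}
    (hφ : ∀ i j, Measurable fun w => φ w i j) (hφ' : ∀ w i j, i ≠ j → -1 < φ w i j) :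
    ∃ κ : Kernel (Types n) (Outcome n), IsCoupling θ φ κ ∧
      ∀ w, κ w = couplingLaw (p θ w (φ w)) fun i j => (q θ w i j).toNNReal := by
  have h0 : ∀ w i j, 0 ≤ p θ w (φ w) i j := fun w => p_nonneg hθ w (hφ' w)
  have h1 : ∀ w i j, p θ w (φ w) i j ≤ 1 := fun w => p_le_one θ w (φ w)
  have hq : ∀ i j, Measurable fun w : Types n => (q θ w i j).toNNReal :=
    fun i j => (measurable_q θ i j).real_toNNReal
  have := fun w s => isProbabilityMeasure_sampleLaw (Q := fun i j => (q θ w i j).toNNReal)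
    (h0 w) (h1 w) s
  have := fun w i j => isProbabilityMeasure_edgeLaw (h0 w i j) (h1 w i j)
  let G : Kernel (Types n) (Adj n) :=
    ⟨fun w => Measure.pi fun i => Measure.pi fun j => edgeLaw (p θ w (φ w) i j),
      measurable_pi_edgeLaw h0 h1 fun i j => measurable_p θ hφ i j⟩
  let R : Kernel (Types n) (List ℕ × Fin n → Sample n) :=
    ⟨fun w => Measure.infinitePi fun a : List ℕ × Fin n =>
      sampleLaw (p θ w (φ w)) (fun i j => (q θ w i j).toNNReal) a.2,
      measurable_infinitePi fun a => measurable_sampleLaw h0 h1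
        (fun i j => measurable_p θ hφ i j) hq a.2⟩
  have : IsMarkovKernel G := ⟨fun w => by
    change IsProbabilityMeasure (Measure.pi fun i => Measure.pi fun j => edgeLaw _)
    infer_instance⟩
  have : IsMarkovKernel R := ⟨fun w => by
    change IsProbabilityMeasure (Measure.infinitePi _)
    infer_instance⟩
  let κ : Kernel (Types n) (Outcome n) :=
    ((Kernel.const (Types n) (unifVertex n)) ×ₖ (G ×ₖ R)).map coupledOutcome
  have hκ : ∀ w, κ w = couplingLaw (p θ w (φ w)) fun i j => (q θ w i j).toNNReal := by
    intro w
    rw [Kernel.map_apply _ measurable_coupledOutcome, Kernel.prod_apply, Kernel.prod_apply,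
      Kernel.const_apply]
    rfl
  refine ⟨κ, fun w => ?_, hκ⟩
  rw [hκ]
  refine ⟨map_fst_couplingLaw (h0 w) (h1 w), ?_⟩
  rw [map_snd_couplingLaw (h0 w) (h1 w)]
  simp_rw [map_snd_sampleLaw (h0 w) (h1 w)]
  rfl

/-! ### Bounds on the edge probabilities -/

/-- The weight `1 + W⁺ + W⁻` of a type. -/
def VType.weight (v : VType) : ℝ := 1 + v.wIn + v.wOut

theorem wIn_nonneg (v : VType) : 0 ≤ v.wIn := v.1.2

theorem wOut_nonneg (v : VType) : 0 ≤ v.wOut := v.2.1.2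

theorem one_le_weight (v : VType) : 1 ≤ v.weight := by
  have := wIn_nonneg v
  have := wOut_nonneg v
  unfold VType.weight
  linarith

theorem weight_pos (v : VType) : 0 < v.weight := one_pos.trans_le (one_le_weight v)

theorem wIn_le_weight (v : VType) : v.wIn ≤ v.weight := by
  have := wOut_nonneg v
  unfold VType.weight
  linarith

theorem wOut_le_weight (v : VType) : v.wOut ≤ v.weight := by
  have := wIn_nonneg v
  unfold VType.weight
  linarith

/-- The empirical mean of the weights to the power `1 + δ`. -/
def meanPow (δ : ℝ) (w : Types n) : ℝ := (n : ℝ)⁻¹ * ∑ i, (w i).weight ^ (1 + δ)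

/-- The empirical mean of `W⁻` times the weight. -/
def meanOut (w : Types n) : ℝ := (n : ℝ)⁻¹ * ∑ i, (w i).wOut * (w i).weight

theorem meanPow_nonneg (δ : ℝ) (w : Types n) : 0 ≤ meanPow δ w :=
  mul_nonneg (by positivity) (Finset.sum_nonneg fun i _ => Real.rpow_nonneg (weight_pos _).le _)

theorem meanOut_nonneg (w : Types n) : 0 ≤ meanOut w :=
  mul_nonneg (by positivity)
    (Finset.sum_nonneg fun i _ => mul_nonneg (wOut_nonneg _) (weight_pos _).le)

theorem mu_nonneg {θ : ℝ} (hθ : 0 ≤ θ) (w : Types n) : 0 ≤ mu θ w :=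
  mul_nonneg (by positivity)
    (Finset.sum_nonneg fun i _ => mul_nonneg (wIn_nonneg _) (wOut_nonneg _))

theorem q_nonneg {θ : ℝ} (hθ : 0 ≤ θ) (w : Types n) (i j : Fin n) : 0 ≤ q θ w i j :=
  div_nonneg (mul_nonneg (wOut_nonneg _) (wIn_nonneg _)) (by positivity)

theorem q_le_weight {θ : ℝ} (hθ : 0 ≤ θ) (w : Types n) (i j : Fin n) :
    q θ w i j ≤ (w i).weight * (w j).weight / (θ * n) := by
  unfold q
  have := wOut_le_weight (w i)
  have := wIn_le_weight (w j)
  have := wIn_nonneg (w j)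
  have := weight_pos (w i)
  gcongr

theorem q_le_weight' {θ : ℝ} (hθ : 0 ≤ θ) (w : Types n) (i j : Fin n) :
    q θ w i j ≤ (w j).weight * (w i).weight / (θ * n) := by
  rw [mul_comm (w j).weight]
  exact q_le_weight hθ w i j

theorem weight_le_rpow {δ : ℝ} (hδ : 0 ≤ δ) (v : VType) : v.weight ≤ v.weight ^ (1 + δ) := by
  conv_lhs => rw [← Real.rpow_one v.weight]
  exact Real.rpow_le_rpow_of_exponent_le (one_le_weight v) (by linarith)

theorem rpow_le_weight {δ : ℝ} (hδ : δ ≤ 1) (v : VType) : v.weight ^ δ ≤ v.weight := by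
  conv_rhs => rw [← Real.rpow_one v.weight]
  exact Real.rpow_le_rpow_of_exponent_le (one_le_weight v) hδ

theorem mean_weight_le {δ : ℝ} (hδ : 0 ≤ δ) (w : Types n) :
    (n : ℝ)⁻¹ * ∑ i, (w i).weight ≤ meanPow δ w := by
  unfold meanPow
  gcongr with i
  exact weight_le_rpow hδ _

section

variable {θ δ : ℝ} {w : Types n} {s : Fin n} {f : Fin n → ℝ}

/-- The bound on `f` is a product of weights, so the sum separates and leaves the empirical moment
of order `1 + δ`. Rows and columns of `q` both satisfy it. -/
theorem sum_mul_weight_le [NeZero n] (hθ : 0 < θ) (f : Fin n → ℝ)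
    (hf : ∀ j, f j ≤ (w j).weight * (w s).weight / (θ * n)) :
    ∑ j, f j * (w j).weight ^ δ ≤ (w s).weight * meanPow δ w / θ := by
  have hn : (0 : ℝ) < n := Nat.cast_pos.2 (NeZero.pos n)
  calc ∑ j, f j * (w j).weight ^ δ
      ≤ ∑ j, (w j).weight * (w s).weight / (θ * n) * (w j).weight ^ δ :=
        Finset.sum_le_sum fun j _ =>
          mul_le_mul_of_nonneg_right (hf j) (Real.rpow_nonneg (weight_pos _).le _)
    _ = (w s).weight * meanPow δ w / θ := by
        unfold meanPow
        rw [Finset.mul_sum, Finset.mul_sum, Finset.sum_div]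
        refine Finset.sum_congr rfl fun j _ => ?_
        rw [Real.rpow_add (weight_pos _), Real.rpow_one]
        field_simp

theorem sum_le_weight [NeZero n] (hθ : 0 < θ) (hδ : 0 ≤ δ) (f : Fin n → ℝ)
    (hf : ∀ j, f j ≤ (w j).weight * (w s).weight / (θ * n)) (hf0 : ∀ j, 0 ≤ f j) :
    ∑ j, f j ≤ (w s).weight * meanPow δ w / θ :=
  le_trans (Finset.sum_le_sum fun j _ => le_mul_of_one_le_right (hf0 j)
    (Real.one_le_rpow (one_le_weight _) hδ)) (sum_mul_weight_le hθ f hf)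

/-- Only moments of order `1 + δ` are available; as `f ≤ 1`, the square is at most the power `1 +
δ`. -/
theorem sum_sq_le_weight [NeZero n] (hθ : 0 < θ) (hδ : 0 < δ) (hδ1 : δ ≤ 1) (f : Fin n → ℝ)
    (hf : ∀ j, f j ≤ (w j).weight * (w s).weight / (θ * n)) (hf0 : ∀ j, 0 ≤ f j)
    (hf1 : ∀ j, f j ≤ 1 / 4) :
    ∑ j, f j ^ 2 ≤
      meanPow δ w * θ ^ (-(1 + δ)) * (w s).weight ^ (1 + δ) * (n : ℝ) ^ (-δ) := by
  have hn : (0 : ℝ) < n := Nat.cast_pos.2 (NeZero.pos n)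
  calc ∑ j, f j ^ 2 ≤ ∑ j, ((w j).weight * (w s).weight / (θ * n)) ^ (1 + δ) := by
        refine Finset.sum_le_sum fun j _ => ?_
        calc f j ^ 2 = f j ^ (2 : ℝ) := (Real.rpow_two _).symm
          _ ≤ f j ^ (1 + δ) := by
              refine Real.rpow_le_rpow_of_exponent_ge' (hf0 j) (by linarith [hf1 j])
                (by linarith) (by linarith)
          _ ≤ _ := Real.rpow_le_rpow (hf0 j) (hf j) (by linarith)
    _ = _ := by
        unfold meanPow
        rw [Finset.mul_sum, Finset.sum_mul, Finset.sum_mul, Finset.sum_mul]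
        refine Finset.sum_congr rfl fun j _ => ?_
        have h1 := weight_pos (w j)
        have h2 := weight_pos (w s)
        rw [Real.div_rpow (by positivity) (by positivity), Real.mul_rpow h1.le h2.le,
          Real.mul_rpow hθ.le hn.le, Real.rpow_neg hθ.le, Real.rpow_neg hn.le,
          Real.rpow_add hn, Real.rpow_one]
        field_simp

/-- Here `f ≤ f ^ δ` because `f ≤ 1`. This produces the powers `δ` of the weights by which the known
types are measured. -/
theorem sum_finset_le_weight [NeZero n] (hθ : 0 < θ) (hδ : 0 < δ) (hδ1 : δ ≤ 1)
    (K : Finset (Fin n)) (f : Fin n → ℝ)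
    (hf : ∀ j, f j ≤ (w j).weight * (w s).weight / (θ * n)) (hf0 : ∀ j, 0 ≤ f j)
    (hf1 : ∀ j, f j ≤ 1 / 4) :
    ∑ j ∈ K, f j ≤
      θ ^ (-δ) * (w s).weight ^ δ * (n : ℝ) ^ (-δ) * ∑ j ∈ K, (w j).weight ^ δ := by
  have hn : (0 : ℝ) < n := Nat.cast_pos.2 (NeZero.pos n)
  rw [Finset.mul_sum]
  refine Finset.sum_le_sum fun j _ => ?_
  have h1 := weight_pos (w j)
  have h2 := weight_pos (w s)
  calc f j = f j ^ (1 : ℝ) := (Real.rpow_one _).symm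
    _ ≤ f j ^ δ := Real.rpow_le_rpow_of_exponent_ge' (hf0 j) (by linarith [hf1 j]) hδ.le hδ1
    _ ≤ ((w j).weight * (w s).weight / (θ * n)) ^ δ := Real.rpow_le_rpow (hf0 j) (hf j) hδ.le
    _ = _ := by
        rw [Real.div_rpow (by positivity) (by positivity), Real.mul_rpow h1.le h2.le,
          Real.mul_rpow hθ.le hn.le, Real.rpow_neg hθ.le, Real.rpow_neg hn.le]
        field_simp

end

section

variable {θ δ η : ℝ} {w : Types n} {φ : Fin n → Fin n → ℝ}

/-- Since `1 + φ ≤ 2` and `q ≤ 1 / 4`, the truncation at one is inactive and the difference is `φ *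
q`; a loop contributes all of `q`. -/
theorem abs_p_sub_q_le [NeZero n] (hθ : 0 ≤ θ) (hη : 0 < η) (i j : Fin n)
    (hφ : i ≠ j → |φ i j| ≤ (n : ℝ) ^ (-η)) (hq : q θ w i j ≤ 1 / 4) :
    |p θ w φ i j - q θ w i j| ≤
      (n : ℝ) ^ (-η) * q θ w i j + if i = j then q θ w i j else 0 := by
  have hq0 := q_nonneg hθ w i j
  have hn : (1 : ℝ) ≤ n := Nat.one_le_cast.2 NeZero.one_le
  unfold p
  split_ifs with h
  · rw [zero_sub, abs_neg, abs_of_nonneg hq0]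
    have : 0 ≤ (n : ℝ) ^ (-η) * q θ w i j := by positivity
    linarith
  · have h1 := hφ h
    have h2 : (n : ℝ) ^ (-η) ≤ 1 := Real.rpow_le_one_of_one_le_of_nonpos hn (by linarith)
    have h3 := abs_le.1 h1
    have h4 : q θ w i j * (1 + φ i j) ≤ 1 := by nlinarith
    rw [min_eq_right h4, add_zero, show q θ w i j * (1 + φ i j) - q θ w i j =
      φ i j * q θ w i j by ring, abs_mul, abs_of_nonneg hq0]
    gcongr

/-- The probability of a bad sample at `s` in terms of the edge means. -/
def badBound (θ : ℝ) (w : Types n) (φ : Fin n → Fin n → ℝ) (K : Finset (Fin n)) (s : Fin n) : ℝ :=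
  ∑ j, (|p θ w φ j s - q θ w j s| + q θ w j s ^ 2) +
    ∑ j, (|p θ w φ s j - q θ w s j| + q θ w s j ^ 2) +
    ∑ j ∈ K, (q θ w j s + q θ w s j) + ∑ j, q θ w j s * q θ w s j

/-- The constant in the bound on the probability of a bad sample. -/
def errConst (δ θ : ℝ) (w : Types n) : ℝ :=
  4 * meanPow δ w / θ + 4 * meanPow δ w * θ ^ (-(1 + δ)) + 4 * θ ^ (-δ)

theorem errConst_nonneg (hθ : 0 ≤ θ) (w : Types n) : 0 ≤ errConst δ θ w := by
  have := meanPow_nonneg δ w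
  unfold errConst
  positivity

/-- At a vertex where the edge probabilities are regular, a sample is bad with small
probability, unless the weight of the known types is large. -/
theorem badBound_add_le [NeZero n] (hθ : 0 < θ) (hδ : 0 < δ) (hδ1 : δ ≤ 1) (hη : 0 < η)
    {K : Finset (Fin n)} {s : Fin n} (hs : s ∈ K)
    (hK : ∑ j ∈ K, (n : ℝ) ^ (-(δ / 2)) * (w j).weight ^ δ ≤ 1)
    (hB : B θ η w φ s) (hB' : B' θ η w φ s) :
    badBound θ w φ K s +
      ∑ j, (q θ w j s + q θ w s j) * ((n : ℝ) ^ (-(δ / 2)) * (w j).weight ^ δ) ≤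
      (n : ℝ) ^ (-(min (δ / 2) η)) * errConst δ θ w * (w s).weight := by
  have hn1 : (1 : ℝ) ≤ n := Nat.one_le_cast.2 NeZero.one_le
  have hn : (0 : ℝ) < n := by linarith
  have hg := weight_pos (w s)
  have hM := meanPow_nonneg δ w
  set M := meanPow δ w with hMdef
  set g := (w s).weight with hgdef
  set e := (n : ℝ) ^ (-(δ / 2)) with he
  set N := (n : ℝ) ^ (-(min (δ / 2) η)) with hN
  have heN : e ≤ N := Real.rpow_le_rpow_of_exponent_le hn1 (by linarith [min_le_left (δ / 2) η])
  have hηN : (n : ℝ) ^ (-η) ≤ N :=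
    Real.rpow_le_rpow_of_exponent_le hn1 (by linarith [min_le_right (δ / 2) η])
  have he0 : 0 ≤ e := by positivity
  have hee : (n : ℝ) ^ (-δ) = e * e := by
    rw [he, ← Real.rpow_add hn]; congr 1; ring
  have hq0 := q_nonneg (n := n) hθ.le w
  have hqs : ∀ j, q θ w j s ≤ (w j).weight * (w s).weight / (θ * n) :=
    fun j => q_le_weight hθ.le w j s
  have hqs' : ∀ j, q θ w s j ≤ (w j).weight * (w s).weight / (θ * n) :=
    fun j => q_le_weight' hθ.le w s j
  have l1 := sum_le_weight hθ hδ.le _ hqs fun j => hq0 j s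
  have l2 := sum_le_weight hθ hδ.le _ hqs' fun j => hq0 s j
  -- The type `s` is itself known, so its own weight is at most one; this lowers `g ^ (1 + δ) * n ^
  -- (-δ)` to `g * n ^ (-δ / 2)`.
  have hgd : e * g ^ δ ≤ 1 := le_trans (Finset.single_le_sum (f := fun j => e * (w j).weight ^ δ)
    (fun j _ => mul_nonneg he0 (Real.rpow_nonneg (weight_pos _).le _)) hs) hK
  have hsq : M * θ ^ (-(1 + δ)) * g ^ (1 + δ) * (n : ℝ) ^ (-δ) ≤ M * θ ^ (-(1 + δ)) * g * e := by
    rw [hee, Real.rpow_add hg, Real.rpow_one]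
    have : 0 ≤ M * θ ^ (-(1 + δ)) * g * e := by positivity
    calc _ = M * θ ^ (-(1 + δ)) * g * e * (e * g ^ δ) := by ring
      _ ≤ _ := mul_le_of_le_one_right this hgd
  have s1 := (sum_sq_le_weight hθ hδ hδ1 _ hqs (fun j => hq0 j s) fun j => hB.2 j).trans hsq
  have s2 := (sum_sq_le_weight hθ hδ hδ1 _ hqs' (fun j => hq0 s j) fun j => hB'.2 j).trans hsq
  -- One factor `n ^ (-δ / 2)` is absorbed by the weight of the known types, the other remains.
  have hcol : θ ^ (-δ) * g ^ δ * (n : ℝ) ^ (-δ) * ∑ j ∈ K, (w j).weight ^ δ ≤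
      θ ^ (-δ) * g * e := by
    rw [← Finset.mul_sum] at hK
    have h1 : 0 ≤ θ ^ (-δ) * g ^ δ * e := by positivity
    calc _ = θ ^ (-δ) * g ^ δ * e * (e * ∑ j ∈ K, (w j).weight ^ δ) := by rw [hee]; ring
      _ ≤ θ ^ (-δ) * g ^ δ * e := mul_le_of_le_one_right h1 hK
      _ ≤ _ := by
          have := rpow_le_weight hδ1 (w s)
          gcongr
  have c1 := (sum_finset_le_weight hθ hδ hδ1 K _ hqs (fun j => hq0 j s) fun j => hB.2 j).trans hcol
  have c2 := (sum_finset_le_weight hθ hδ hδ1 K _ hqs' (fun j => hq0 s j)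
    fun j => hB'.2 j).trans hcol
  -- The loop terms are charged to the collisions with known types, as `s ∈ K`.
  have cs1 : q θ w s s ≤ ∑ j ∈ K, q θ w j s :=
    Finset.single_le_sum (f := fun j => q θ w j s) (fun j _ => hq0 j s) hs
  have cs2 : q θ w s s ≤ ∑ j ∈ K, q θ w s j :=
    Finset.single_le_sum (f := fun j => q θ w s j) (fun j _ => hq0 s j) hs
  have m1 : ∑ j, |p θ w φ j s - q θ w j s| ≤
      (n : ℝ) ^ (-η) * ∑ j, q θ w j s + q θ w s s := by
    calc _ ≤ ∑ j, ((n : ℝ) ^ (-η) * q θ w j s + if j = s then q θ w j s else 0) :=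
          Finset.sum_le_sum fun j _ => abs_p_sub_q_le hθ.le hη j s (hB.1 j) (hB.2 j)
      _ = _ := by
          rw [Finset.sum_add_distrib, ← Finset.mul_sum, Finset.sum_ite_eq' Finset.univ s]
          simp
  have m2 : ∑ j, |p θ w φ s j - q θ w s j| ≤
      (n : ℝ) ^ (-η) * ∑ j, q θ w s j + q θ w s s := by
    calc _ ≤ ∑ j, ((n : ℝ) ^ (-η) * q θ w s j + if s = j then q θ w s j else 0) :=
          Finset.sum_le_sum fun j _ => abs_p_sub_q_le hθ.le hη s j
            (fun h => hB'.1 j h.symm) (hB'.2 j)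
      _ = _ := by
          rw [Finset.sum_add_distrib, ← Finset.mul_sum, Finset.sum_ite_eq Finset.univ s]
          simp
  have m3 : ∑ j, q θ w j s * q θ w s j ≤ ∑ j, q θ w j s ^ 2 + ∑ j, q θ w s j ^ 2 := by
    rw [← Finset.sum_add_distrib]
    refine Finset.sum_le_sum fun j _ => ?_
    nlinarith [sq_nonneg (q θ w j s - q θ w s j), sq_nonneg (q θ w j s),
      sq_nonneg (q θ w s j)]
  have d1 : ∑ j, (q θ w j s + q θ w s j) * (e * (w j).weight ^ δ) ≤ e * (2 * (g * M / θ)) := by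
    have t1 := sum_mul_weight_le (δ := δ) hθ _ hqs
    have t2 := sum_mul_weight_le (δ := δ) hθ _ hqs'
    calc _ = e * (∑ j, q θ w j s * (w j).weight ^ δ + ∑ j, q θ w s j * (w j).weight ^ δ) := by
          rw [← Finset.sum_add_distrib, Finset.mul_sum]
          exact Finset.sum_congr rfl fun j _ => by ring
      _ ≤ _ := by gcongr; linarith
  have hη0 : 0 ≤ (n : ℝ) ^ (-η) := by positivity
  have x1 : (n : ℝ) ^ (-η) * ∑ j, q θ w j s ≤ N * (g * M / θ) := by
    have : 0 ≤ ∑ j, q θ w j s := Finset.sum_nonneg fun j _ => hq0 j s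
    gcongr
  have x2 : (n : ℝ) ^ (-η) * ∑ j, q θ w s j ≤ N * (g * M / θ) := by
    have : 0 ≤ ∑ j, q θ w s j := Finset.sum_nonneg fun j _ => hq0 s j
    gcongr
  have x3 : e * (2 * (g * M / θ)) ≤ N * (2 * (g * M / θ)) := by gcongr
  have x4 : M * θ ^ (-(1 + δ)) * g * e ≤ M * θ ^ (-(1 + δ)) * g * N := by gcongr
  have x5 : θ ^ (-δ) * g * e ≤ θ ^ (-δ) * g * N := by gcongr
  unfold badBound errConst
  simp only [Finset.sum_add_distrib]
  -- The fours: two `φ`-errors and two from the weight gain; two sums of squares and two from the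
  -- products; two collision sums and two loop terms.
  have expand : N * (4 * M / θ + 4 * M * θ ^ (-(1 + δ)) + 4 * θ ^ (-δ)) * g =
      4 * (N * (g * M / θ)) + 4 * (M * θ ^ (-(1 + δ)) * g * N) + 4 * (θ ^ (-δ) * g * N) := by
    ring
  rw [expand]
  linarith

/-- At a vertex where the outbound edge probabilities are regular, they agree with the Poisson
means up to a small error. -/
theorem sum_abs_add_sq_le [NeZero n] (hθ : 0 < θ) (hδ : 0 < δ) (hδ1 : δ ≤ 1) (hη : 0 < η)
    {s : Fin n} (hB' : B' θ η w φ s) :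
    ∑ t, (|p θ w φ s t - q θ w s t| + q θ w s t ^ 2) + q θ w s s ≤
      (n : ℝ) ^ (-η) * ((w s).weight * meanPow δ w / θ) +
        meanPow δ w * θ ^ (-(1 + δ)) * (w s).weight ^ (1 + δ) * (n : ℝ) ^ (-δ) +
        2 * q θ w s s := by
  have hq0 := q_nonneg (n := n) hθ.le w
  have hqs' : ∀ j, q θ w s j ≤ (w j).weight * (w s).weight / (θ * n) :=
    fun j => q_le_weight' hθ.le w s j
  have l2 := sum_le_weight hθ hδ.le _ hqs' fun j => hq0 s j
  have s2 := sum_sq_le_weight hθ hδ hδ1 _ hqs' (fun j => hq0 s j) fun j => hB'.2 j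
  have m2 : ∑ j, |p θ w φ s j - q θ w s j| ≤
      (n : ℝ) ^ (-η) * ∑ j, q θ w s j + q θ w s s := by
    calc _ ≤ ∑ j, ((n : ℝ) ^ (-η) * q θ w s j + if s = j then q θ w s j else 0) :=
          Finset.sum_le_sum fun j _ => abs_p_sub_q_le hθ.le hη s j
            (fun h => hB'.1 j h.symm) (hB'.2 j)
      _ = _ := by
          rw [Finset.sum_add_distrib, ← Finset.mul_sum, Finset.sum_ite_eq Finset.univ s]
          simp
  have x2 : (n : ℝ) ^ (-η) * ∑ j, q θ w s j ≤
      (n : ℝ) ^ (-η) * ((w s).weight * meanPow δ w / θ) := by gcongr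
  rw [Finset.sum_add_distrib]
  linarith

end

/-! ### The bound on the breaking probability -/

theorem ind_nonneg (A : Prop) : 0 ≤ ind A := by
  unfold ind
  split_ifs <;> norm_num

theorem ind_of_true {A : Prop} (h : A) : ind A = 1 := by
  unfold ind
  exact if_pos h

theorem ind_of_false {A : Prop} (h : ¬ A) : ind A = 0 := by
  unfold ind
  exact if_neg h

theorem ind_or_le (A A' : Prop) : ind (A ∨ A') ≤ ind A + ind A' := by
  unfold ind
  by_cases h : A <;> by_cases h2 : A' <;> simp [h, h2]

/-- The cost of exploring a node of type `s`. -/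
def cost (δ η θ : ℝ) (w : Types n) (φ : Fin n → Fin n → ℝ) (s : Fin n) : ℝ :=
  ind (¬ B θ η w φ s ∨ ¬ B' θ η w φ s) +
    (n : ℝ) ^ (-(min (δ / 2) η)) * errConst δ θ w * (w s).weight

/-- The expected total cost of the descendants, within less than `l` generations, of a node of
type `s`. -/
def potential (δ η θ : ℝ) (w : Types n) (φ : Fin n → Fin n → ℝ) : ℕ → Fin n → ℝ
  | 0, _ => 0
  | l + 1, s => cost δ η θ w φ s + (w s).wIn / θ * (∑ i ∈ Finset.range l, mu θ w ^ i) *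
      ((n : ℝ)⁻¹ * ∑ j, (w j).wOut * cost δ η θ w φ j)

section

variable {δ η θ : ℝ} {w : Types n} {φ : Fin n → Fin n → ℝ}

theorem cost_nonneg (hθ : 0 ≤ θ) (s : Fin n) : 0 ≤ cost δ η θ w φ s := by
  have := ind_nonneg (¬ B θ η w φ s ∨ ¬ B' θ η w φ s)
  have := errConst_nonneg (δ := δ) hθ w
  have := weight_pos (w s)
  unfold cost
  positivity

theorem potential_nonneg (hθ : 0 ≤ θ) (l : ℕ) (s : Fin n) : 0 ≤ potential δ η θ w φ l s := by
  rcases l with _ | l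
  · exact le_rfl
  · have h1 := cost_nonneg (δ := δ) (η := η) (w := w) (φ := φ) hθ s
    have h2 := wIn_nonneg (w s)
    have h3 := mu_nonneg hθ w
    have h4 : 0 ≤ ∑ j, (w j).wOut * cost δ η θ w φ j :=
      Finset.sum_nonneg fun j _ => mul_nonneg (wOut_nonneg _) (cost_nonneg hθ j)
    have h5 : 0 ≤ ∑ i ∈ Finset.range l, mu θ w ^ i := Finset.sum_nonneg fun i _ => by positivity
    unfold potential
    positivity

/-- The mean matrix has rank one: offspring averages depend on the parent only through `W⁺`. -/
theorem sum_q_mul (θ : ℝ) (w : Types n) (s : Fin n) (f : Fin n → ℝ) :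
    ∑ j, q θ w j s * f j = (w s).wIn / θ * ((n : ℝ)⁻¹ * ∑ j, (w j).wOut * f j) := by
  rw [Finset.mul_sum, Finset.mul_sum]
  refine Finset.sum_congr rfl fun j _ => ?_
  unfold q
  rw [div_eq_mul_inv, mul_inv, div_eq_mul_inv]
  ring

/-- First-generation decomposition of the expected cost. The mean matrix multiplies the vector `W⁺`
by `μ_n`, so the geometric sum gains one term. -/
theorem potential_step (l : ℕ) (s : Fin n) :
    cost δ η θ w φ s + ∑ j, q θ w j s * potential δ η θ w φ l j =
      potential δ η θ w φ (l + 1) s := by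
  rcases l with _ | l
  · simp [potential]
  · simp only [potential]
    rw [sum_q_mul]
    set S := ∑ i ∈ Finset.range l, mu θ w ^ i with hS
    set c := (n : ℝ)⁻¹ * ∑ j, (w j).wOut * cost δ η θ w φ j with hc
    have h1 : ∑ j, (w j).wOut * (cost δ η θ w φ j + (w j).wIn / θ * S * c) =
        ∑ j, (w j).wOut * cost δ η θ w φ j + (∑ j, (w j).wIn * (w j).wOut) / θ * S * c := by
      rw [Finset.sum_div, Finset.sum_mul, Finset.sum_mul, ← Finset.sum_add_distrib]
      exact Finset.sum_congr rfl fun j _ => by ring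
    have h2 : mu θ w = (n : ℝ)⁻¹ * ((∑ j, (w j).wIn * (w j).wOut) / θ) := by
      unfold mu
      rw [mul_inv, div_eq_mul_inv]
      ring
    have h3 : ∑ i ∈ Finset.range (l + 1), mu θ w ^ i = S * mu θ w + 1 := by
      rw [Finset.sum_range_succ', pow_zero]
      simp only [pow_succ, ← Finset.sum_mul, hS]
    rw [h3, h1, mul_add, ← hc, show (n : ℝ)⁻¹ *
      ((∑ j, (w j).wIn * (w j).wOut) / θ * S * c) = mu θ w * S * c by rw [h2]; ring]
    ring

theorem lintegral_sum_count_mul {P : Fin n → Fin n → ℝ} {Q : Fin n → Fin n → ℝ≥0}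
    (h0 : ∀ i j, 0 ≤ P i j) (h1 : ∀ i j, P i j ≤ 1) (s : Fin n) {a : Fin n → ℝ}
    (ha : ∀ j, 0 ≤ a j) :
    ∫⁻ y, ∑ j, (y.2.2.count j : ℝ≥0∞) * ENNReal.ofReal (a j) ∂(sampleLaw P Q s) =
      ENNReal.ofReal (∑ j, (Q j s : ℝ) * a j) := by
  rw [lintegral_finsetSum _ fun j _ => Measurable.of_discrete,
    ENNReal.ofReal_sum_of_nonneg fun j _ => mul_nonneg (Q j s).coe_nonneg (ha j)]
  refine Finset.sum_congr rfl fun j _ => ?_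
  rw [lintegral_mul_const _ Measurable.of_discrete, lintegral_sampleLaw_count_cast h0 h1,
    ENNReal.ofReal_mul (Q j s).coe_nonneg, ENNReal.ofReal_coe_nnreal]

theorem lintegral_sum_numbers_mul {P : Fin n → Fin n → ℝ} {Q : Fin n → Fin n → ℝ≥0}
    (h0 : ∀ i j, 0 ≤ P i j) (h1 : ∀ i j, P i j ≤ 1) (s : Fin n) {a : Fin n → ℝ}
    (ha : ∀ j, 0 ≤ a j) :
    ∫⁻ y, ∑ j, ((y.2.2.count j : ℝ≥0∞) + y.2.1 j) * ENNReal.ofReal (a j) ∂(sampleLaw P Q s) =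
      ENNReal.ofReal (∑ j, ((Q j s : ℝ) + Q s j) * a j) := by
  rw [lintegral_finsetSum _ fun j _ => Measurable.of_discrete,
    ENNReal.ofReal_sum_of_nonneg fun j _ =>
      mul_nonneg (add_nonneg (Q j s).coe_nonneg (Q s j).coe_nonneg) (ha j)]
  refine Finset.sum_congr rfl fun j _ => ?_
  rw [lintegral_mul_const _ Measurable.of_discrete, lintegral_add_left Measurable.of_discrete,
    lintegral_sampleLaw_count_cast h0 h1, lintegral_sampleLaw_inactive_cast h0 h1,
    ENNReal.ofReal_mul (add_nonneg (Q j s).coe_nonneg (Q s j).coe_nonneg), ENNReal.ofReal_add (Q j s).coe_nonneg (Q s j).coe_nonneg,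
    ENNReal.ofReal_coe_nnreal, ENNReal.ofReal_coe_nnreal]

/-- The breaking probability is at most the expected total cost. -/
theorem couplingLaw_le_potential [NeZero n] (hθ : 0 < θ) (hδ : 0 < δ) (hδ1 : δ ≤ 1) (hη : 0 < η)
    (hφ : ∀ i j, i ≠ j → -1 < φ i j) (k : ℕ) :
    couplingLaw (p θ w φ) (fun i j => (q θ w i j).toNNReal) {ω | breakStep ω ≤ (k : ℕ∞)} ≤
      ENNReal.ofReal ((n : ℝ)⁻¹ * ∑ r, ((n : ℝ) ^ (-(δ / 2)) * (w r).weight ^ δ +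
        potential δ η θ w φ (k + 1) r)) := by
  have hn : (0 : ℝ) < n := Nat.cast_pos.2 (NeZero.pos n)
  have h0 := p_nonneg hθ.le w hφ
  have h1 := p_le_one θ w φ
  have hd : ∀ i, p θ w φ i i = 0 := fun i => by simp [p]
  have hq : ∀ i j, ((q θ w i j).toNNReal : ℝ) = q θ w i j :=
    fun i j => Real.coe_toNNReal _ (q_nonneg hθ.le w i j)
  have := fun s => isProbabilityMeasure_sampleLaw (Q := fun i j => (q θ w i j).toNNReal) h0 h1 s
  set a : Fin n → ℝ := fun j => (n : ℝ) ^ (-(δ / 2)) * (w j).weight ^ δ with ha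
  have ha0 : ∀ j, 0 ≤ a j := fun j => by
    have := weight_pos (w j)
    simp only [ha]
    positivity
  have hpot := fun l s => potential_nonneg (δ := δ) (η := η) (w := w) (φ := φ) hθ.le l s
  have hcost := fun s => cost_nonneg (δ := δ) (η := η) (w := w) (φ := φ) hθ.le s
  refine (couplingLaw_breakStep_le_breaks h0 h1 k).trans ?_
  rw [ENNReal.ofReal_mul (by positivity), ENNReal.ofReal_inv_of_pos hn, ENNReal.ofReal_natCast,
    ENNReal.ofReal_sum_of_nonneg fun r _ => add_nonneg (ha0 r) (hpot _ r)]
  gcongr with r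
  refine (Exploration.measure_breaks_le
    (sampleLaw (p θ w φ) (fun i j => (q θ w i j).toNNReal)) (fun j => ENNReal.ofReal (a j))
    (fun s => ENNReal.ofReal (cost δ η θ w φ s))
    (fun l s => ENNReal.ofReal (potential δ η θ w φ l s)) ?_ ?_ k n (Exploration.start r)
    (by simp [Exploration.start])).trans ?_
  · intro K s hs hK
    rw [lintegral_sum_numbers_mul h0 h1 s ha0]
    simp only [hq]
    rw [← ENNReal.ofReal_sum_of_nonneg fun j _ => ha0 j, ENNReal.ofReal_le_one] at hK
    by_cases hB : B θ η w φ s ∧ B' θ η w φ s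
    · have hle := badBound_add_le hθ hδ hδ1 hη hs hK hB.1 hB.2
      have hbad := sampleLaw_not_isGood_le (Q := fun i j => (q θ w i j).toNNReal) h0 h1 hd K s
      simp only [hq] at hbad
      refine (add_le_add_left hbad _).trans ?_
      have hsum : 0 ≤ ∑ j, (q θ w j s + q θ w s j) * a j := Finset.sum_nonneg fun j _ =>
        mul_nonneg (add_nonneg (q_nonneg hθ.le w _ _) (q_nonneg hθ.le w _ _)) (ha0 j)
      have hb0 : 0 ≤ badBound θ w φ K s := by
        have hq0 := q_nonneg (n := n) hθ.le w
        refine add_nonneg (add_nonneg (add_nonneg ?_ ?_) ?_) ?_ <;>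
          refine Finset.sum_nonneg fun j _ => ?_
        · positivity
        · positivity
        · exact add_nonneg (hq0 _ _) (hq0 _ _)
        · exact mul_nonneg (hq0 _ _) (hq0 _ _)
      change ENNReal.ofReal (badBound θ w φ K s) + _ ≤ _
      rw [← ENNReal.ofReal_add hb0 hsum]
      refine ENNReal.ofReal_le_ofReal (hle.trans ?_)
      unfold cost
      linarith [ind_nonneg (¬ B θ η w φ s ∨ ¬ B' θ η w φ s)]
    -- At an irregular vertex the indicator pays for a bad sample. The gain of weight is still
    -- bounded by the other summand of the cost, which needs no regularity.
    · have hind : ind (¬ B θ η w φ s ∨ ¬ B' θ η w φ s) = 1 := ind_of_true (by tauto)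
      have hq0 := q_nonneg (n := n) hθ.le w
      have hM := meanPow_nonneg δ w
      have hg := weight_pos (w s)
      have hn1 : (1 : ℝ) ≤ n := Nat.one_le_cast.2 NeZero.one_le
      have heN : (n : ℝ) ^ (-(δ / 2)) ≤ (n : ℝ) ^ (-(min (δ / 2) η)) :=
        Real.rpow_le_rpow_of_exponent_le hn1 (by linarith [min_le_left (δ / 2) η])
      have t1 := sum_mul_weight_le (δ := δ) hθ _ fun j => q_le_weight hθ.le w j s
      have t2 := sum_mul_weight_le (δ := δ) hθ _ fun j => q_le_weight' hθ.le w s j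
      have hle : ∑ j, (q θ w j s + q θ w s j) * a j ≤
          (n : ℝ) ^ (-(min (δ / 2) η)) * errConst δ θ w * (w s).weight := by
        calc _ = (n : ℝ) ^ (-(δ / 2)) * (∑ j, q θ w j s * (w j).weight ^ δ +
              ∑ j, q θ w s j * (w j).weight ^ δ) := by
              rw [← Finset.sum_add_distrib, Finset.mul_sum]
              exact Finset.sum_congr rfl fun j _ => by simp only [ha]; ring
          _ ≤ (n : ℝ) ^ (-(δ / 2)) * (4 * meanPow δ w / θ * (w s).weight) := by
              gcongr
              have : 4 * meanPow δ w / θ * (w s).weight =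
                4 * ((w s).weight * meanPow δ w / θ) := by ring
              have h5 : 0 ≤ (w s).weight * meanPow δ w / θ := by positivity
              linarith
          _ ≤ (n : ℝ) ^ (-(min (δ / 2) η)) * (errConst δ θ w * (w s).weight) := by
              have : 4 * meanPow δ w / θ ≤ errConst δ θ w := by
                unfold errConst
                have : 0 ≤ 4 * meanPow δ w * θ ^ (-(1 + δ)) := by positivity
                have : 0 ≤ 4 * θ ^ (-δ) := by positivity
                linarith
              gcongr
          _ = _ := by ring
      have e1 : ENNReal.ofReal (cost δ η θ w φ s) = 1 + ENNReal.ofReal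
          ((n : ℝ) ^ (-(min (δ / 2) η)) * errConst δ θ w * (w s).weight) := by
        have := errConst_nonneg (δ := δ) hθ.le w
        unfold cost
        rw [hind, ENNReal.ofReal_add zero_le_one (by positivity), ENNReal.ofReal_one]
      rw [e1]
      exact add_le_add prob_le_one (ENNReal.ofReal_le_ofReal hle)
  · intro l s
    rw [lintegral_sum_count_mul h0 h1 s (hpot l)]
    simp only [hq]
    rw [← ENNReal.ofReal_add (hcost s) (Finset.sum_nonneg fun j _ =>
      mul_nonneg (q_nonneg hθ.le w _ _) (hpot l j)), potential_step]
  · simp only [Exploration.start, Finset.sum_singleton, List.map_cons, List.map_nil,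
      List.sum_cons, List.sum_nil, List.length_nil, Nat.sub_zero, add_zero]
    rw [ENNReal.ofReal_add (ha0 r) (hpot _ r)]

/-- If no edge may occur, the coupling does not break. -/
theorem couplingLaw_eq_zero [NeZero n] (hθ : 0 < θ) (hφ : ∀ i j, i ≠ j → -1 < φ i j)
    (hq : ∀ i j, q θ w i j = 0) (k : ℕ) :
    couplingLaw (p θ w φ) (fun i j => (q θ w i j).toNNReal) {ω | breakStep ω ≤ (k : ℕ∞)} = 0 := by
  have h0 := p_nonneg hθ.le w hφ
  have h1 := p_le_one θ w φ
  have hp : ∀ i j, p θ w φ i j = 0 := fun i j => by simp [p, hq]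
  have := fun s => isProbabilityMeasure_sampleLaw (Q := fun i j => (q θ w i j).toNNReal) h0 h1 s
  refine le_antisymm ((couplingLaw_breakStep_le_breaks h0 h1 k).trans ?_) zero_le
  have : ∀ r, Measure.infinitePi (fun a : List ℕ × Fin n =>
      sampleLaw (p θ w φ) (fun i j => (q θ w i j).toNNReal) a.2)
        {R | Exploration.Breaks k R n (Exploration.start r)} ≤ 0 := by
    intro r
    refine (Exploration.measure_breaks_le
      (sampleLaw (p θ w φ) (fun i j => (q θ w i j).toNNReal)) (fun _ => 0) (fun _ => 0)
      (fun _ _ => 0) ?_ ?_ k n (Exploration.start r) (by simp [Exploration.start])).trans ?_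
    · intro K s _ _
      have hbad := sampleLaw_not_isGood_le (Q := fun i j => (q θ w i j).toNNReal) h0 h1
        (fun i => hp i i) K s
      simpa [hp, hq] using hbad
    · simp
    · simp [Exploration.start]
  simp [fun r => le_antisymm (this r) zero_le]

end

/-! ### The random variable in the bound -/

/-- The part of the random variable in the bound that depends continuously on the empirical
means `M₁ = meanPow δ w`, `M₂ = meanOut w`, and on `μₙ` and its inverse. -/
def meanConst (δ θ M₁ M₂ μ ν : ℝ) : ℝ :=
  -- The `1` serves the indicator terms, the next three summands step `0`, and the factor `ν = μ⁻¹`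
  -- converts `∑_{i<k} μ ^ i` into `∑_{m=1}^k μ ^ m`.
  1 + M₁ ^ 2 / θ + M₁ ^ 2 * θ ^ (-(1 + δ)) + 2 * μ +
    ν * (M₁ + (4 * M₁ / θ + 4 * M₁ * θ ^ (-(1 + δ)) + 4 * θ ^ (-δ)) * (M₁ + M₁ * M₂ / θ) + M₁ / θ)

/-- The types for which `μₙ` vanishes although edges may occur. -/
def Degenerate (w : Types n) : Prop :=
  ∑ i, (w i).wIn * (w i).wOut = 0 ∧ (∑ i, (w i).wIn) * ∑ i, (w i).wOut ≠ 0

/-- The random variable in the bound on the breaking probability. -/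
def boundConst (n : ℕ) (δ θ : ℝ) (w : Types n) : ℝ :=
  meanConst δ θ (meanPow δ w) (meanOut w) (mu θ w) (mu θ w)⁻¹ + ind (Degenerate w) * n

theorem measurable_boundConst (n : ℕ) (δ θ : ℝ) : Measurable (boundConst n δ θ) := by
  have h1 := measurable_wIn (n := n)
  have h2 := measurable_wOut (n := n)
  have h3 : ∀ i, Measurable fun w : Types n => (w i).weight :=
    fun i => ((measurable_const.add (h1 i)).add (h2 i))
  have h4 : Measurable fun w : Types n => meanPow δ w := by
    unfold meanPow
    fun_prop
  have h5 : Measurable fun w : Types n => meanOut w := by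
    unfold meanOut
    fun_prop
  have h6 : Measurable fun w : Types n => mu θ w := by
    unfold mu
    fun_prop
  have h7 : MeasurableSet {w : Types n | Degenerate w} := by
    refine MeasurableSet.inter (measurableSet_eq_fun ?_ measurable_const)
      (measurableSet_eq_fun ?_ measurable_const).compl <;> fun_prop
  have h8 : Measurable fun w : Types n => ind (Degenerate w) := by
    unfold ind
    exact Measurable.ite h7 measurable_const measurable_const
  unfold boundConst meanConst
  fun_prop

section

variable {δ η θ : ℝ} {w : Types n} {φ : Fin n → Fin n → ℝ}

theorem couplingLaw_le_one [NeZero n] (hθ : 0 < θ) (hφ : ∀ i j, i ≠ j → -1 < φ i j) (k : ℕ) :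
    couplingLaw (p θ w φ) (fun i j => (q θ w i j).toNNReal) {ω | breakStep ω ≤ (k : ℕ∞)} ≤ 1 := by
  have h0 := p_nonneg hθ.le w hφ
  have h1 := p_le_one θ w φ
  have := fun s => isProbabilityMeasure_sampleLaw (Q := fun i j => (q θ w i j).toNNReal) h0 h1 s
  refine (couplingLaw_breakStep_le_breaks h0 h1 k).trans ?_
  calc _ ≤ (n : ℝ≥0∞)⁻¹ * ∑ _r : Fin n, 1 := by
        gcongr
        exact prob_le_one
    _ = 1 := by
        rw [Finset.sum_const, Finset.card_univ, Fintype.card_fin, nsmul_one]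
        exact ENNReal.inv_mul_cancel (Nat.cast_ne_zero.2 (NeZero.ne n)) (ENNReal.natCast_ne_top n)

/-- The bound on the probability that the coupling breaks at the root. -/
theorem couplingLaw_zero_le [NeZero n] (hθ : 0 < θ) (hδ : 0 < δ) (hδ1 : δ ≤ 1) (hη : 0 < η)
    (hφ : ∀ i j, i ≠ j → -1 < φ i j) :
    (couplingLaw (p θ w φ) fun i j => (q θ w i j).toNNReal).real
        {ω | breakStep ω ≤ ((0 : ℕ) : ℕ∞)} ≤
      (n : ℝ)⁻¹ * ∑ i, ind (¬ B' θ η w φ i) + meanPow δ w ^ 2 / θ * (n : ℝ) ^ (-η) +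
        (meanPow δ w ^ 2 * θ ^ (-(1 + δ)) + 2 * mu θ w) * (n : ℝ) ^ (-δ) := by
  have hn1 : (1 : ℝ) ≤ n := Nat.one_le_cast.2 NeZero.one_le
  have hn : (0 : ℝ) < n := by linarith
  have hM := meanPow_nonneg δ w
  have hμ := mu_nonneg hθ.le w
  have hq : ∀ i j, ((q θ w i j).toNNReal : ℝ) = q θ w i j :=
    fun i j => Real.coe_toNNReal _ (q_nonneg hθ.le w i j)
  have hind := Finset.sum_nonneg fun i (_ : i ∈ Finset.univ) => ind_nonneg (¬ B' θ η w φ i)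
  refine ENNReal.toReal_le_of_le_ofReal (by positivity) ?_
  refine (couplingLaw_breakStep_zero_le (p_nonneg hθ.le w hφ) (p_le_one θ w φ)
    fun i => by simp [p]).trans ?_
  simp only [hq]
  set f : Fin n → ℝ := fun r =>
    min 1 (∑ t, (|p θ w φ r t - q θ w r t| + q θ w r t ^ 2) + q θ w r r) with hf
  have hf0 : ∀ r, 0 ≤ f r := fun r => le_min zero_le_one (add_nonneg
    (Finset.sum_nonneg fun t _ => by positivity) (q_nonneg hθ.le w r r))
  have hfr : ∀ r, f r ≤ ind (¬ B' θ η w φ r) +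
      (n : ℝ) ^ (-η) * (meanPow δ w / θ) * (w r).weight +
      meanPow δ w * θ ^ (-(1 + δ)) * (n : ℝ) ^ (-δ) * (w r).weight ^ (1 + δ) +
      2 * q θ w r r := by
    intro r
    have hg := weight_pos (w r)
    have hqr := q_nonneg hθ.le w r r
    by_cases hB : B' θ η w φ r
    · refine (min_le_right _ _).trans ((sum_abs_add_sq_le hθ hδ hδ1 hη hB).trans ?_)
      rw [ind_of_false (not_not.2 hB)]
      exact le_of_eq (by ring)
    · refine (min_le_left _ _).trans ?_
      rw [ind_of_true hB]
      have : 0 ≤ (n : ℝ) ^ (-η) * (meanPow δ w / θ) * (w r).weight +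
        meanPow δ w * θ ^ (-(1 + δ)) * (n : ℝ) ^ (-δ) * (w r).weight ^ (1 + δ) := by positivity
      linarith
  rw [← ENNReal.ofReal_sum_of_nonneg fun r _ => hf0 r, ← ENNReal.ofReal_natCast,
    ← ENNReal.ofReal_inv_of_pos hn, ← ENNReal.ofReal_mul (by positivity)]
  refine ENNReal.ofReal_le_ofReal ?_
  -- The diagonal of `q` sums to `μ_n`, and `n⁻¹ ≤ n ^ (-δ)` as `δ ≤ 1`. It occurs twice: for the
  -- missing loop and for an inactive node of the type of the root.
  have hqq : (n : ℝ)⁻¹ * ∑ r, q θ w r r ≤ mu θ w * (n : ℝ) ^ (-δ) := by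
    have e : ∑ r, q θ w r r = mu θ w := by
      unfold q mu
      rw [Finset.mul_sum]
      exact Finset.sum_congr rfl fun i _ => by rw [div_eq_inv_mul, mul_comm (w i).wOut]
    have : (n : ℝ)⁻¹ ≤ (n : ℝ) ^ (-δ) := by
      rw [← Real.rpow_neg_one]
      exact Real.rpow_le_rpow_of_exponent_le hn1 (by linarith)
    rw [e, mul_comm]
    gcongr
  have hw := mean_weight_le hδ.le w
  have hw' : (n : ℝ) ^ (-η) * (meanPow δ w / θ) * ((n : ℝ)⁻¹ * ∑ r, (w r).weight) ≤
      (n : ℝ) ^ (-η) * (meanPow δ w / θ) * meanPow δ w := by gcongr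
  calc (n : ℝ)⁻¹ * ∑ r, f r
      ≤ (n : ℝ)⁻¹ * ∑ r, (ind (¬ B' θ η w φ r) +
        (n : ℝ) ^ (-η) * (meanPow δ w / θ) * (w r).weight +
        meanPow δ w * θ ^ (-(1 + δ)) * (n : ℝ) ^ (-δ) * (w r).weight ^ (1 + δ) +
        2 * q θ w r r) := by
        gcongr with r
        exact hfr r
    _ = (n : ℝ)⁻¹ * ∑ i, ind (¬ B' θ η w φ i) +
        (n : ℝ) ^ (-η) * (meanPow δ w / θ) * ((n : ℝ)⁻¹ * ∑ r, (w r).weight) +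
        meanPow δ w * θ ^ (-(1 + δ)) * (n : ℝ) ^ (-δ) * meanPow δ w +
        2 * ((n : ℝ)⁻¹ * ∑ r, q θ w r r) := by
        rw [Finset.sum_add_distrib, Finset.sum_add_distrib, Finset.sum_add_distrib,
          ← Finset.mul_sum, ← Finset.mul_sum, ← Finset.mul_sum]
        unfold meanPow
        ring
    _ ≤ _ := by
        have : meanPow δ w ^ 2 / θ * (n : ℝ) ^ (-η) =
          (n : ℝ) ^ (-η) * (meanPow δ w / θ) * meanPow δ w := by ring
        rw [this]
        linarith

/-- The mean of the weights of the roots and of the potential in terms of the empirical means. -/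
theorem mean_potential_le [NeZero n] (hθ : 0 < θ) (hδ : 0 < δ) (hδ1 : δ ≤ 1) {k : ℕ}
    (hk : 1 ≤ k) :
    (n : ℝ)⁻¹ * ∑ r, ((n : ℝ) ^ (-(δ / 2)) * (w r).weight ^ δ +
        potential δ η θ w φ (k + 1) r) ≤
      (n : ℝ)⁻¹ * ∑ i, ind (¬ B θ η w φ i) + (n : ℝ)⁻¹ * ∑ i, ind (¬ B' θ η w φ i) +
        (meanPow δ w + errConst δ θ w * (meanPow δ w + meanPow δ w * meanOut w / θ)) *
          (n : ℝ) ^ (-(min (δ / 2) η)) * ∑ i ∈ Finset.range k, mu θ w ^ i +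
        meanPow δ w / θ * ((n : ℝ)⁻¹ *
          ∑ i, ind (¬ B θ η w φ i ∨ ¬ B' θ η w φ i) * (w i).wOut) *
            ∑ i ∈ Finset.range k, mu θ w ^ i := by
  have hn1 : (1 : ℝ) ≤ n := Nat.one_le_cast.2 NeZero.one_le
  have hn : (0 : ℝ) < n := by linarith
  have hM := meanPow_nonneg δ w
  have hO := meanOut_nonneg w
  have hμ := mu_nonneg hθ.le w
  have hC := errConst_nonneg (δ := δ) hθ.le w
  set M := meanPow δ w with hMdef
  set N := (n : ℝ) ^ (-(min (δ / 2) η)) with hN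
  set C := errConst δ θ w with hCdef
  set S := ∑ i ∈ Finset.range k, mu θ w ^ i with hS
  set D := (n : ℝ)⁻¹ * ∑ i, ind (¬ B θ η w φ i ∨ ¬ B' θ η w φ i) * (w i).wOut with hD
  have hN0 : 0 ≤ N := by positivity
  have hD0 : 0 ≤ D := mul_nonneg (by positivity)
    (Finset.sum_nonneg fun i _ => mul_nonneg (ind_nonneg _) (wOut_nonneg _))
  -- For `k ≥ 1` the geometric sum contains `μ ^ 0`, which lets the terms of the root be absorbed
  -- into it.
  have hS1 : 1 ≤ S := by
    have := Finset.single_le_sum (f := fun i => mu θ w ^ i) (fun i _ => by positivity)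
      (Finset.mem_range.2 hk)
    simpa using this
  have hw := mean_weight_le hδ.le w
  have hcost : (n : ℝ)⁻¹ * ∑ s, cost δ η θ w φ s ≤ (n : ℝ)⁻¹ * ∑ i, ind (¬ B θ η w φ i) +
      (n : ℝ)⁻¹ * ∑ i, ind (¬ B' θ η w φ i) + N * C * M := by
    calc _ ≤ (n : ℝ)⁻¹ * ∑ s, (ind (¬ B θ η w φ s) + ind (¬ B' θ η w φ s) +
          N * C * (w s).weight) := by
          gcongr with s
          exact add_le_add_left (ind_or_le _ _) _
      _ = (n : ℝ)⁻¹ * ∑ i, ind (¬ B θ η w φ i) + (n : ℝ)⁻¹ * ∑ i, ind (¬ B' θ η w φ i) +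
          N * C * ((n : ℝ)⁻¹ * ∑ s, (w s).weight) := by
          rw [Finset.sum_add_distrib, Finset.sum_add_distrib, ← Finset.mul_sum]
          ring
      _ ≤ _ := by gcongr
  have hcost' : (n : ℝ)⁻¹ * ∑ j, (w j).wOut * cost δ η θ w φ j = D + N * C * meanOut w := by
    unfold meanOut
    rw [hD, Finset.mul_sum, Finset.mul_sum, Finset.mul_sum, Finset.mul_sum,
      ← Finset.sum_add_distrib]
    refine Finset.sum_congr rfl fun j _ => ?_
    unfold cost
    ring
  have hin : (n : ℝ)⁻¹ * ∑ r, (w r).wIn ≤ M := by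
    refine le_trans ?_ hw
    gcongr with r
    exact wIn_le_weight _
  have hroot : (n : ℝ)⁻¹ * ∑ r, (n : ℝ) ^ (-(δ / 2)) * (w r).weight ^ δ ≤ N * M := by
    have heN : (n : ℝ) ^ (-(δ / 2)) ≤ N :=
      Real.rpow_le_rpow_of_exponent_le hn1 (by linarith [min_le_left (δ / 2) η])
    calc _ = (n : ℝ) ^ (-(δ / 2)) * ((n : ℝ)⁻¹ * ∑ r, (w r).weight ^ δ) := by
          rw [← Finset.mul_sum]
          ring
      _ ≤ N * ((n : ℝ)⁻¹ * ∑ r, (w r).weight) := by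
          have h0 : 0 ≤ ∑ r, (w r).weight ^ δ :=
            Finset.sum_nonneg fun r _ => Real.rpow_nonneg (weight_pos _).le _
          gcongr with r
          exact rpow_le_weight hδ1 _
      _ ≤ _ := by gcongr
  have htotal : (n : ℝ)⁻¹ * ∑ r, ((n : ℝ) ^ (-(δ / 2)) * (w r).weight ^ δ +
        potential δ η θ w φ (k + 1) r) =
      (n : ℝ)⁻¹ * ∑ r, (n : ℝ) ^ (-(δ / 2)) * (w r).weight ^ δ +
        (n : ℝ)⁻¹ * ∑ s, cost δ η θ w φ s +
        ((n : ℝ)⁻¹ * ∑ r, (w r).wIn) / θ * S * (D + N * C * meanOut w) := by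
    simp only [potential]
    rw [hcost', Finset.sum_add_distrib, Finset.sum_add_distrib, ← Finset.sum_mul,
      ← Finset.sum_mul, ← Finset.sum_div]
    ring
  rw [htotal]
  have h1 : ((n : ℝ)⁻¹ * ∑ r, (w r).wIn) / θ * S * (D + N * C * meanOut w) ≤
      M / θ * S * (D + N * C * meanOut w) := by gcongr
  have h2 : N * M + N * C * M ≤ (N * M + N * C * M) * S := le_mul_of_one_le_right (by positivity) hS1
  have e : (M + C * (M + M * meanOut w / θ)) * N * S + M / θ * D * S =
      (N * M + N * C * M) * S + M / θ * S * (D + N * C * meanOut w) := by ring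
  linarith

theorem one_le_meanConst (hθ : 0 < θ) (w : Types n) :
    1 ≤ meanConst δ θ (meanPow δ w) (meanOut w) (mu θ w) (mu θ w)⁻¹ := by
  have hM := meanPow_nonneg δ w
  have hO := meanOut_nonneg w
  have hμ := mu_nonneg hθ.le w
  unfold meanConst
  rw [add_assoc, add_assoc, add_assoc]
  exact le_add_of_nonneg_right (by positivity)

/-- The bound on the breaking probability. -/
theorem couplingLaw_le_boundConst [NeZero n] (hθ : 0 < θ) (hδ : 0 < δ) (hδ1 : δ ≤ 1) (hη : 0 < η)
    (hφ : ∀ i j, i ≠ j → -1 < φ i j) {x : ℝ} (hx : 1 ≤ x) (k : ℕ) :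
    (couplingLaw (p θ w φ) fun i j => (q θ w i j).toNNReal).real
        {ω | breakStep ω ≤ (k : ℕ∞)} ≤
      boundConst n δ θ w * (x⁻¹ + (n : ℝ) ^ (-δ) + (n : ℝ) ^ (-η) + (n : ℝ) ^ (-δ) * x *
          ∑ m ∈ Finset.Icc 1 k, ∑ r ∈ Finset.range m, mu θ w ^ (m + r) +
        (n : ℝ) ^ (-(min (δ / 2) η)) * ∑ m ∈ Finset.Icc 1 k, mu θ w ^ m +
        (n : ℝ)⁻¹ * ∑ i, ind (¬ B' θ η w φ i) +
        (n : ℝ)⁻¹ * ∑ i, ind (1 ≤ k ∧ ¬ B θ η w φ i) +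
        (n : ℝ)⁻¹ * (∑ i, ind (¬ B θ η w φ i ∨ ¬ B' θ η w φ i) * (w i).wOut) *
          ∑ m ∈ Finset.Icc 1 k, mu θ w ^ m) := by
  have hn1 : (1 : ℝ) ≤ n := Nat.one_le_cast.2 NeZero.one_le
  have hn : (0 : ℝ) < n := by linarith
  have hM := meanPow_nonneg δ w
  have hO := meanOut_nonneg w
  have hμ := mu_nonneg hθ.le w
  have hC := errConst_nonneg (δ := δ) hθ.le w
  have hH1 : 1 ≤ boundConst n δ θ w := (one_le_meanConst hθ w).trans
    (le_add_of_nonneg_right (mul_nonneg (ind_nonneg _) hn.le))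
  have hx0 : 0 ≤ x⁻¹ := inv_nonneg.2 (by linarith)
  have hδ0 : 0 ≤ (n : ℝ) ^ (-δ) := by positivity
  have hη0 : 0 ≤ (n : ℝ) ^ (-η) := by positivity
  have hY0 : 0 ≤ (n : ℝ) ^ (-δ) * x *
      ∑ m ∈ Finset.Icc 1 k, ∑ r ∈ Finset.range m, mu θ w ^ (m + r) :=
    mul_nonneg (mul_nonneg hδ0 (by linarith))
      (Finset.sum_nonneg fun m _ => Finset.sum_nonneg fun r _ => pow_nonneg hμ _)
  have hT0 : 0 ≤ ∑ m ∈ Finset.Icc 1 k, mu θ w ^ m := Finset.sum_nonneg fun m _ => pow_nonneg hμ _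
  have hN0 : 0 ≤ (n : ℝ) ^ (-(min (δ / 2) η)) := by positivity
  have hb0' : 0 ≤ (n : ℝ)⁻¹ * ∑ i, ind (¬ B' θ η w φ i) :=
    mul_nonneg (by positivity) (Finset.sum_nonneg fun i _ => ind_nonneg _)
  have hb0 : 0 ≤ (n : ℝ)⁻¹ * ∑ i, ind (1 ≤ k ∧ ¬ B θ η w φ i) :=
    mul_nonneg (by positivity) (Finset.sum_nonneg fun i _ => ind_nonneg _)
  have hD0 : 0 ≤ (n : ℝ)⁻¹ * ∑ i, ind (¬ B θ η w φ i ∨ ¬ B' θ η w φ i) * (w i).wOut :=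
    mul_nonneg (by positivity)
      (Finset.sum_nonneg fun i _ => mul_nonneg (ind_nonneg _) (wOut_nonneg _))
  have hb_eq : 1 ≤ k → (n : ℝ)⁻¹ * ∑ i, ind (1 ≤ k ∧ ¬ B θ η w φ i) =
      (n : ℝ)⁻¹ * ∑ i, ind (¬ B θ η w φ i) := fun hk => by simp [hk]
  have hzero : k = 0 → (couplingLaw (p θ w φ) fun i j => (q θ w i j).toNNReal).real
        {ω | breakStep ω ≤ (k : ℕ∞)} ≤
      (n : ℝ)⁻¹ * ∑ i, ind (¬ B' θ η w φ i) + meanPow δ w ^ 2 / θ * (n : ℝ) ^ (-η) +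
        (meanPow δ w ^ 2 * θ ^ (-(1 + δ)) + 2 * mu θ w) * (n : ℝ) ^ (-δ) := by
    rintro rfl
    exact couplingLaw_zero_le hθ hδ hδ1 hη hφ
  have hpos : 1 ≤ k → (couplingLaw (p θ w φ) fun i j => (q θ w i j).toNNReal).real
        {ω | breakStep ω ≤ (k : ℕ∞)} ≤ _ := fun hk =>
    (ENNReal.toReal_le_of_le_ofReal (mul_nonneg (by positivity) (Finset.sum_nonneg fun r _ =>
      add_nonneg (mul_nonneg (by positivity) (Real.rpow_nonneg (weight_pos _).le _))
        (potential_nonneg hθ.le _ _)))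
      (couplingLaw_le_potential (w := w) hθ hδ hδ1 hη hφ k)).trans
      (mean_potential_le hθ hδ hδ1 hk)
  have hone : (couplingLaw (p θ w φ) fun i j => (q θ w i j).toNNReal).real
      {ω | breakStep ω ≤ (k : ℕ∞)} ≤ 1 :=
    ENNReal.toReal_le_of_le_ofReal zero_le_one (by
      rw [ENNReal.ofReal_one]
      exact couplingLaw_le_one hθ hφ k)
  -- The sum that the theorem offers is `μ_n` times the sum that the expected cost produces.
  have hT : ∑ m ∈ Finset.Icc 1 k, mu θ w ^ m = mu θ w * ∑ i ∈ Finset.range k, mu θ w ^ i := by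
    rw [Finset.mul_sum, ← Finset.Ico_add_one_right_eq_Icc, Finset.sum_Ico_eq_sum_range]
    exact Finset.sum_congr rfl fun i _ => by rw [pow_add, pow_one]
  have hempty : (∑ i, (w i).wIn) * ∑ i, (w i).wOut = 0 →
      (couplingLaw (p θ w φ) fun i j => (q θ w i j).toNNReal).real
        {ω | breakStep ω ≤ (k : ℕ∞)} = 0 := by
    intro h
    have hq : ∀ i j, q θ w i j = 0 := by
      intro i j
      unfold q
      rcases mul_eq_zero.1 h with h | h
      · rw [(Finset.sum_eq_zero_iff_of_nonneg fun i _ => wIn_nonneg (w i)).1 h j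
          (Finset.mem_univ j), mul_zero, zero_div]
      · rw [(Finset.sum_eq_zero_iff_of_nonneg fun i _ => wOut_nonneg (w i)).1 h i
          (Finset.mem_univ i), zero_mul, zero_div]
    rw [Measure.real, couplingLaw_eq_zero hθ hφ hq, ENNReal.toReal_zero]
  -- In the degenerate case the summand `n` outweighs `n ^ (-δ) ≥ n⁻¹`, and the bound is trivial.
  have hdeg : Degenerate w → 1 ≤ boundConst n δ θ w * (n : ℝ) ^ (-δ) := by
    intro h
    have h1 : (n : ℝ) ≤ boundConst n δ θ w := by
      unfold boundConst
      rw [ind_of_true h, one_mul]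
      linarith [one_le_meanConst (δ := δ) hθ w]
    have h2 : (n : ℝ)⁻¹ ≤ (n : ℝ) ^ (-δ) := by
      rw [← Real.rpow_neg_one]
      exact Real.rpow_le_rpow_of_exponent_le hn1 (by linarith)
    calc (1 : ℝ) = n * (n : ℝ)⁻¹ := (mul_inv_cancel₀ hn.ne').symm
      _ ≤ _ := by gcongr
  have hmu : mu θ w = 0 ↔ ∑ i, (w i).wIn * (w i).wOut = 0 := by
    unfold mu
    rw [mul_eq_zero, or_iff_right (by positivity)]
  have hH : meanConst δ θ (meanPow δ w) (meanOut w) (mu θ w) (mu θ w)⁻¹ ≤ boundConst n δ θ w :=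
    le_add_of_nonneg_right (mul_nonneg (ind_nonneg _) hn.le)
  set H := boundConst n δ θ w with hHdef
  set M := meanPow δ w with hMdef
  set Y := (n : ℝ) ^ (-δ) * x * ∑ m ∈ Finset.Icc 1 k, ∑ r ∈ Finset.range m, mu θ w ^ (m + r)
  set T := ∑ m ∈ Finset.Icc 1 k, mu θ w ^ m with hTdef
  set N := (n : ℝ) ^ (-(min (δ / 2) η))
  set b' := (n : ℝ)⁻¹ * ∑ i, ind (¬ B' θ η w φ i)
  set b := (n : ℝ)⁻¹ * ∑ i, ind (1 ≤ k ∧ ¬ B θ η w φ i)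
  set D := (n : ℝ)⁻¹ * ∑ i, ind (¬ B θ η w φ i ∨ ¬ B' θ η w φ i) * (w i).wOut
  set S := ∑ i ∈ Finset.range k, mu θ w ^ i with hSdef
  have hH0 : 0 ≤ H := by linarith
  have expand : H * (x⁻¹ + (n : ℝ) ^ (-δ) + (n : ℝ) ^ (-η) + Y + N * T + b' + b + D * T) =
      H * x⁻¹ + H * (n : ℝ) ^ (-δ) + H * (n : ℝ) ^ (-η) + H * Y + H * (N * T) + H * b' + H * b +
        H * (D * T) := by ring
  rw [expand]
  have p1 : 0 ≤ H * x⁻¹ := by positivity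
  have p2 : 0 ≤ H * (n : ℝ) ^ (-δ) := by positivity
  have p3 : 0 ≤ H * (n : ℝ) ^ (-η) := by positivity
  have p4 : 0 ≤ H * Y := by positivity
  have p5 : 0 ≤ H * (N * T) := by positivity
  have p6 : b' ≤ H * b' := le_mul_of_one_le_left hb0' hH1
  have p7 : b ≤ H * b := le_mul_of_one_le_left hb0 hH1
  have p8 : 0 ≤ H * (D * T) := by positivity
  have hMC : meanConst δ θ M (meanOut w) (mu θ w) (mu θ w)⁻¹ = 1 + M ^ 2 / θ +
      M ^ 2 * θ ^ (-(1 + δ)) + 2 * mu θ w + (mu θ w)⁻¹ *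
      (M + errConst δ θ w * (M + M * meanOut w / θ) + M / θ) := rfl
  rw [hMC] at hH
  have n1 : 0 ≤ M ^ 2 / θ := by positivity
  have n2 : 0 ≤ M ^ 2 * θ ^ (-(1 + δ)) := by positivity
  have n3 : 0 ≤ M + errConst δ θ w * (M + M * meanOut w / θ) := by positivity
  have n4 : 0 ≤ M / θ := by positivity
  rcases Nat.eq_zero_or_pos k with hk | hk
  · have n5 : 0 ≤ (mu θ w)⁻¹ * (M + errConst δ θ w * (M + M * meanOut w / θ) + M / θ) := by
      positivity
    have a1 : M ^ 2 / θ * (n : ℝ) ^ (-η) ≤ H * (n : ℝ) ^ (-η) := by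
      gcongr
      linarith
    have a2 : (M ^ 2 * θ ^ (-(1 + δ)) + 2 * mu θ w) * (n : ℝ) ^ (-δ) ≤ H * (n : ℝ) ^ (-δ) := by
      gcongr
      linarith
    linarith [hzero hk]
  · by_cases hm : mu θ w = 0
    -- For `μ_n = 0` the sums over `m` vanish and give no help: either all edge probabilities are
    -- zero, or the types are degenerate.
    · by_cases hw : (∑ i, (w i).wIn) * ∑ i, (w i).wOut = 0
      · rw [hempty hw]
        linarith
      · linarith [hdeg ⟨hmu.1 hm, hw⟩]
    · have hm0 : 0 < mu θ w := lt_of_le_of_ne hμ (Ne.symm hm)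
      have hST : S = (mu θ w)⁻¹ * T := by
        rw [hT, inv_mul_cancel_left₀ hm]
      have hν : 0 ≤ (mu θ w)⁻¹ := inv_nonneg.2 hμ
      have n6 : 0 ≤ (mu θ w)⁻¹ * (M + errConst δ θ w * (M + M * meanOut w / θ)) := by positivity
      have n7 : 0 ≤ (mu θ w)⁻¹ * (M / θ) := by positivity
      rw [mul_add (mu θ w)⁻¹] at hH
      have a1 : (mu θ w)⁻¹ * (M + errConst δ θ w * (M + M * meanOut w / θ)) * (N * T) ≤
          H * (N * T) :=
        mul_le_mul_of_nonneg_right (by linarith) (mul_nonneg hN0 hT0)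
      have a2 : (mu θ w)⁻¹ * (M / θ) * (D * T) ≤ H * (D * T) :=
        mul_le_mul_of_nonneg_right (by linarith) (mul_nonneg hD0 hT0)
      have h := hpos hk
      rw [← hb_eq hk, hST] at h
      have e1 : (M + errConst δ θ w * (M + M * meanOut w / θ)) * N * ((mu θ w)⁻¹ * T) =
          (mu θ w)⁻¹ * (M + errConst δ θ w * (M + M * meanOut w / θ)) * (N * T) := by ring
      have e2 : M / θ * D * ((mu θ w)⁻¹ * T) = (mu θ w)⁻¹ * (M / θ) * (D * T) := by ring
      linarith

end

/-! ### The limit of the random variable in the bound -/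

section

variable {Ω : Type*} [MeasurableSpace Ω] {P : Measure Ω}

theorem VType.measurable_wIn : Measurable VType.wIn := by
  unfold VType.wIn
  fun_prop

theorem VType.measurable_wOut : Measurable VType.wOut := by
  unfold VType.wOut
  fun_prop

theorem measurable_weight : Measurable VType.weight :=
  (measurable_const.add VType.measurable_wIn).add VType.measurable_wOut

/-- The strong law of large numbers for functions of i.i.d. types. -/
theorem tendsto_mean {W : ℕ → Ω → VType} (hW : iIndepFun W P)
    (hid : ∀ i, IdentDistrib (W i) (W 0) P P) {f : VType → ℝ} (hf : Measurable f)
    (hint : Integrable (fun ω => f (W 0 ω)) P) :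
    ∀ᵐ ω ∂P, Tendsto (fun n : ℕ => (n : ℝ)⁻¹ * ∑ i : Fin n, f (W i ω)) atTop
      (𝓝 (∫ ω, f (W 0 ω) ∂P)) := by
  have h := strong_law_ae_real (fun i ω => f (W i ω)) hint
    (fun i j hij => (hW.indepFun hij).comp hf hf) fun i => (hid i).comp hf
  filter_upwards [h] with ω hω
  refine hω.congr fun n => ?_
  rw [Fin.sum_univ_eq_sum_range (fun i => f (W i ω)) n, div_eq_inv_mul]

/-- The weight is at most three times the maximum of `1`, `W⁺`, `W⁻`, and `3 ^ (1 + δ) ≤ 9`. If the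
maximum is `W⁻`, it is at least one, so the exponent may be raised to two. -/
theorem rpow_weight_le {δ : ℝ} (hδ : 0 < δ) (hδ1 : δ ≤ 1) (v : VType) :
    v.weight ^ (1 + δ) ≤ 9 * (1 + v.wIn ^ (1 + δ) + v.wOut ^ 2) := by
  have ha := wIn_nonneg v
  have hb := wOut_nonneg v
  have hap : 0 ≤ v.wIn ^ (1 + δ) := by positivity
  have hbp : 0 ≤ v.wOut ^ 2 := by positivity
  set m := max 1 (max v.wIn v.wOut) with hm
  have hm1 : 1 ≤ m := le_max_left _ _
  have hma : v.wIn ≤ m := (le_max_left _ _).trans (le_max_right _ _)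
  have hmb : v.wOut ≤ m := (le_max_right _ _).trans (le_max_right _ _)
  have h1 : v.weight ≤ 3 * m := by
    unfold VType.weight
    linarith
  have h3 : (3 : ℝ) ^ (1 + δ) ≤ 9 := by
    calc (3 : ℝ) ^ (1 + δ) ≤ 3 ^ (2 : ℝ) :=
          Real.rpow_le_rpow_of_exponent_le (by norm_num) (by linarith)
      _ = 9 := by norm_num
  have h4 : m ^ (1 + δ) ≤ 1 + v.wIn ^ (1 + δ) + v.wOut ^ 2 := by
    rcases max_choice (1 : ℝ) (max v.wIn v.wOut) with h | h
    · rw [hm, h, Real.one_rpow]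
      linarith
    · rcases max_choice v.wIn v.wOut with h' | h'
      · rw [hm, h, h']
        linarith
      · have hmw : m = v.wOut := by rw [hm, h, h']
        calc m ^ (1 + δ) ≤ m ^ (2 : ℝ) := Real.rpow_le_rpow_of_exponent_le hm1 (by linarith)
          _ = v.wOut ^ 2 := by rw [Real.rpow_two, hmw]
          _ ≤ _ := by linarith
  calc v.weight ^ (1 + δ) ≤ (3 * m) ^ (1 + δ) :=
        Real.rpow_le_rpow (weight_pos v).le h1 (by linarith)
    _ = 3 ^ (1 + δ) * m ^ (1 + δ) := Real.mul_rpow (by norm_num) (by linarith)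
    _ ≤ _ := by gcongr

namespace TypeAssumption

variable {V : Ω → VType} {δ : ℝ}

theorem integrable_rpow_weight [IsProbabilityMeasure P] (h : TypeAssumption P V δ)
    (hV : Measurable V) : Integrable (fun ω => (V ω).weight ^ (1 + δ)) P := by
  refine Integrable.mono' (((integrable_const (1 : ℝ)).add h.moment_in).add h.moment_out
    |>.const_mul 9) ((measurable_weight.comp hV).pow_const _).aestronglyMeasurable
    (Eventually.of_forall fun ω => ?_)
  rw [Real.norm_of_nonneg (Real.rpow_nonneg (weight_pos _).le _)]
  exact rpow_weight_le h.delta_pos h.delta_le _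

theorem integrable_weight [IsProbabilityMeasure P] (h : TypeAssumption P V δ)
    (hV : Measurable V) : Integrable (fun ω => (V ω).weight) P := by
  refine (h.integrable_rpow_weight hV).mono' (measurable_weight.comp hV).aestronglyMeasurable
    (Eventually.of_forall fun ω => ?_)
  rw [Real.norm_of_nonneg (weight_pos _).le]
  exact weight_le_rpow h.delta_pos.le _

theorem integrable_wIn [IsProbabilityMeasure P] (h : TypeAssumption P V δ)
    (hV : Measurable V) : Integrable (fun ω => (V ω).wIn) P := by
  refine (h.integrable_weight hV).mono' (VType.measurable_wIn.comp hV).aestronglyMeasurable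
    (Eventually.of_forall fun ω => ?_)
  rw [Real.norm_of_nonneg (wIn_nonneg _)]
  exact wIn_le_weight _

theorem integrable_wOut [IsProbabilityMeasure P] (h : TypeAssumption P V δ)
    (hV : Measurable V) : Integrable (fun ω => (V ω).wOut) P := by
  refine (h.integrable_weight hV).mono' (VType.measurable_wOut.comp hV).aestronglyMeasurable
    (Eventually.of_forall fun ω => ?_)
  rw [Real.norm_of_nonneg (wOut_nonneg _)]
  exact wOut_le_weight _

theorem indepFun_wIn_wOut (h : TypeAssumption P V δ) :
    IndepFun (fun ω => (V ω).wIn) (fun ω => (V ω).wOut) P :=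
  h.indep.comp measurable_fst measurable_fst

theorem integrable_mul [IsProbabilityMeasure P] (h : TypeAssumption P V δ)
    (hV : Measurable V) : Integrable (fun ω => (V ω).wIn * (V ω).wOut) P :=
  h.indepFun_wIn_wOut.integrable_mul (h.integrable_wIn hV) (h.integrable_wOut hV)

theorem integral_mul [IsProbabilityMeasure P] (h : TypeAssumption P V δ) (hV : Measurable V) :
    ∫ ω, (V ω).wIn * (V ω).wOut ∂P = (∫ ω, (V ω).wIn ∂P) * ∫ ω, (V ω).wOut ∂P :=
  h.indepFun_wIn_wOut.integral_mul_eq_mul_integral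
    (VType.measurable_wIn.comp hV).aestronglyMeasurable
    (VType.measurable_wOut.comp hV).aestronglyMeasurable

/-- The product is `W⁻ + W⁺ W⁻ + (W⁻) ^ 2`: independence handles the mixed term and the second
moment the last one. -/
theorem integrable_wOut_mul_weight [IsProbabilityMeasure P] (h : TypeAssumption P V δ)
    (hV : Measurable V) : Integrable (fun ω => (V ω).wOut * (V ω).weight) P := by
  refine (((h.integrable_wOut hV).add (h.integrable_mul hV)).add h.moment_out).congr
    (Eventually.of_forall fun ω => ?_)
  simp only [Pi.add_apply, VType.weight]
  ring

end TypeAssumption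

/-- A nonnegative function of the types with mean zero vanishes at all the types. -/
theorem ae_forall_eq_zero {W : ℕ → Ω → VType} (hid : ∀ i, IdentDistrib (W i) (W 0) P P)
    {f : VType → ℝ} (hf : Measurable f) (hf0 : ∀ v, 0 ≤ f v)
    (hint : Integrable (fun ω => f (W 0 ω)) P) (h : ∫ ω, f (W 0 ω) ∂P = 0) :
    ∀ᵐ ω ∂P, ∀ i, f (W i ω) = 0 := by
  refine ae_all_iff.2 fun i => ?_
  have h1 : ∫ ω, f (W i ω) ∂P = 0 := ((hid i).comp hf).integral_eq.trans h
  exact (integral_eq_zero_iff_of_nonneg (fun ω => hf0 _)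
    (((hid i).comp hf).integrable_iff.2 hint)).1 h1

theorem tendsto_meanConst {δ θ : ℝ} {a b c d : ℕ → ℝ} {a' b' c' d' : ℝ}
    (ha : Tendsto a atTop (𝓝 a')) (hb : Tendsto b atTop (𝓝 b')) (hc : Tendsto c atTop (𝓝 c'))
    (hd : Tendsto d atTop (𝓝 d')) :
    Tendsto (fun n => meanConst δ θ (a n) (b n) (c n) (d n)) atTop
      (𝓝 (meanConst δ θ a' b' c' d')) := by
  unfold meanConst
  exact ((((tendsto_const_nhds.add ((ha.pow 2).div_const _)).add
    ((ha.pow 2).mul_const _)).add (hc.const_mul _)).add (hd.mul ((ha.add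
    (((((ha.const_mul _).div_const _).add ((ha.const_mul _).mul_const _)).add
      tendsto_const_nhds).mul (ha.add ((ha.mul hb).div_const _)))).add (ha.div_const _))))

/-- The random variable in the bound converges to a constant. -/
theorem tendsto_boundConst [IsProbabilityMeasure P] {W : ℕ → Ω → VType} {δ : ℝ} (θ : ℝ)
    (hmeas : Measurable (W 0)) (hW : iIndepFun W P) (hid : ∀ i, IdentDistrib (W i) (W 0) P P)
    (h : TypeAssumption P (W 0) δ) (hθ : 0 < θ) :
    ∃ L : ℝ, ∀ᵐ ω ∂P, Tendsto (fun n : ℕ => boundConst n δ θ fun i : Fin n => W i ω)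
      atTop (𝓝 L) := by
  have t1 := tendsto_mean hW hid (measurable_weight.pow_const (1 + δ))
    (h.integrable_rpow_weight hmeas)
  have t2 := tendsto_mean hW hid (VType.measurable_wOut.mul measurable_weight)
    (h.integrable_wOut_mul_weight hmeas)
  have t3 := tendsto_mean hW hid (VType.measurable_wIn.mul VType.measurable_wOut)
    (h.integrable_mul hmeas)
  simp only [Pi.mul_apply] at t2 t3
  set M₁ := ∫ ω, (W 0 ω).weight ^ (1 + δ) ∂P
  set M₂ := ∫ ω, (W 0 ω).wOut * (W 0 ω).weight ∂P
  set m := ∫ ω, (W 0 ω).wIn * (W 0 ω).wOut ∂P with hm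
  have hmu : ∀ (n : ℕ) (ω : Ω), mu θ (fun i : Fin n => W i ω) =
      θ⁻¹ * ((n : ℝ)⁻¹ * ∑ i : Fin n, (W i ω).wIn * (W i ω).wOut) := by
    intro n ω
    unfold mu
    rw [mul_inv, mul_assoc]
  by_cases hm0 : m = 0
  -- By independence a vanishing mean of `W⁺ W⁻` forces one of the factors to have mean zero, hence
  -- to vanish for all vertices; such types are never degenerate.
  · have hz : ∀ᵐ ω ∂P, (∀ i, (W i ω).wIn = 0) ∨ ∀ i, (W i ω).wOut = 0 := by
      rw [hm, h.integral_mul hmeas, mul_eq_zero] at hm0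
      rcases hm0 with h0 | h0
      · filter_upwards [ae_forall_eq_zero hid VType.measurable_wIn wIn_nonneg
          (h.integrable_wIn hmeas) h0] with ω hω using Or.inl hω
      · filter_upwards [ae_forall_eq_zero hid VType.measurable_wOut wOut_nonneg
          (h.integrable_wOut hmeas) h0] with ω hω using Or.inr hω
    -- Here `μ_n = 0` for all `n`, and the convention `0⁻¹ = 0` gives the last argument.
    refine ⟨meanConst δ θ M₁ M₂ 0 0, ?_⟩
    filter_upwards [t1, t2, hz] with ω h1 h2 hω
    have e : ∀ n : ℕ, boundConst n δ θ (fun i : Fin n => W i ω) =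
        meanConst δ θ (meanPow δ fun i : Fin n => W i ω) (meanOut fun i : Fin n => W i ω) 0 0 := by
      intro n
      have h3 : mu θ (fun i : Fin n => W i ω) = 0 := by
        unfold mu
        rcases hω with hω | hω <;> simp [hω]
      have h4 : ¬ Degenerate fun i : Fin n => W i ω := by
        rintro ⟨-, h4⟩
        rcases hω with hω | hω <;> simp [hω] at h4
      rw [boundConst, h3, ind_of_false h4, zero_mul, add_zero, inv_zero]
    have hM₁ : Tendsto (fun n : ℕ => meanPow δ fun i : Fin n => W i ω) atTop (𝓝 M₁) := h1
    have hM₂ : Tendsto (fun n : ℕ => meanOut fun i : Fin n => W i ω) atTop (𝓝 M₂) := h2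
    simp only [e]
    exact tendsto_meanConst hM₁ hM₂ tendsto_const_nhds tendsto_const_nhds
  · refine ⟨meanConst δ θ M₁ M₂ (θ⁻¹ * m) (θ⁻¹ * m)⁻¹, ?_⟩
    filter_upwards [t1, t2, t3] with ω h1 h2 h3
    have hM₁ : Tendsto (fun n : ℕ => meanPow δ fun i : Fin n => W i ω) atTop (𝓝 M₁) := h1
    have hM₂ : Tendsto (fun n : ℕ => meanOut fun i : Fin n => W i ω) atTop (𝓝 M₂) := h2
    have hmu' : Tendsto (fun n : ℕ => mu θ fun i : Fin n => W i ω) atTop (𝓝 (θ⁻¹ * m)) := by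
      simp only [hmu]
      exact h3.const_mul _
    have hlim := tendsto_meanConst (δ := δ) (θ := θ) hM₁ hM₂ hmu'
      (hmu'.inv₀ (mul_ne_zero (inv_ne_zero hθ.ne') hm0))
    refine hlim.congr' ?_
    -- Convergence to a nonzero limit makes `μ_n` nonzero eventually, so the degenerate summand
    -- disappears.
    filter_upwards [h3.eventually_ne hm0] with n hn
    have h4 : ¬ Degenerate fun i : Fin n => W i ω := by
      rintro ⟨h4, -⟩
      exact hn (by rw [h4, mul_zero])
    rw [boundConst, ind_of_false h4, zero_mul, add_zero]

end

end InhomDigraph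

end

theorem theoremT :
    ∃ H : (n : ℕ) → ℝ → ℝ → InhomDigraph.Types n → ℝ,
      (∀ (n : ℕ) (δ θ : ℝ), Measurable (H n δ θ)) ∧
      -- The coupling and the bound, conditionally on the types.
      (∀ (n : ℕ) (_ : 0 < n) (θ : ℝ) (_ : 0 < θ)
        (φ : InhomDigraph.Types n → Fin n → Fin n → ℝ)
        (_ : ∀ i j, Measurable fun w => φ w i j)
        (_ : ∀ w i j, i ≠ j → -1 < φ w i j),
        ∃ κ : Kernel (InhomDigraph.Types n) (InhomDigraph.Outcome n),
          InhomDigraph.IsCoupling θ φ κ ∧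
          ∀ (w : InhomDigraph.Types n) (δ η x : ℝ) (k : ℕ),
            0 < δ → δ ≤ 1 → 0 < η → η ≤ 1 → 1 ≤ x →
            (κ w).real {ω | InhomDigraph.breakStep ω ≤ (k : ℕ∞)} ≤
              H n δ θ w *
                (x⁻¹ + (n : ℝ) ^ (-δ) + (n : ℝ) ^ (-η)
                  + (n : ℝ) ^ (-δ) * x *
                      ∑ m ∈ Finset.Icc 1 k, ∑ r ∈ Finset.range m,
                        InhomDigraph.mu θ w ^ (m + r)
                  + (n : ℝ) ^ (-(min (δ / 2) η)) *
                      ∑ m ∈ Finset.Icc 1 k, InhomDigraph.mu θ w ^ m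
                  + (n : ℝ)⁻¹ * ∑ i, InhomDigraph.ind (¬ InhomDigraph.B' θ η w (φ w) i)
                  + (n : ℝ)⁻¹ *
                      ∑ i, InhomDigraph.ind (1 ≤ k ∧ ¬ InhomDigraph.B θ η w (φ w) i)
                  + (n : ℝ)⁻¹ *
                      (∑ i, InhomDigraph.ind (¬ InhomDigraph.B θ η w (φ w) i ∨
                          ¬ InhomDigraph.B' θ η w (φ w) i) * (w i).wOut) *
                      ∑ m ∈ Finset.Icc 1 k, InhomDigraph.mu θ w ^ m)) ∧
      -- The limit of the random variable in the bound, for i.i.d. types.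
      (∀ (Ω : Type*) [MeasurableSpace Ω] (P : Measure Ω) [IsProbabilityMeasure P]
        (W : ℕ → Ω → InhomDigraph.VType) (δ θ : ℝ),
        (∀ i, Measurable (W i)) → iIndepFun W P → (∀ i, IdentDistrib (W i) (W 0) P P) →
        InhomDigraph.TypeAssumption P (W 0) δ →
        θ = ∫ ω, ((W 0 ω).wIn + (W 0 ω).wOut) ∂P → 0 < θ →
        ∃ Hδ : ℝ, ∀ᵐ ω ∂P,
          Tendsto (fun n : ℕ => H n δ θ fun i : Fin n => W i ω) atTop (𝓝 Hδ)) := by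
  refine ⟨InhomDigraph.boundConst, InhomDigraph.measurable_boundConst, ?_, ?_⟩
  · intro n hn θ hθ φ hφ hφ'
    have : NeZero n := ⟨hn.ne'⟩
    obtain ⟨κ, hκ, hκ'⟩ := InhomDigraph.exists_coupling hθ.le hφ hφ'
    -- The parameters `δ`, `η`, `x`, `k` enter only the analysis of the coupling, not its
    -- construction, so one coupling serves them all.
    refine ⟨κ, hκ, fun w δ η x k hδ hδ1 hη _ hx => ?_⟩
    rw [hκ']
    exact InhomDigraph.couplingLaw_le_boundConst hθ hδ hδ1 hη (hφ' w) hx k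
  · intro Ω _ P _ W δ θ hmeas hW hid h _ hθ
    exact InhomDigraph.tendsto_boundConst θ (hmeas 0) hW hid h hθ
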